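/- \textbf{Setting.} A function $\nu:\mathbb N\to\mathbb R_{\ge 0}$ is negligible if for every $C>0$, $\nu(\lambda)\le\lambda^{-C}$ for all large $\lambda$. ``Polynomial time'' refers to probabilistic algorithms that may draw exactly uniform elements of $\{0,\dots,k-1\}$ for any $k\ge 1$. A channel over a finite alphabet $\Sigma$ assigns to each $x\in\Sigma^*$ a probability distribution $\mathcal E(x)$ on $\Sigma^*$. It is $p$-substitution-bounded if for every $n$ and $y\in\Sigma^n$, almost surely $\mathcal E(y)\in\Sigma^n$ differs from $y$ in at most $pn$ positions. It is $p$-edit-bounded if for every $x\in\Sigma^*$, almost surely $\mathcal E(x)$ can be obtained from $x$ by at most $p|x|$ substitutions, insertions and deletions (channels need not be efficiently computable). A (secret-key) \emph{pseudorandom code} (PRC) over alphabets $\Sigma(\lambda)$, with block length $n(\lambda)$ and messages in $\{0,1\}^{k(\lambda)}$, robust to collections $\mathscr E(\lambda)$ of channels over $\Sigma(\lambda)$, consists of probabilistic polynomial-time algorithms $\mathsf{Key}(1^\lambda)$, $\mathsf{Enc}(1^\lambda,\mathsf{sk},\mathsf m)\in\Sigma(\lambda)^{n(\lambda)}$ and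 $\mathsf{Dec}(1^\lambda,\mathsf{sk},y)\in\{0,1\}^{k(\lambda)}\cup\{\bot\}$ (for $y\in\Sigma(\lambda)^*$), where $n(\lambda)$, $k(\lambda)$ and the key length are polynomially bounded and $n(\lambda)$ is computable from $1^\lambda$ in polynomial time, such that for some negligible $\nu$: \begin{itemize} \item (robustness) for all $\lambda$, $\mathcal E\in\mathscr E(\lambda)$ and $\mathsf m$: $\Pr[\mathsf{Dec}(1^\lambda,\mathsf{sk},\mathcal E(\mathsf{Enc}(1^\lambda,\mathsf{sk},\mathsf m)))=\mathsf m]\ge 1-\nu(\lambda)$, where $\mathsf{sk}\gets\mathsf{Key}(1^\lambda)$; \item (soundness) for all $\lambda$ and every fixed $y\in\Sigma(\lambda)^*$: $\Pr[\mathsf{Dec}(1^\lambda,\mathsf{sk},y)=\bot]\ge 1-\nu(\lambda)$; \end{itemize} and (undetectability) for every probabilistic polynomial-time oracle algorithm $\mathsf{Adv}$, $|\Pr[\mathsf{Adv}^{\mathsf{Enc}(1^\lambda,\mathsf{sk},\cdot)}(1^\lambda)=1]-\Pr[\mathsf{Adv}^{\mathcal U}(1^\lambda)=1]|$ is at most a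 negligible function of $\lambda$, where $\mathcal U$ answers every query with a fresh uniformly random element of $\Sigma(\lambda)^{n(\lambda)}$. \textbf{Construction.} Let $\mathsf{PRC}_S=(\mathsf{Key}_S,\mathsf{Enc}_S,\mathsf{Dec}_S)$ be a PRC over $\{0,1\}$ with block length $n=n(\lambda)$, and let $\rho\ge 1$ be an integer. Put $m=\lceil n\ln 2\rceil$. The code $\mathsf{PRC}_I[\mathsf{PRC}_S,\rho]$ over the alphabet $[\rho n]$, with block length $m$ and the same messages as $\mathsf{PRC}_S$, is as follows. \begin{itemize} \item $\mathsf{Key}$: output $(\mathsf{sk},\psi)$ with $\mathsf{sk}\gets\mathsf{Key}_S(1^\lambda)$ and, independently, $\psi:[\rho n]\to[n]$ uniformly random subject to $|\psi^{-1}(j)|=\rho$ for all $j$. \item $\mathsf{Enc}$ of $\mathsf m$ under $(\mathsf{sk},\psi)$: let $y^0\gets\mathsf{Enc}_S(1^\lambda,\mathsf{sk},\mathsf m)$ and $y\gets\mathsf{PerturbDifference}(n,m,y^0)$, and output $z\in[\rho n]^m$ with independent uniformly random $z_j\in\psi^{-1}(y_j)$. \item $\mathsf{Dec}$ of $z$ under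 $(\mathsf{sk},\psi)$: output $\mathsf{Dec}_S(1^\lambda,\mathsf{sk},y')$, where $y'\in\{0,1\}^n$ has $y'_i=1$ if and only if $i=\psi(z_j)$ for some $j$. \item $\mathsf{PerturbDifference}(n,m,y^0)$: let $S^0=\{i:y^0_i=1\}$, sample $y^1\in[n]^m$ uniformly, and let $S^1$ be the set of symbols of $y^1$. If $|S^0\setminus S^1|\ge|S^1\setminus S^0|$, draw a uniformly random injection $\sigma:S^1\setminus S^0\to S^0\setminus S^1$ and replace each instance in $y^1$ of each $a\in S^1\setminus S^0$ by $\sigma(a)$. Otherwise draw a uniformly random injection $\tau:S^0\setminus S^1\to S^1\setminus S^0$ and, for each $a\in S^0\setminus S^1$, replace each instance of $\tau(a)$ in $y^1$ by $a$. Output the resulting string. \end{itemize} \textbf{Theorem.} There are constants $C_0,C_{\mathrm{rob}}\ge 1$ such that the following holds. Let $0<p_0<(10\,C_{\mathrm{rob}})^{-1}$, let $\mathsf{PRC}_S$ be a PRC over $\{0,1\}$ with block length $n(\lambda)\ge\lambda$ that is robust to all $(1/2-p_0)$-substitution-bounded channels, and let $\rho\ge C_0/p_0$ be an integer. Then $\mathsf{PRC}_I[\mathsf{PRC}_S,\rho]$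 is a PRC over an alphabet of size $\lceil\rho\, n(\lambda)\rceil=\rho\,n(\lambda)$, with block length at most $n(\lambda)$, and it is robust to all $(1-C_{\mathrm{rob}}p_0)$-edit-bounded channels. -/

import Mathlib

/-!
# Secret-key pseudorandom codes and the indexing construction

Part 1 fixes a model of probabilistic (oracle) computation with an explicit cost.
Part 2 defines secret-key pseudorandom codes.
Part 3 defines the channels, part 4 the indexing construction.
-/

noncomputable section

namespace PRCode

/-! ## Part 1: probabilistic polynomial time -/

/-- Finite data: binary trees whose leaves are natural numbers (written in binary). -/
inductive Data : Type where
  | num : ℕ → Data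
  | pair : Data → Data → Data

/-- Number of bits (up to a constant factor) of a piece of data. -/
def Data.size : Data → ℕ
  | .num n => Nat.size n + 1
  | .pair a b => a.size + b.size + 1

/-- Lists are coded as `[] ↦ 0` and `a :: l ↦ (a, l)`. -/
def Data.ofList : List Data → Data
  | [] => .num 0
  | a :: l => .pair a (Data.ofList l)

/-- The entries of a coded list. -/
def Data.toList : Data → List Data
  | .num _ => []
  | .pair a l => a :: l.toList

/-- First component (`0` on a number). -/
def Data.fst : Data → Data
  | .pair a _ => a
  | .num _ => .num 0

/-- Second component (`0` on a number). -/
def Data.snd : Data → Data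
  | .pair _ b => b
  | .num _ => .num 0

/-- `1` on a pair, `0` on a number. -/
def Data.isPair : Data → Data
  | .pair _ _ => .num 1
  | .num _ => .num 0

/-- The test for the number `0`. -/
def Data.isZero : Data → Bool
  | .num 0 => true
  | _ => false

/-- A binary operation on numbers, applied to a pair of numbers (`0` on any other input). -/
def Data.arith (f : ℕ → ℕ → ℕ) : Data → Data
  | .pair (.num a) (.num b) => .num (f a b)
  | _ => .num 0

/-- Programs of a small structured programming language.  A program maps data to (random) data.
Every basic operation is charged for the bits that it reads and writes, so running times agree
with those of Turing machines up to a polynomial.  The number of rounds of a loop is fixed on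
entry; this does not restrict polynomial-time algorithms, which can compute their own time bound
(a polynomial) first and then loop over single steps.  Uniform sampling from `{0, …, k - 1}` is a
basic operation, because exactly uniform symbols and random maps have to be drawn in strictly
bounded time. -/
inductive Prog : Type where
  /-- return the input -/
  | id : Prog
  /-- return a fixed piece of data -/
  | const : Data → Prog
  /-- projections, and the test whether the input is a pair -/
  | fst : Prog
  | snd : Prog
  | isPair : Prog
  /-- the size of the input, as a number -/
  | size : Prog
  /-- sum, truncated difference, product and integer quotient of a pair of numbers -/
  | add : Prog
  | sub : Prog
  | mul : Prog
  | div : Prog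
  /-- `fork f g` runs `f` and `g` on the input and returns the pair of results -/
  | fork : Prog → Prog → Prog
  /-- `comp g f` runs `f` on the input and then `g` on the result -/
  | comp : Prog → Prog → Prog
  /-- `ite c f g` runs `c` on the input, then `g` (if the result was `0`) or `f` on the input -/
  | ite : Prog → Prog → Prog → Prog
  /-- on input `(t, x)`, apply the body `t` times in succession to `x` -/
  | loop : Prog → Prog
  /-- on input `k ≥ 1`, draw a fresh uniformly random element of `{0, …, k - 1}` -/
  | rand : Prog
  /-- query the oracle with the input and return its answer -/
  | ask : Prog

/-- An oracle: answers every query with a fresh sample from a distribution that depends on the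
query. -/
abbrev Oracle : Type := Data → PMF Data

/-- The outcome of a basic operation that turns `x` into `y`: the result and its cost, namely
one step plus the number of bits read and written. -/
def basic (x y : Data) : Data × ℕ := (y, 1 + x.size + y.size)

/-- `t`-fold iteration of a random procedure with a cost; each round has one step of overhead. -/
def iterCost (F : Data → PMF (Data × ℕ)) : ℕ → Data → PMF (Data × ℕ)
  | 0, x => PMF.pure (x, 1)
  | t + 1, x =>
      (F x).bind fun r => (iterCost F t r.1).map fun s => (s.1, r.2 + s.2 + 1)

/-- A uniformly random element of `{0, …, k - 1}` (and `0` for `k = 0`). -/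
def uniformBelow : ℕ → PMF ℕ
  | 0 => PMF.pure 0
  | k + 1 => (PMF.uniformOfFintype (Fin (k + 1))).map fun i => (i : ℕ)

/-- Semantics: the joint distribution of the output and the running time of a program, given an
oracle and an input. -/
def Prog.run (O : Oracle) : Prog → Data → PMF (Data × ℕ)
  | .id, x => PMF.pure (basic x x)
  | .const c, x => PMF.pure (basic x c)
  | .fst, x => PMF.pure (basic x x.fst)
  | .snd, x => PMF.pure (basic x x.snd)
  | .isPair, x => PMF.pure (basic x x.isPair)
  | .size, x => PMF.pure (basic x (.num x.size))
  | .add, x => PMF.pure (basic x (x.arith fun a b => a + b))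
  | .sub, x => PMF.pure (basic x (x.arith fun a b => a - b))
  | .mul, x => PMF.pure (basic x (x.arith fun a b => a * b))
  | .div, x => PMF.pure (basic x (x.arith fun a b => a / b))
  | .fork f g, x =>
      (f.run O x).bind fun r => (g.run O x).map fun s =>
        (.pair r.1 s.1, r.2 + s.2 + 1 + (Data.pair r.1 s.1).size)
  | .comp g f, x =>
      (f.run O x).bind fun r => (g.run O r.1).map fun s => (s.1, r.2 + s.2 + 1)
  | .ite c f g, x =>
      (c.run O x).bind fun r =>
        (if r.1.isZero then g.run O x else f.run O x).map fun s => (s.1, r.2 + s.2 + 1)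
  | .loop f, .pair (.num t) x => iterCost (f.run O) t x
  | .loop _, x => PMF.pure (basic x x)
  | .rand, .num k => (uniformBelow k).map fun i => basic (.num k) (.num i)
  | .rand, x => PMF.pure (basic x (.num 0))
  | .ask, x => (O x).map fun y => basic x y

/-- The output distribution of a program. -/
def Prog.output (P : Prog) (O : Oracle) (x : Data) : PMF Data :=
  (P.run O x).map Prod.fst

/-- The program never runs for more than `T` steps on this input with this oracle. -/
def Prog.RunsWithin (P : Prog) (O : Oracle) (x : Data) (T : ℕ) : Prop :=
  ∀ r ∈ (P.run O x).support, r.2 ≤ T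

/-- The oracle used for algorithms without oracle access. -/
def noOracle : Oracle := fun _ => PMF.pure (.num 0)

/-- The family of distributions `out i` is sampled by one probabilistic polynomial-time
algorithm, which is given the input `inp i` and runs in time polynomial in the security
parameter `sec i` and the length of its input. -/
def IsPPT {ι : Type} (sec : ι → ℕ) (inp : ι → Data) (out : ι → PMF Data) : Prop :=
  ∃ (P : Prog) (p : Polynomial ℕ), ∀ i,
    P.output noOracle (inp i) = out i ∧
    P.RunsWithin noOracle (inp i) (p.eval (sec i + (inp i).size))

/-! ## Part 2: secret-key pseudorandom codes -/

/-- A function `ℕ → ℝ≥0` that eventually lies below every inverse polynomial. -/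
def Negligible (f : ℕ → ℝ) : Prop :=
  (∀ l, 0 ≤ f l) ∧ ∀ C : ℝ, 0 < C → ∃ l₀ : ℕ, ∀ l : ℕ, l₀ < l → f l ≤ (l : ℝ) ^ (-C)

/-- Code of a string over the alphabet `{0, …, q - 1}`. -/
def codeString {q : ℕ} (x : List (Fin q)) : Data :=
  Data.ofList (x.map fun a => Data.num a.val)

/-- Code of an element of `Σ^n`. -/
def codeWord {q n : ℕ} (x : Fin n → Fin q) : Data := codeString (List.ofFn x)

/-- Code of the result of decoding; `none` stands for `⊥`. -/
def codeResult {k : ℕ} : Option (Fin k → Fin 2) → Data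
  | none => .num 0
  | some msg => .pair (.num 1) (codeWord msg)

/-- Reads arbitrary data as a `k`-bit message, so that every oracle query is a legal one;
`readMsg k (codeWord msg) = msg`. -/
def readMsg (k : ℕ) (d : Data) : Fin k → Fin 2 :=
  fun i => if (d.toList.getD i (.num 0)).isZero then 0 else 1

/-- The three algorithms of a secret-key code over the alphabets `Σ(l) = {0, …, q l - 1}`, with
block length `blockLength l` and messages in `{0,1}^(msgLength l)`, as (families of)
distributions.  Keys are pieces of data, given through an injective coding. -/
structure Scheme (q : ℕ → ℕ) where
  blockLength : ℕ → ℕ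
  msgLength : ℕ → ℕ
  Key : ℕ → Type
  codeKey : ∀ l, Key l → Data
  codeKey_injective : ∀ l, Function.Injective (codeKey l)
  key : ∀ l, PMF (Key l)
  enc : ∀ l, Key l → (Fin (msgLength l) → Fin 2) → PMF (Fin (blockLength l) → Fin (q l))
  dec : ∀ l, Key l → List (Fin (q l)) → PMF (Option (Fin (msgLength l) → Fin 2))

/-- A channel over `Σ`: a distribution over `Σ^*` for each string in `Σ^*`. -/
abbrev Channel (α : Type) : Type := List α → PMF (List α)

namespace Scheme

variable {q : ℕ → ℕ}

/-- The size of the alphabet of a scheme. -/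
def alphabetSize (_ : Scheme q) : ℕ → ℕ := q

/-- Words of the right length exist, since the encoder outputs one. -/
theorem nonempty_word (S : Scheme q) (l : ℕ) :
    Nonempty (Fin (S.blockLength l) → Fin (q l)) := by
  obtain ⟨sk, _⟩ := (S.key l).support_nonempty
  obtain ⟨x, _⟩ := (S.enc l sk fun _ => 0).support_nonempty
  exact ⟨x⟩

/-- `Key`, `Enc` and `Dec` are probabilistic polynomial-time algorithms; the block length,
message length and key length are polynomially bounded, and the block length can be computed
from `1^l` in polynomial time. -/
structure Efficient (S : Scheme q) : Prop where
  key_ppt : IsPPT (fun l : ℕ => l) (fun l => Data.num l)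
    (fun l => (S.key l).map (S.codeKey l))
  enc_ppt : IsPPT
    (fun i : Σ l, S.Key l × (Fin (S.msgLength l) → Fin 2) => i.1)
    (fun i => .pair (.num i.1) (.pair (S.codeKey i.1 i.2.1) (codeWord i.2.2)))
    (fun i => (S.enc i.1 i.2.1 i.2.2).map codeWord)
  dec_ppt : IsPPT
    (fun i : Σ l, S.Key l × List (Fin (q l)) => i.1)
    (fun i => .pair (.num i.1) (.pair (S.codeKey i.1 i.2.1) (codeString i.2.2)))
    (fun i => (S.dec i.1 i.2.1 i.2.2).map codeResult)
  blockLength_ppt : IsPPT (fun l : ℕ => l) (fun l => Data.num l)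
    (fun l => PMF.pure (Data.num (S.blockLength l)))
  lengths_poly : ∃ p : Polynomial ℕ, ∀ l,
    S.blockLength l ≤ p.eval l ∧ S.msgLength l ≤ p.eval l ∧
    ∀ sk : S.Key l, (S.codeKey l sk).size ≤ p.eval l

/-- The result of decoding a message that was encoded and then sent through a channel. -/
def transmit (S : Scheme q) (l : ℕ) (E : Channel (Fin (q l)))
    (msg : Fin (S.msgLength l) → Fin 2) : PMF (Option (Fin (S.msgLength l) → Fin 2)) :=
  (S.key l).bind fun sk => (S.enc l sk msg).bind fun x =>
    (E (List.ofFn x)).bind fun y => S.dec l sk y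

/-- Robustness to the collections `C l` of channels. -/
def Robust (S : Scheme q) (C : ∀ l, Set (Channel (Fin (q l)))) : Prop :=
  ∃ ν : ℕ → ℝ, Negligible ν ∧ ∀ l, ∀ E ∈ C l, ∀ msg : Fin (S.msgLength l) → Fin 2,
    1 - ν l ≤ (S.transmit l E msg (some msg)).toReal

/-- Soundness: every fixed string is rejected with overwhelming probability. -/
def Sound (S : Scheme q) : Prop :=
  ∃ ν : ℕ → ℝ, Negligible ν ∧ ∀ l, ∀ y : List (Fin (q l)),
    1 - ν l ≤ (((S.key l).bind fun sk => S.dec l sk y) none).toReal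

/-- The oracle that answers the query `msg` with a sample from `f msg`. -/
def wordOracle (S : Scheme q) (l : ℕ)
    (f : (Fin (S.msgLength l) → Fin 2) → PMF (Fin (S.blockLength l) → Fin (q l))) : Oracle :=
  fun d => (f (readMsg (S.msgLength l) d)).map codeWord

/-- A uniformly random string of length `blockLength l`. -/
def uniformWord (S : Scheme q) (l : ℕ) : PMF (Fin (S.blockLength l) → Fin (q l)) :=
  haveI := S.nonempty_word l
  PMF.uniformOfFintype _

/-- A probabilistic polynomial-time adversary: on input `1^l`, and for every oracle that answers
messages with strings in `Σ(l)^(blockLength l)`, it runs in time polynomial in `l`. -/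
def IsAdversary (S : Scheme q) (A : Prog) : Prop :=
  ∃ p : Polynomial ℕ, ∀ l, ∀ f, A.RunsWithin (S.wordOracle l f) (.num l) (p.eval l)

/-- The probability that the adversary outputs `1` when its oracle is `Enc(1^l, sk, ·)` for a
random key `sk`. -/
def probReal (S : Scheme q) (A : Prog) (l : ℕ) : ℝ :=
  (((S.key l).bind fun sk => A.output (S.wordOracle l (S.enc l sk)) (.num l)) (.num 1)).toReal

/-- The probability that the adversary outputs `1` when its oracle answers each query with a
fresh uniformly random string. -/
def probIdeal (S : Scheme q) (A : Prog) (l : ℕ) : ℝ :=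
  ((A.output (S.wordOracle l fun _ => S.uniformWord l) (.num l)) (.num 1)).toReal

/-- Undetectability: no probabilistic polynomial-time adversary can tell the two oracles apart. -/
def Undetectable (S : Scheme q) : Prop :=
  ∀ A : Prog, S.IsAdversary A →
    ∃ ν : ℕ → ℝ, Negligible ν ∧ ∀ l, |S.probReal A l - S.probIdeal A l| ≤ ν l

/-- `S` is a secret-key pseudorandom code with robustness to the channels in `C`. -/
structure IsPRC (S : Scheme q) (C : ∀ l, Set (Channel (Fin (q l)))) : Prop where
  efficient : S.Efficient
  robust : S.Robust C
  sound : S.Sound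
  undetectable : S.Undetectable

end Scheme

/-! ## Part 3: channels -/

/-- `p`-substitution-bounded channels: the output has the length `n` of the input and Hamming
distance at most `p n` from it, almost surely. -/
def SubstitutionBounded {α : Type} [DecidableEq α] (p : ℝ) (E : Channel α) : Prop :=
  ∀ (n : ℕ) (y : Fin n → α), ∀ z ∈ (E (List.ofFn y)).support,
    ∃ w : Fin n → α, z = List.ofFn w ∧ (hammingDist y w : ℝ) ≤ p * n

/-- A single substitution, insertion or deletion. -/
inductive EditStep {α : Type} : List α → List α → Prop where
  | subst (u v : List α) (a b : α) : EditStep (u ++ a :: v) (u ++ b :: v)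
  | insert (u v : List α) (b : α) : EditStep (u ++ v) (u ++ b :: v)
  | delete (u v : List α) (a : α) : EditStep (u ++ a :: v) (u ++ v)

/-- `Edits k x y`: the string `y` is obtained from `x` by `k` successive edits. -/
inductive Edits {α : Type} : ℕ → List α → List α → Prop where
  | refl (x : List α) : Edits 0 x x
  | step {k : ℕ} {x y z : List α} : Edits k x y → EditStep y z → Edits (k + 1) x z

/-- `p`-edit-bounded channels: the output is obtained from the input `x` by at most `p |x|`
substitutions, insertions and deletions, almost surely.  (The channel need not be efficient.) -/
def EditBounded {α : Type} (p : ℝ) (E : Channel α) : Prop :=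
  ∀ x : List α, ∀ y ∈ (E x).support, ∃ k : ℕ, (k : ℝ) ≤ p * x.length ∧ Edits k x y

/-! ## Part 4: the indexing construction -/

/-- The maps `ψ : [ρ n] → [n]` all of whose fibres have exactly `ρ` elements. -/
abbrev BalancedMap (ρ n : ℕ) : Type :=
  {ψ : Fin (ρ * n) → Fin n // ∀ j, (Finset.univ.filter fun a => ψ a = j).card = ρ}

instance nonempty_balancedMap (ρ n : ℕ) : Nonempty (BalancedMap ρ n) := by
  refine ⟨⟨fun a => (finProdFinEquiv.symm a).2, fun j => ?_⟩⟩
  have hinj : Function.Injective fun i : Fin ρ => finProdFinEquiv (i, j) := fun i i' h =>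
    (Prod.ext_iff.1 (finProdFinEquiv.injective h)).1
  have h : (Finset.univ.filter fun a : Fin (ρ * n) => (finProdFinEquiv.symm a).2 = j) =
      (Finset.univ : Finset (Fin ρ)).image fun i => finProdFinEquiv (i, j) := by
    ext a
    rw [Finset.mem_filter, Finset.mem_image]
    constructor
    · rintro ⟨_, ha⟩
      refine ⟨(finProdFinEquiv.symm a).1, Finset.mem_univ _, ?_⟩
      rw [← ha]
      exact finProdFinEquiv.apply_symm_apply a
    · rintro ⟨i, _, rfl⟩
      exact ⟨Finset.mem_univ _, congrArg Prod.snd (finProdFinEquiv.symm_apply_apply (i, j))⟩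
  rw [h, Finset.card_image_of_injective _ hinj, Finset.card_univ, Fintype.card_fin]

/-- The set of the distinct symbols of a word. -/
def unique {m n : ℕ} (y : Fin m → Fin n) : Finset (Fin n) := Finset.univ.image y

/-- The set of positions where a binary word has a `1`. -/
def ones {n : ℕ} (y₀ : Fin n → Fin 2) : Finset (Fin n) :=
  Finset.univ.filter fun i => y₀ i = 1

/-- Replace each instance in `y₁` of a symbol `a ∈ A` by `σ a`. -/
def replaceBy {m n : ℕ} {A B : Finset (Fin n)} (σ : A ↪ B) (y₁ : Fin m → Fin n) :
    Fin m → Fin n :=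
  fun j => if h : y₁ j ∈ A then (σ ⟨y₁ j, h⟩ : Fin n) else y₁ j

open Classical in
/-- For each `a ∈ A`, replace each instance of `τ a` in `y₁` by `a`. -/
def replaceFrom {m n : ℕ} {A B : Finset (Fin n)} (τ : A ↪ B) (y₁ : Fin m → Fin n) :
    Fin m → Fin n :=
  fun j => if h : ∃ a : A, (τ a : Fin n) = y₁ j then (h.choose : Fin n) else y₁ j

theorem nonempty_embedding {n : ℕ} {A B : Finset (Fin n)} (h : A.card ≤ B.card) :
    Nonempty (A ↪ B) := by
  apply Function.Embedding.nonempty_of_card_le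
  simpa using h

/-- The second half of `PerturbDifference`, given the sample `y₁`. -/
def perturbWith {m n : ℕ} (y₀ : Fin n → Fin 2) (y₁ : Fin m → Fin n) : PMF (Fin m → Fin n) :=
  if h : (unique y₁ \ ones y₀).card ≤ (ones y₀ \ unique y₁).card then
    haveI := nonempty_embedding h
    (PMF.uniformOfFintype (↥(unique y₁ \ ones y₀) ↪ ↥(ones y₀ \ unique y₁))).map
      fun σ => replaceBy σ y₁
  else
    haveI := nonempty_embedding (le_of_not_ge h)
    (PMF.uniformOfFintype (↥(ones y₀ \ unique y₁) ↪ ↥(unique y₁ \ ones y₀))).map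
      fun τ => replaceFrom τ y₁

/-- `PerturbDifference(n, m, y₀)`. -/
def perturbDifference (n m : ℕ) [Nonempty (Fin m → Fin n)] (y₀ : Fin n → Fin 2) :
    PMF (Fin m → Fin n) :=
  (PMF.uniformOfFintype (Fin m → Fin n)).bind fun y₁ => perturbWith y₀ y₁

theorem fibre_nonempty {ρ n m : ℕ} (hρ : 0 < ρ) (ψ : BalancedMap ρ n) (y : Fin m → Fin n) :
    (Fintype.piFinset fun j => Finset.univ.filter fun a => ψ.1 a = y j).Nonempty := by
  rw [Fintype.piFinset_nonempty]
  intro j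
  rw [← Finset.card_pos, ψ.2 (y j)]
  exact hρ

/-- Independent uniformly random preimages `z_j` of the `y_j` under `ψ` (that is, a uniformly
random element of the product of the fibres). -/
def liftWord {ρ n m : ℕ} (hρ : 0 < ρ) (ψ : BalancedMap ρ n) (y : Fin m → Fin n) :
    PMF (Fin m → Fin (ρ * n)) :=
  PMF.uniformOfFinset (Fintype.piFinset fun j => Finset.univ.filter fun a => ψ.1 a = y j)
    (fibre_nonempty hρ ψ y)

/-- The binary word whose `i`-th entry is `1` iff `i` occurs among the symbols `ψ(z_j)`. -/
def indicatorWord {ρ n : ℕ} (ψ : BalancedMap ρ n) (z : List (Fin (ρ * n))) : Fin n → Fin 2 :=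
  fun i => if i ∈ z.map ψ.1 then 1 else 0

/-- The block length `⌈ln(2) n⌉`. -/
def indexLength (n : ℕ) : ℕ := ⌈Real.log 2 * (n : ℝ)⌉₊

instance nonempty_indexWord (n : ℕ) : Nonempty (Fin (indexLength n) → Fin n) := by
  rcases Nat.eq_zero_or_pos n with rfl | hn
  · have : indexLength 0 = 0 := by simp [indexLength]
    rw [this]
    exact ⟨Fin.elim0⟩
  · exact ⟨fun _ => ⟨0, hn⟩⟩

theorem ofList_injective : Function.Injective Data.ofList := by
  intro l
  induction l with
  | nil => intro l' h; cases l' <;> simp_all [Data.ofList]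
  | cons a l ih =>
    intro l' h
    cases l' with
    | nil => simp [Data.ofList] at h
    | cons b l' =>
      simp only [Data.ofList, Data.pair.injEq] at h
      rw [h.1, ih h.2]

theorem codeWord_injective {q n : ℕ} :
    Function.Injective (codeWord : (Fin n → Fin q) → Data) := by
  intro x y h
  have h1 := ofList_injective h
  have h2 : Function.Injective fun a : Fin q => Data.num a.val := by
    intro a b hab
    simpa [Fin.ext_iff] using hab
  exact List.ofFn_injective (List.map_injective_iff.2 h2 h1)

/-- The indexing construction `PRC_I[S, ρ]` for a code `S` over the binary alphabet. -/
def indexing (S : Scheme fun _ => 2) (ρ : ℕ) (hρ : 0 < ρ) :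
    Scheme fun l => ρ * S.blockLength l where
  blockLength l := indexLength (S.blockLength l)
  msgLength := S.msgLength
  Key l := S.Key l × BalancedMap ρ (S.blockLength l)
  codeKey l sk := .pair (S.codeKey l sk.1) (codeWord sk.2.1)
  codeKey_injective l := by
    rintro ⟨s, ψ⟩ ⟨s', ψ'⟩ h
    simp only [Data.pair.injEq] at h
    exact Prod.ext (S.codeKey_injective l h.1) (Subtype.ext (codeWord_injective h.2))
  key l :=
    (S.key l).bind fun sk =>
      (PMF.uniformOfFintype (BalancedMap ρ (S.blockLength l))).map fun ψ => (sk, ψ)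
  enc l sk msg :=
    (S.enc l sk.1 msg).bind fun y₀ =>
      (perturbDifference (S.blockLength l) (indexLength (S.blockLength l)) y₀).bind fun y =>
        liftWord hρ sk.2 y
  dec l sk z := S.dec l sk.1 (List.ofFn (indicatorWord sk.2 z))

end PRCode

end

/-!
The indexing construction turns a binary pseudorandom code into one for edits: the set of ones of
the binary codeword is, up to a perturbation, transmitted as a set of indices, each sent as a random
one of its `ρ` synonyms. The decoder reads off the set of received indices, so the order of the
symbols is irrelevant, and an edit makes at most one symbol appear and at most one disappear
(`PRCode.Edits.card_sdiff_le`).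

*Undetectability.* The perturbation relabels a uniform word by a permutation of the symbols
(`PRCode.exists_perturbed_eq`), and it is equivariant under relabelling of all its inputs
(`PRCode.perturbed_equivariant`). If the binary word is uniform, the law of the perturbed word is
therefore invariant under relabelling, hence exactly uniform
(`PRCode.bind_perturbDifference_uniform`), and so is the word of synonyms
(`PRCode.bind_liftWord_uniform`). An adversary against the binary code draws the map `ψ`, runs a
given adversary against the indexing construction, and post-processes the answers of its own oracle;
this simulation is exact and costs a polynomial factor (`PRCode.output_relay`, `PRCode.relay_cost`,
`PRCode.Scheme.exists_adversary`).

*Soundness.* For each fixed `ψ`, the decoder is the binary decoder on a fixed word.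

*Robustness.* Up to failures of the binary decoder, a decoding error needs a word that is recovered
at distance more than `1/2 - p` from the binary codeword, as otherwise the whole construction,
channel included, acts on the binary codeword like a substitution-bounded channel
(`PRCode.Scheme.transmit_indexing_ge`). The weight of a codeword is within `p * n` of `n / 2` with
overwhelming probability: otherwise a substitution-bounded channel could replace it by a constant
word, which a sound decoder rejects (`PRCode.Scheme.expect_close_le`). For such a codeword, the
relabelling of the perturbation is moved into the balanced map, so that the sent word `z` becomes
uniform and independent of `ψ`, and of the codeword. Then `z` has few repetitions
(`PRCode.card_repeats_le`), and the number of values that `ψ` misses on a fixed set of size `t` is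
concentrated around `n * exp (-t / n)`, by a bound for its moment generating function
(`PRCode.sum_exp_missed_le`, `PRCode.card_abs_missed_sub_gt_le`). Applied to the sets of sent
symbols, of received symbols, and to their union, this bounds the distance of the recovered word
(`PRCode.card_symmDiff_image_le`, `PRCode.expect_received_far_le`): about half of the values are hit
since the length is about `n * log 2`, and fewer edits than symbols leave a margin.

*Efficiency.* Polynomial time is handled by a typed notion, `PRCode.PolyTime`, closed under
composition and under folds over lists (`PRCode.PolyTime.fold`). The random choices are reduced to
uniform numbers and to a shuffle of a list, and the programs sample the prescribed distributions
exactly (`PRCode.postprocess_eq`, `PRCode.randomBalanced_eq`). The block length `⌈n * log 2⌉` is the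
delicate point: an approximation of `log 2` decides the rounding only if `n * log 2` is not too
close to an integer. This follows from a quantitative irrationality of `log 2`
(`PRCode.exists_le_abs_sub_log_two`), obtained from the integrals of `((u-1)(2-u)/u)^N/u` over `[1,
2]`: they are exponentially small and positive, and become integer combinations of `1` and `log 2`
when multiplied by the least common multiple of `1, …, N`.
-/

noncomputable section
namespace PRCode

/-! ### Semantics of the program constructors -/

theorem eval_mono (p : Polynomial ℕ) {a b : ℕ} (h : a ≤ b) : p.eval a ≤ p.eval b := by
  rw [Polynomial.eval_eq_sum, Polynomial.eval_eq_sum]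
  exact Finset.sum_le_sum fun i _ => Nat.mul_le_mul_left _ (Nat.pow_le_pow_left h i)

/-- `t`-fold iteration of a random map. -/
def iter {α : Type} (F : α → PMF α) : ℕ → α → PMF α
  | 0, x => PMF.pure x
  | t + 1, x => (F x).bind (iter F t)

theorem Data.size_pos (d : Data) : 1 ≤ d.size := by cases d <;> simp [Data.size]

theorem output_comp (O : Oracle) (g f : Prog) (x : Data) :
    (Prog.comp g f).output O x = (f.output O x).bind (g.output O) := by
  simp only [Prog.output, Prog.run, PMF.map_bind, PMF.bind_map, PMF.map_comp]
  rfl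

theorem output_fork (O : Oracle) (f g : Prog) (x : Data) :
    (Prog.fork f g).output O x =
      (f.output O x).bind fun a => (g.output O x).map fun b => Data.pair a b := by
  simp only [Prog.output, Prog.run, PMF.map_bind, PMF.bind_map, PMF.map_comp]
  rfl

theorem output_ite (O : Oracle) (c f g : Prog) (x : Data) :
    (Prog.ite c f g).output O x =
      (c.output O x).bind fun r => if r.isZero then g.output O x else f.output O x := by
  simp only [Prog.output, Prog.run, PMF.map_bind, PMF.bind_map, PMF.map_comp]
  congr 1; funext r
  by_cases h : r.1.isZero <;> simp [h] <;> rfl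

theorem map_fst_iterCost (F : Data → PMF (Data × ℕ)) (t : ℕ) (x : Data) :
    (iterCost F t x).map Prod.fst = iter (fun y => (F y).map Prod.fst) t x := by
  induction t generalizing x with
  | zero => simp [iterCost, iter, PMF.pure_map]
  | succ t ih =>
    simp only [iterCost, iter, PMF.map_bind, PMF.map_comp, PMF.bind_map, Function.comp_def, ← ih]

theorem output_loop (O : Oracle) (f : Prog) (t : ℕ) (x : Data) :
    (Prog.loop f).output O (.pair (.num t) x) = iter (f.output O) t x := by
  simp only [Prog.output, Prog.run, map_fst_iterCost]; rfl

theorem mem_support_iterCost_size {F : Data → PMF (Data × ℕ)}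
    (hF : ∀ x, ∀ r ∈ (F x).support, r.1.size ≤ r.2 + x.size) (t : ℕ) (x : Data) :
    ∀ r ∈ (iterCost F t x).support, r.1.size ≤ r.2 + x.size := by
  induction t generalizing x with
  | zero => simp [iterCost]
  | succ t ih =>
    intro r hr
    simp only [iterCost, PMF.mem_support_bind_iff, PMF.support_map, Set.mem_image] at hr
    obtain ⟨a, ha, b, hb, rfl⟩ := hr
    have h1 := hF x a ha
    have h2 := ih a.1 b hb
    simp only
    omega

/-- The output of a program is not longer than its running time plus the length of the input. -/
theorem size_le_of_mem_run (O : Oracle) (P : Prog) (x : Data) :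
    ∀ r ∈ (P.run O x).support, r.1.size ≤ r.2 + x.size := by
  induction P generalizing x with
  | fork f g hf hg =>
    intro r hr
    simp only [Prog.run, PMF.mem_support_bind_iff, PMF.support_map, Set.mem_image] at hr
    obtain ⟨a, ha, b, hb, rfl⟩ := hr
    simp only; omega
  | comp g f hg hf =>
    intro r hr
    simp only [Prog.run, PMF.mem_support_bind_iff, PMF.support_map, Set.mem_image] at hr
    obtain ⟨a, ha, b, hb, rfl⟩ := hr
    have := hf _ _ ha
    have := hg _ _ hb
    simp only; omega
  | ite c f g hc hf hg =>
    intro r hr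
    simp only [Prog.run, PMF.mem_support_bind_iff, PMF.support_map, Set.mem_image] at hr
    obtain ⟨a, ha, b, hb, rfl⟩ := hr
    have : b.1.size ≤ b.2 + x.size := by
      split at hb
      · exact hg _ _ hb
      · exact hf _ _ hb
    simp only; omega
  | loop f hf =>
    intro r hr
    match x with
    | .pair (.num t) x =>
      have := mem_support_iterCost_size hf t x r hr
      simp only [Data.size]; omega
    | .num k => simp [Prog.run, basic] at hr; subst hr; simp
    | .pair (.pair _ _) _ => simp [Prog.run, basic] at hr; subst hr; simp
  | rand =>
    intro r hr
    match x with
    | .pair a b => simp [Prog.run, basic] at hr; subst hr; simp; omega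
    | .num k =>
      simp only [Prog.run, PMF.support_map, Set.mem_image] at hr
      obtain ⟨i, _, rfl⟩ := hr
      simp [basic]; omega
  | ask =>
    intro r hr
    simp only [Prog.run, PMF.support_map, Set.mem_image] at hr
    obtain ⟨i, _, rfl⟩ := hr
    simp [basic]; omega
  | _ =>
    intro r hr
    simp only [Prog.run, PMF.support_pure, Set.mem_singleton_iff] at hr
    subst hr; simp [basic] <;> omega

/-! ### Polynomial-time random functions -/

/-- A type whose elements are coded as data.  The weight `wt` bounds the length of the code and is
the parameter in which running times are measured; it may be much larger than that length. -/
class Coded (α : Type) where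
  code : α → Data
  wt : α → ℕ
  size_le : ∀ a, (code a).size ≤ wt a

open Coded

theorem natSize_le (n : ℕ) : Nat.size n ≤ n :=
  Nat.size_le.2 Nat.lt_two_pow_self

/-- Numbers have unary weight: time polynomial in their value is allowed. -/
instance : Coded ℕ where
  code := Data.num
  wt n := n + 1
  size_le n := Nat.succ_le_succ (natSize_le n)

instance {α β : Type} [Coded α] [Coded β] : Coded (α × β) where
  code p := .pair (code p.1) (code p.2)
  wt p := wt p.1 + wt p.2 + 1
  size_le p := by
    have := size_le p.1
    have := size_le p.2
    simp only [Data.size]; omega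

/-- The weight of a list: the weights of its entries, and `1` for each cell. -/
def listWt {α : Type} [Coded α] : List α → ℕ
  | [] => 1
  | a :: l => wt a + listWt l + 1

instance {α : Type} [Coded α] : Coded (List α) where
  code l := Data.ofList (l.map code)
  wt l := listWt l
  size_le l := by
    induction l with
    | nil => simp [Data.ofList, Data.size, listWt]
    | cons a l ih =>
      have := size_le a
      simp only [List.map_cons, Data.ofList, Data.size, listWt]; omega

instance : Coded Data where
  code := _root_.id
  wt := Data.size
  size_le _ := le_rfl

/-- Numbers with the same code as in `ℕ`, but whose weight is their binary length: polynomial time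
in an argument of this type is polynomial time in its number of digits. -/
structure Bin where
  val : ℕ

instance : Coded Bin where
  code b := .num b.val
  wt b := Nat.size b.val + 1
  size_le _ := le_rfl

variable {α β γ δ : Type} [Coded α] [Coded β] [Coded γ] [Coded δ]

theorem wt_nat (n : ℕ) : wt n = n + 1 := rfl
theorem wt_prod (p : α × β) : wt p = wt p.1 + wt p.2 + 1 := rfl
theorem wt_nil : wt ([] : List α) = 1 := rfl
theorem wt_cons (a : α) (l : List α) : wt (a :: l) = wt a + wt l + 1 := rfl
theorem code_cons (a : α) (l : List α) : code (a :: l) = .pair (code a) (code l) := rfl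
theorem code_prod (p : α × β) : code p = .pair (code p.1) (code p.2) := rfl
theorem wt_bin (b : Bin) : wt b = Nat.size b.val + 1 := rfl

/-- The random function `f` is computed by one program (without oracle) in time polynomial in the
weight of the argument, and its values have polynomial weight. -/
def PolyTime (f : α → PMF β) : Prop :=
  ∃ (P : Prog) (p : Polynomial ℕ), ∀ a,
    P.output noOracle (code a) = (f a).map code ∧
    P.RunsWithin noOracle (code a) (p.eval (wt a)) ∧
    ∀ b ∈ (f a).support, wt b ≤ p.eval (wt a)

/-- Deterministic functions computable in polynomial time. -/
def PolyTimeFun (f : α → β) : Prop := PolyTime fun a => PMF.pure (f a)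

/-- Predicates decidable in polynomial time. -/
def PolyTimePred (p : α → Prop) [DecidablePred p] : Prop :=
  PolyTimeFun fun a => if p a then 1 else 0

theorem exists_of_mem_run {P : Prog} {x : Data} {f : PMF β}
    (h : P.output noOracle x = f.map code) {r : Data × ℕ}
    (hr : r ∈ (P.run noOracle x).support) : ∃ b ∈ f.support, code b = r.1 := by
  have : r.1 ∈ (P.output noOracle x).support := by
    simp only [Prog.output, PMF.support_map]; exact ⟨r, hr, rfl⟩
  rw [h, PMF.support_map] at this
  exact this

/-- Running time and weight may be bounded by two different polynomials. -/
theorem PolyTime.of_bounds {f : α → PMF β} (P : Prog) (p q : Polynomial ℕ)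
    (h : ∀ a : α, P.output noOracle (code a) = (f a).map code)
    (ht : ∀ a : α, P.RunsWithin noOracle (code a) (p.eval (wt a)))
    (hw : ∀ a, ∀ b ∈ (f a).support, wt b ≤ q.eval (wt a)) : PolyTime f := by
  refine ⟨P, p + q, fun a => ⟨h a, fun r hr => (ht a r hr).trans ?_,
    fun b hb => (hw a b hb).trans ?_⟩⟩ <;> simp

theorem PolyTime.comp {f : α → PMF β} {g : β → PMF γ} (hg : PolyTime g) (hf : PolyTime f) :
    PolyTime fun a => (f a).bind g := by
  obtain ⟨P, p, hP⟩ := hf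
  obtain ⟨Q, q, hQ⟩ := hg
  refine PolyTime.of_bounds (.comp Q P) (p + q.comp p + 1) (q.comp p) (fun a => ?_) (fun a => ?_)
    fun a c hc => ?_
  · rw [output_comp, (hP a).1, PMF.bind_map, PMF.map_bind]
    congr 1; funext b
    exact (hQ b).1
  · intro r hr
    simp only [Prog.run, PMF.mem_support_bind_iff, PMF.support_map, Set.mem_image] at hr
    obtain ⟨x, hx, y, hy, rfl⟩ := hr
    obtain ⟨b, hb, hbx⟩ := exists_of_mem_run (hP a).1 hx
    rw [← hbx] at hy
    have h1 := (hP a).2.1 x hx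
    have h2 := (hQ b).2.1 y hy
    have h3 := eval_mono q ((hP a).2.2 b hb)
    simp only [Polynomial.eval_add, Polynomial.eval_comp, Polynomial.eval_one]
    omega
  · rw [PMF.mem_support_bind_iff] at hc
    obtain ⟨b, hb, hc⟩ := hc
    have h1 := (hQ b).2.2 c hc
    have h3 := eval_mono q ((hP a).2.2 b hb)
    rw [Polynomial.eval_comp]; omega

theorem PolyTime.prod {f : α → PMF β} {g : α → PMF γ} (hf : PolyTime f) (hg : PolyTime g) :
    PolyTime fun a => (f a).bind fun b => (g a).map fun c => (b, c) := by
  obtain ⟨P, p, hP⟩ := hf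
  obtain ⟨Q, q, hQ⟩ := hg
  refine PolyTime.of_bounds (.fork P Q) (p + q + 1 + (p + q + 1)) (p + q + 1)
    (fun a => ?_) (fun a => ?_)
    fun a c hc => ?_
  · rw [output_fork, (hP a).1, (hQ a).1]
    simp only [PMF.bind_map, PMF.map_bind, PMF.map_comp]
    rfl
  · intro r hr
    simp only [Prog.run, PMF.mem_support_bind_iff, PMF.support_map, Set.mem_image] at hr
    obtain ⟨x, hx, y, hy, rfl⟩ := hr
    obtain ⟨b, hb, hbx⟩ := exists_of_mem_run (hP a).1 hx
    obtain ⟨c, hc, hcx⟩ := exists_of_mem_run (hQ a).1 hy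
    have h1 := (hP a).2.1 x hx
    have h2 := (hQ a).2.1 y hy
    have h3 := (hP a).2.2 b hb
    have h4 := (hQ a).2.2 c hc
    have h5 := size_le b
    have h6 := size_le c
    simp only [Polynomial.eval_add, Polynomial.eval_one, Data.size, ← hbx, ← hcx]
    omega
  · simp only [PMF.mem_support_bind_iff, PMF.support_map, Set.mem_image] at hc
    obtain ⟨b, hb, c, hc, rfl⟩ := hc
    have h3 := (hP a).2.2 b hb
    have h4 := (hQ a).2.2 c hc
    simp only [Polynomial.eval_add, Polynomial.eval_one, wt_prod]
    omega

/-- A function is computable in polynomial time if one basic instruction computes it and its values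
have polynomial weight. -/
theorem PolyTimeFun.of_basic {f : α → β} (P : Prog) (q : Polynomial ℕ)
    (h : ∀ a, P.run noOracle (code a) = PMF.pure (basic (code a) (code (f a))))
    (hw : ∀ a, wt (f a) ≤ q.eval (wt a)) : PolyTimeFun f := by
  refine PolyTime.of_bounds P (1 + Polynomial.X + q) q (fun a => ?_) (fun a => ?_) fun a b hb => ?_
  · simp [Prog.output, h a, PMF.pure_map, basic]
  · intro r hr
    rw [h a, PMF.support_pure, Set.mem_singleton_iff] at hr
    subst hr
    have h1 := size_le a
    have h2 := size_le (f a)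
    have h3 := hw a
    simp only [basic, Polynomial.eval_add, Polynomial.eval_one, Polynomial.eval_X]
    omega
  · rw [PMF.support_pure, Set.mem_singleton_iff] at hb
    rw [hb]; exact hw a

theorem PolyTimeFun.comp {f : α → β} {g : β → γ} (hg : PolyTimeFun g) (hf : PolyTimeFun f) :
    PolyTimeFun fun a => g (f a) := by
  have := PolyTime.comp hg hf
  unfold PolyTimeFun
  simpa only [PMF.pure_bind] using this

theorem PolyTime.compFun {f : α → β} {g : β → PMF γ} (hg : PolyTime g) (hf : PolyTimeFun f) :
    PolyTime fun a => g (f a) := by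
  have := PolyTime.comp hg hf
  simpa only [PMF.pure_bind] using this

theorem PolyTimeFun.compPMF {f : α → PMF β} {g : β → γ} (hg : PolyTimeFun g) (hf : PolyTime f) :
    PolyTime fun a => (f a).map g := PolyTime.comp hg hf

theorem PolyTimeFun.prod {f : α → β} {g : α → γ} (hf : PolyTimeFun f) (hg : PolyTimeFun g) :
    PolyTimeFun fun a => (f a, g a) := by
  have := PolyTime.prod hf hg
  unfold PolyTimeFun
  simpa only [PMF.pure_bind, PMF.pure_map] using this

theorem PolyTimeFun.id : PolyTimeFun fun a : α => a :=
  .of_basic .id Polynomial.X (fun _ => rfl) fun a => by simp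

theorem PolyTimeFun.const (b : β) : PolyTimeFun fun _ : α => b :=
  .of_basic (.const (code b)) (Polynomial.C (wt b)) (fun _ => rfl) fun a => by simp

theorem PolyTimeFun.fst : PolyTimeFun (Prod.fst : α × β → α) :=
  .of_basic .fst Polynomial.X (fun _ => rfl) fun a => by
    simp only [Polynomial.eval_X, wt_prod]; omega

theorem PolyTimeFun.snd : PolyTimeFun (Prod.snd : α × β → β) :=
  .of_basic .snd Polynomial.X (fun _ => rfl) fun a => by
    simp only [Polynomial.eval_X, wt_prod]; omega

theorem PolyTimeFun.fst' {f : α → β × γ} (hf : PolyTimeFun f) : PolyTimeFun fun a => (f a).1 :=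
  PolyTimeFun.fst.comp hf

theorem PolyTimeFun.snd' {f : α → β × γ} (hf : PolyTimeFun f) : PolyTimeFun fun a => (f a).2 :=
  PolyTimeFun.snd.comp hf

/-- Sequential composition in which the second step still sees the argument. -/
theorem PolyTime.bind {f : α → PMF β} {g : α × β → PMF γ} (hf : PolyTime f) (hg : PolyTime g) :
    PolyTime fun a => (f a).bind fun b => g (a, b) := by
  have := hg.comp (PolyTime.prod PolyTimeFun.id hf)
  simpa only [PMF.pure_bind, PMF.bind_map, Function.comp_def] using this

theorem PolyTime.ite {c : α → ℕ} {f g : α → PMF β} (hc : PolyTimeFun c) (hf : PolyTime f)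
    (hg : PolyTime g) : PolyTime fun a => if c a = 0 then g a else f a := by
  obtain ⟨C, c', hC⟩ := hc
  obtain ⟨P, p, hP⟩ := hf
  obtain ⟨Q, q, hQ⟩ := hg
  have hz : ∀ n : ℕ, (Data.isZero (code n) = true) ↔ n = 0 := by
    intro n; cases n <;> simp [code, Data.isZero]
  refine PolyTime.of_bounds (.ite C P Q) (c' + p + q + 1) (p + q) (fun a => ?_) (fun a => ?_)
    fun a b hb => ?_
  · rw [output_ite, (hC a).1, PMF.pure_map, PMF.pure_bind]
    simp only [hz]
    split
    · exact (hQ a).1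
    · exact (hP a).1
  · intro r hr
    simp only [Prog.run, PMF.mem_support_bind_iff, PMF.support_map, Set.mem_image] at hr
    obtain ⟨x, hx, y, hy, rfl⟩ := hr
    have h1 := (hC a).2.1 x hx
    simp only [Polynomial.eval_add, Polynomial.eval_one]
    split at hy
    · have h2 := (hQ a).2.1 y hy
      omega
    · have h2 := (hP a).2.1 y hy
      omega
  · simp only [Polynomial.eval_add]
    split at hb
    · have := (hQ a).2.2 b hb; omega
    · have := (hP a).2.2 b hb; omega

theorem PolyTime.ifPred {p : α → Prop} [DecidablePred p] {f g : α → PMF β} (hc : PolyTimePred p)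
    (hf : PolyTime f) (hg : PolyTime g) : PolyTime fun a => if p a then f a else g a := by
  have := PolyTime.ite hc hf hg
  convert this using 2 with a
  by_cases h : p a <;> simp [h]

theorem PolyTimeFun.ifPred {p : α → Prop} [DecidablePred p] {f g : α → β} (hc : PolyTimePred p)
    (hf : PolyTimeFun f) (hg : PolyTimeFun g) : PolyTimeFun fun a => if p a then f a else g a := by
  have := PolyTime.ifPred hc hf hg
  unfold PolyTimeFun
  convert this using 2 with a
  beta_reduce
  split <;> rfl

/-- Case distinction on a list. -/
theorem PolyTime.listCases {f : α → List β} {g : α → PMF γ} {h : α × (β × List β) → PMF γ}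
    (hf : PolyTimeFun f) (hg : PolyTime g) (hh : PolyTime h) :
    PolyTime fun a => match f a with
      | [] => g a
      | b :: l => h (a, (b, l)) := by
  obtain ⟨F, f', hF⟩ := hf
  obtain ⟨G, g', hG⟩ := hg
  obtain ⟨H, h', hH⟩ := hh
  have hF1 : ∀ a, ∀ r ∈ (F.run noOracle (code a)).support, r.1 = code (f a) := by
    intro a r hr
    obtain ⟨b, hb, hbx⟩ := exists_of_mem_run (hF a).1 hr
    rw [PMF.support_pure, Set.mem_singleton_iff] at hb
    rw [← hbx, hb]
  refine PolyTime.of_bounds (.ite (.comp .isPair F) (.comp H (.fork .id F)) G)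
    (f' + f' + 8 + g' + (f' + f' + 10) + 3 * Polynomial.X + h'.comp (Polynomial.X + f' + 1) + f')
    (g' + h'.comp (Polynomial.X + f' + 1)) (fun a => ?_) (fun a => ?_) fun a b hb => ?_
  · rw [output_ite, output_comp, output_comp, output_fork, (hF a).1]
    simp only [PMF.pure_map, PMF.pure_bind, Prog.output, Prog.run, basic]
    cases hfa : f a with
    | nil => simpa [code, Data.ofList, Data.isPair, Data.isZero, Prog.output] using (hG a).1
    | cons b l => 
      simpa [code, Data.ofList, Data.isPair, Data.isZero, Prog.output] using (hH (a, (b, l))).1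
  · intro r hr
    simp only [Prog.run, PMF.mem_support_bind_iff, PMF.support_map, Set.mem_image] at hr
    obtain ⟨x, ⟨u, hu, v, hv, rfl⟩, y, hy, rfl⟩ := hr
    have h1 := (hF a).2.1 u hu
    have hu1 := hF1 a u hu
    have hw := (hF a).2.2 (f a) (by simp)
    have hsz := size_le (f a)
    rw [PMF.support_pure, Set.mem_singleton_iff] at hv
    subst hv
    have hsa := size_le a
    simp only [hu1, basic] at hy ⊢
    have hp : (Data.isPair (code (f a))).size ≤ 2 := by
      cases f a <;> simp [code, Data.ofList, Data.isPair, Data.size]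
    simp only [Polynomial.eval_add, Polynomial.eval_one, Polynomial.eval_comp, Polynomial.eval_mul,
      Polynomial.eval_X, Polynomial.eval_ofNat]
    cases hfa : f a with
    | nil =>
      simp only [hfa, code, Data.ofList, Data.isPair, Data.isZero, List.map_nil, if_true]
        at hy hp hsz ⊢
      have h2 := (hG a).2.1 y hy
      simp only [Data.size] at hp hsz ⊢
      simp at hp hsz ⊢
      omega
    | cons b l =>
      have hy' : y ∈ (PMF.bind ((Prog.fork .id F).run noOracle (code a)) fun r =>
          PMF.map (fun s => (s.1, r.2 + s.2 + 1)) (H.run noOracle r.1)).support := by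
        simpa [hfa, code, Data.ofList, Data.isPair, Data.isZero, Prog.run, basic] using hy
      simp only [Prog.run, PMF.mem_support_bind_iff, PMF.support_map, Set.mem_image,
        PMF.support_pure, Set.mem_singleton_iff] at hy'
      obtain ⟨_, ⟨_, rfl, w, hw', rfl⟩, z, hz, rfl⟩ := hy'
      have h4 := (hF a).2.1 w hw'
      have h5 := hF1 a w hw'
      rw [hfa] at h5 hw hp hsz
      simp only [basic, h5] at hz ⊢
      have h6 := (hH (a, (b, l))).2.1 z hz
      have h7 := eval_mono h' (a := wt (a, (b, l))) (b := wt a + f'.eval (wt a) + 1) (by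
        rw [wt_cons] at hw
        simp only [wt_prod]
        omega)
      simp only [Data.size]
      omega
  · simp only [Polynomial.eval_add, Polynomial.eval_one, Polynomial.eval_comp, Polynomial.eval_X]
    have hw := (hF a).2.2 (f a) (by simp)
    cases hfa : f a with
    | nil =>
      rw [hfa] at hb
      have := (hG a).2.2 b hb
      omega
    | cons b' l =>
      rw [hfa] at hb hw
      have h6 := (hH (a, (b', l))).2.2 b hb
      have h7 := eval_mono h' (a := wt (a, (b', l))) (b := wt a + f'.eval (wt a) + 1) (by
        rw [wt_cons] at hw
        simp only [wt_prod]
        omega)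
      omega

theorem PolyTimeFun.listCases {f : α → List β} {g : α → γ} {h : α × (β × List β) → γ}
    (hf : PolyTimeFun f) (hg : PolyTimeFun g) (hh : PolyTimeFun h) :
    PolyTimeFun fun a => match f a with
      | [] => g a
      | b :: l => h (a, (b, l)) := by
  have := PolyTime.listCases hf hg hh
  unfold PolyTimeFun
  convert this using 2 with a
  beta_reduce
  split <;> rfl

/-- Iteration commutes with the coding of the states. -/
theorem iter_code {F : Data → PMF Data} {f : α → PMF α}
    (h : ∀ a, F (code a) = (f a).map code) (t : ℕ) (a : α) :
    iter F t (code a) = (iter f t a).map code := by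
  induction t generalizing a with
  | zero => simp [iter, PMF.pure_map]
  | succ t ih => simp [iter, h, PMF.bind_map, PMF.map_bind, Function.comp_def, ih]

/-- A loop runs in polynomial time if its body does, the number of rounds is computable in
polynomial time, and the states it passes through have polynomially bounded weight.  Without the
last condition, repeated squaring would be a counterexample. -/
theorem PolyTime.iterate {f : β → PMF β} {t : α → ℕ} {s : α → β} (hf : PolyTime f)
    (ht : PolyTimeFun t) (hs : PolyTimeFun s) (q : Polynomial ℕ)
    (hq : ∀ a, ∀ k ≤ t a, ∀ b ∈ (iter f k (s a)).support, wt b ≤ q.eval (wt a)) :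
    PolyTime fun a => iter f (t a) (s a) := by
  obtain ⟨F, p, hF⟩ := hf
  obtain ⟨R, r, hR⟩ := PolyTimeFun.prod ht hs
  refine PolyTime.of_bounds (.comp (.loop F) R) (r + (r * (p.comp q + 1) + 1) + 1) q (fun a => ?_)
    (fun a => ?_) fun a => hq a _ le_rfl
  · rw [output_comp, (hR a).1, PMF.pure_map, PMF.pure_bind]
    exact (output_loop _ _ _ _).trans (iter_code (fun b => (hF b).1) _ _)
  · intro y hy
    simp only [Prog.run, PMF.mem_support_bind_iff, PMF.support_map, Set.mem_image] at hy
    obtain ⟨u, hu, v, hv, rfl⟩ := hy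
    have h1 := (hR a).2.1 u hu
    obtain ⟨b, hb, hbx⟩ := exists_of_mem_run (hR a).1 hu
    rw [PMF.support_pure, Set.mem_singleton_iff] at hb
    subst hb
    have h3 := (hR a).2.2 (t a, s a) (by simp)
    rw [wt_prod, wt_nat] at h3
    rw [← hbx] at hv
    replace hv : v ∈ (iterCost (F.run noOracle) (t a) (code (s a))).support := hv
    have key : ∀ k b, (∀ j ≤ k, ∀ b' ∈ (iter f j b).support, wt b' ≤ q.eval (wt a)) →
        ∀ v ∈ (iterCost (F.run noOracle) k (code b)).support,
          v.2 ≤ k * (p.eval (q.eval (wt a)) + 1) + 1 := by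
      intro k
      induction k with
      | zero => intro b _ v hv; simp [iterCost] at hv; subst hv; simp
      | succ k ih =>
        intro b hb v hv
        simp only [iterCost, PMF.mem_support_bind_iff, PMF.support_map, Set.mem_image] at hv
        obtain ⟨x, hx, y, hy, rfl⟩ := hv
        obtain ⟨c, hc, hcx⟩ := exists_of_mem_run (hF b).1 hx
        rw [← hcx] at hy
        have h1 := (hF b).2.1 x hx
        have h2 := eval_mono p (hb 0 (Nat.zero_le _) b (by simp [iter]))
        have h3 := ih c (fun j hj b' hb' => hb (j + 1) (by omega) b' (by
          simp only [iter, PMF.mem_support_bind_iff]; exact ⟨c, hc, hb'⟩)) y hy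
        simp only
        rw [Nat.succ_mul]
        omega
    have h4 := key (t a) (s a) (fun j hj b' hb' => hq a j hj b' hb') v hv
    have h5 : t a * (p.eval (q.eval (wt a)) + 1) ≤ r.eval (wt a) * (p.eval (q.eval (wt a)) + 1) :=
      Nat.mul_le_mul_right _ (by omega)
    simp only [Polynomial.eval_add, Polynomial.eval_one, Polynomial.eval_comp, Polynomial.eval_mul]
    omega

end PRCode
end

noncomputable section
namespace PRCode
open Coded
variable {α β γ δ : Type} [Coded α] [Coded β] [Coded γ] [Coded δ]

/-! ### Arithmetic and list processing in polynomial time -/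

theorem PolyTimeFun.of_arith {f : ℕ → ℕ → ℕ} {P : Prog} (q : Polynomial ℕ)
    (h : ∀ a b : ℕ, P.run noOracle (.pair (.num a) (.num b)) =
      PMF.pure (basic (.pair (.num a) (.num b)) (.num (f a b))))
    (hq : ∀ a b : ℕ, f a b + 1 ≤ q.eval (a + 1 + (b + 1) + 1)) :
    PolyTimeFun fun p : ℕ × ℕ => f p.1 p.2 :=
  .of_basic P q (fun p => h p.1 p.2) fun p => hq p.1 p.2

theorem PolyTimeFun.add {f g : α → ℕ} (hf : PolyTimeFun f) (hg : PolyTimeFun g) :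
    PolyTimeFun fun a => f a + g a :=
  (PolyTimeFun.of_arith (P := .add) (f := fun a b => a + b) Polynomial.X (fun _ _ => rfl)
    fun a b => by simp; omega).comp (hf.prod hg)

theorem PolyTimeFun.sub {f g : α → ℕ} (hf : PolyTimeFun f) (hg : PolyTimeFun g) :
    PolyTimeFun fun a => f a - g a :=
  (PolyTimeFun.of_arith (P := .sub) (f := fun a b => a - b) Polynomial.X (fun _ _ => rfl)
    fun a b => by simp; omega).comp (hf.prod hg)

theorem PolyTimeFun.mul {f g : α → ℕ} (hf : PolyTimeFun f) (hg : PolyTimeFun g) :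
    PolyTimeFun fun a => f a * g a :=
  (PolyTimeFun.of_arith (P := .mul) (f := fun a b => a * b) (Polynomial.X * Polynomial.X)
    (fun _ _ => rfl) fun a b => by simp; nlinarith).comp (hf.prod hg)

theorem PolyTimeFun.div {f g : α → ℕ} (hf : PolyTimeFun f) (hg : PolyTimeFun g) :
    PolyTimeFun fun a => f a / g a :=
  (PolyTimeFun.of_arith (P := .div) (f := fun a b => a / b) Polynomial.X (fun _ _ => rfl)
    fun a b => by have := Nat.div_le_self a b; simp; omega).comp (hf.prod hg)

theorem PolyTimeFun.mod {f g : α → ℕ} (hf : PolyTimeFun f) (hg : PolyTimeFun g) :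
    PolyTimeFun fun a => f a % g a := by
  have := hf.sub (hg.mul (hf.div hg))
  convert this using 2 with a
  exact (Nat.sub_eq_of_eq_add (Nat.mod_add_div (f a) (g a)).symm).symm

theorem PolyTimePred.not {p : α → Prop} [DecidablePred p] (hp : PolyTimePred p) :
    PolyTimePred fun a => ¬ p a := by
  have := (PolyTimeFun.const 1).sub hp
  unfold PolyTimePred
  convert this using 2 with a
  by_cases h : p a <;> simp [h]

theorem PolyTimePred.and {p q : α → Prop} [DecidablePred p] [DecidablePred q]
    (hp : PolyTimePred p) (hq : PolyTimePred q) : PolyTimePred fun a => p a ∧ q a := by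
  have := PolyTimeFun.mul hp hq
  unfold PolyTimePred
  convert this using 2 with a
  by_cases h : p a <;> by_cases h' : q a <;> simp [h, h']

theorem PolyTimePred.eqZero {f : α → ℕ} (hf : PolyTimeFun f) : PolyTimePred fun a => f a = 0 := by
  have := (PolyTimeFun.const 1).sub hf
  unfold PolyTimePred
  convert this using 2 with a
  split <;> omega

theorem PolyTimePred.le {f g : α → ℕ} (hf : PolyTimeFun f) (hg : PolyTimeFun g) :
    PolyTimePred fun a => f a ≤ g a := by
  have := PolyTimePred.eqZero (hf.sub hg)
  unfold PolyTimePred at this ⊢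
  convert this using 5 with a
  omega

theorem PolyTimePred.eq {f g : α → ℕ} (hf : PolyTimeFun f) (hg : PolyTimeFun g) :
    PolyTimePred fun a => f a = g a := by
  have := (PolyTimePred.le hf hg).and (PolyTimePred.le hg hf)
  unfold PolyTimePred at this ⊢
  convert this using 5 with a
  omega

theorem PolyTimePred.comp {p : β → Prop} [DecidablePred p] {f : α → β} (hp : PolyTimePred p)
    (hf : PolyTimeFun f) : PolyTimePred fun a => p (f a) := PolyTimeFun.comp hp hf

theorem PolyTimePred.congr {p q : α → Prop} [DecidablePred p] [DecidablePred q]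
    (hp : PolyTimePred p) (h : ∀ a, p a ↔ q a) : PolyTimePred q := by
  unfold PolyTimePred at hp ⊢
  convert hp using 5 with a
  exact (h a).symm

theorem uniformBelow_succ (k : ℕ) :
    uniformBelow (k + 1) = (PMF.uniformOfFintype (Fin (k + 1))).map Fin.val := by
  rw [uniformBelow]
  exact PMF.map_id _

theorem le_of_mem_uniformBelow {k i : ℕ} (hi : i ∈ (uniformBelow k).support) : i ≤ k := by
  cases k with
  | zero => simpa [uniformBelow] using hi
  | succ k =>
    rw [uniformBelow_succ, PMF.support_map] at hi
    obtain ⟨j, _, rfl⟩ := hi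
    exact j.isLt.le

theorem polyTime_uniformBelow : PolyTime uniformBelow := by
  refine PolyTime.of_bounds (.rand) (1 + Polynomial.X + Polynomial.X) Polynomial.X (fun k => ?_)
    (fun k => ?_) ?_
  · simp only [Prog.output, Coded.code, Prog.run, PMF.map_comp]; rfl
  · intro r hr
    simp only [Coded.code, Prog.run, PMF.support_map, Set.mem_image] at hr
    obtain ⟨i, hi, rfl⟩ := hr
    have := le_of_mem_uniformBelow hi
    have h1 := natSize_le i
    have h2 := natSize_le k
    simp [basic, Data.size, Coded.wt]
    omega
  · intro k i hi
    have := le_of_mem_uniformBelow hi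
    simpa [Coded.wt] using this

theorem polyTimeFun_size : PolyTimeFun fun a : α => (code a).size :=
  .of_basic .size (Polynomial.X + 1) (fun _ => rfl) fun a => by
    have := size_le a
    simp [wt_nat]; omega

/-- Left fold of a random step function. -/
def foldP {α β : Type} (step : β → α → PMF β) : List α → β → PMF β
  | [], b => PMF.pure b
  | a :: l, b => (step b a).bind (foldP step l)

/-- One round of the loop that computes a left fold. -/
def foldBody {α β γ : Type} (step : γ × (α × β) → PMF β) (s : γ × (List α × β)) :
    PMF (γ × (List α × β)) :=
  match s.2.1 with
  | [] => PMF.pure s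
  | a :: l => (step (s.1, (a, s.2.2))).map fun b => (s.1, (l, b))

theorem iter_pure_self {σ : Type} {F : σ → PMF σ} {s : σ} (h : F s = PMF.pure s) (t : ℕ) :
    iter F t s = PMF.pure s := by
  induction t with
  | zero => rfl
  | succ t ih => simp [iter, h, ih]

theorem iter_foldBody {α β γ : Type} (step : γ × (α × β) → PMF β) (c : γ) (l : List α) (b : β)
    (t : ℕ) (ht : l.length ≤ t) :
    iter (foldBody step) t (c, (l, b)) =
      (foldP (fun b a => step (c, (a, b))) l b).map fun b' => (c, ([], b')) := by
  induction l generalizing b t with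
  | nil => rw [iter_pure_self (F := foldBody step) rfl]; simp [foldP, PMF.pure_map]
  | cons a l ih =>
    cases t with
    | zero => simp at ht
    | succ t =>
      simp only [iter, foldBody, foldP, PMF.bind_map, PMF.map_bind, Function.comp_def]
      congr 1; funext b'
      exact ih b' t (by simpa using ht)

theorem length_le_listSize (l : List α) : l.length ≤ (code l).size := by
  induction l with
  | nil => simp
  | cons a l ih => simp only [List.length_cons, code_cons, Data.size]; omega

theorem length_le_wt (l : List α) : l.length ≤ wt l := (length_le_listSize l).trans (size_le l)

/-- The invariant of the fold loop: each round adds at most `q.eval W` to the weight, where `W`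
bounds the weight of the context and of the list. -/
theorem wt_le_of_mem_iter_foldBody {step : γ × (α × β) → PMF β} {q : Polynomial ℕ}
    (hq : ∀ c a b, ∀ b' ∈ (step (c, (a, b))).support, wt b' ≤ wt b + q.eval (wt c + wt a))
    (c : γ) (k : ℕ) (l : List α) (b : β) (W : ℕ) (hW : wt c + wt l ≤ W) :
    ∀ s ∈ (iter (foldBody step) k (c, (l, b))).support,
      wt s ≤ wt c + wt l + wt b + l.length * q.eval W + 2 := by
  induction k generalizing l b with
  | zero =>
    intro s hs
    simp only [iter, PMF.support_pure, Set.mem_singleton_iff] at hs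
    subst hs
    simp only [wt_prod]; omega
  | succ k ih =>
    intro s hs
    cases l with
    | nil =>
      rw [iter_pure_self (F := foldBody step) rfl, PMF.support_pure, Set.mem_singleton_iff] at hs
      subst hs
      simp only [wt_prod]; omega
    | cons a l =>
      simp only [iter, foldBody, PMF.mem_support_bind_iff, PMF.support_map, Set.mem_image] at hs
      obtain ⟨_, ⟨b', hb', rfl⟩, hs⟩ := hs
      rw [wt_cons] at hW
      have h1 := ih l b' (by omega) s hs
      have h2 := hq c a b b' hb'
      have h3 := eval_mono q (a := wt c + wt a) (b := W) (by omega)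
      rw [wt_cons, List.length_cons, Nat.succ_mul]
      omega

/-- A fold is computable in polynomial time if each step is and adds a polynomial amount, which
does not depend on the accumulated value, to the weight. -/
theorem PolyTime.fold {step : γ × (α × β) → PMF β} (hstep : PolyTime step) (q : Polynomial ℕ)
    (hq : ∀ c a b, ∀ b' ∈ (step (c, (a, b))).support, wt b' ≤ wt b + q.eval (wt c + wt a)) :
    PolyTime fun x : γ × (List α × β) => foldP (fun b a => step (x.1, (a, b))) x.2.1 x.2.2 := by
  have hbody : PolyTime (foldBody step) := by
    have h2 : PolyTime fun x : (γ × (List α × β)) × (α × List α) =>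
        (step (x.1.1, (x.2.1, x.1.2.2))).map fun b => (x.1.1, (x.2.2, b)) :=
      PolyTime.bind (g := fun y : ((γ × (List α × β)) × (α × List α)) × β =>
        PMF.pure (y.1.1.1, (y.1.2.2, y.2)))
        (hstep.compFun (PolyTimeFun.fst.fst'.prod
          (PolyTimeFun.snd.fst'.prod PolyTimeFun.fst.snd'.snd')))
        (PolyTimeFun.fst.fst'.fst'.prod (PolyTimeFun.fst.snd'.snd'.prod PolyTimeFun.snd))
    have := PolyTime.listCases (f := fun s : γ × (List α × β) => s.2.1) PolyTimeFun.snd.fst'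
      PolyTimeFun.id h2
    convert this using 2 with s
    rcases s with ⟨c, l, b⟩
    cases l <;> rfl
  -- The number of rounds has to be computed from the code of the list: the size of the code is
  -- available as an instruction and is at least its length; excess rounds change nothing.
  have hit := PolyTime.iterate hbody (t := fun x : γ × (List α × β) => (code x.2.1).size)
    (polyTimeFun_size.comp PolyTimeFun.snd.fst') PolyTimeFun.id
    (Polynomial.X + Polynomial.X * q + 2)
    (fun x k _ s hs => by
      have h1 := wt_le_of_mem_iter_foldBody hq x.1 k x.2.1 x.2.2 (wt x)
        (by simp only [wt_prod]; omega) s hs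
      have h2 : x.2.1.length * q.eval (wt x) ≤ wt x * q.eval (wt x) :=
        Nat.mul_le_mul_right _ ((length_le_wt _).trans (by simp only [wt_prod]; omega))
      have h3 : wt x = wt x.1 + (wt x.2.1 + wt x.2.2 + 1) + 1 := rfl
      simp only [Polynomial.eval_add, Polynomial.eval_mul, Polynomial.eval_X, Polynomial.eval_ofNat]
      omega)
  have := PolyTimeFun.compPMF (g := fun s : γ × (List α × β) => s.2.2) PolyTimeFun.snd.snd' hit
  convert this using 2 with x
  rw [iter_foldBody _ _ _ _ _ (length_le_listSize _), PMF.map_comp]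
  exact (PMF.map_id _).symm

theorem foldP_pure {α β : Type} (f : β → α → β) (l : List α) (b : β) :
    foldP (fun b a => PMF.pure (f b a)) l b = PMF.pure (l.foldl f b) := by
  induction l generalizing b with
  | nil => rfl
  | cons a l ih => simp [foldP, ih]

theorem PolyTimeFun.foldl {step : γ × (α × β) → β} (hstep : PolyTimeFun step) (q : Polynomial ℕ)
    (hq : ∀ c a b, wt (step (c, (a, b))) ≤ wt b + q.eval (wt c + wt a)) :
    PolyTimeFun fun x : γ × (List α × β) => x.2.1.foldl (fun b a => step (x.1, (a, b))) x.2.2 := by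
  have := PolyTime.fold hstep q (by
    intro c a b b' hb'
    rw [PMF.support_pure, Set.mem_singleton_iff] at hb'
    subst hb'; exact hq c a b)
  unfold PolyTimeFun
  convert this using 2 with x
  rw [foldP_pure]

theorem PolyTimeFun.cons {f : α → β} {g : α → List β} (hf : PolyTimeFun f) (hg : PolyTimeFun g) :
    PolyTimeFun fun a => f a :: g a := by
  have : PolyTimeFun fun p : β × List β => p.1 :: p.2 :=
    .of_basic .id Polynomial.X (fun p => rfl) fun p => by
      simp only [wt_cons, wt_prod, Polynomial.eval_X]; exact le_rfl
  exact this.comp (hf.prod hg)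

theorem foldl_cons_eq {α : Type} (l acc : List α) :
    l.foldl (fun b a => a :: b) acc = l.reverse ++ acc := by
  induction l generalizing acc with
  | nil => rfl
  | cons a l ih => simp [ih]

theorem PolyTimeFun.reverse {f : α → List β} (hf : PolyTimeFun f) :
    PolyTimeFun fun a => (f a).reverse := by
  have := PolyTimeFun.foldl (γ := ℕ) (α := β) (β := List β) (step := fun x => x.2.1 :: x.2.2)
    (PolyTimeFun.snd.fst'.cons PolyTimeFun.snd.snd') (Polynomial.X + 1) (fun c a b => by
      simp [wt_cons]; omega)
  have := this.comp ((PolyTimeFun.const 0).prod (hf.prod (PolyTimeFun.const [])))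
  simpa only [foldl_cons_eq, List.append_nil] using this

/-- Apply a random function independently to the entries of a list. -/
def mapP {α β : Type} (f : α → PMF β) : List α → PMF (List β)
  | [] => PMF.pure []
  | a :: l => (f a).bind fun b => (mapP f l).map fun r => b :: r

theorem mapP_pure {α β : Type} (f : α → β) (l : List α) :
    mapP (fun a => PMF.pure (f a)) l = PMF.pure (l.map f) := by
  induction l with
  | nil => rfl
  | cons a l ih => simp [mapP, ih, PMF.pure_map]

theorem foldP_mapP {α β : Type} (f : α → PMF β) (l : List α) (acc : List β) :
    foldP (fun acc a => (f a).map fun b => b :: acc) l acc =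
      (mapP f l).map fun r => r.reverse ++ acc := by
  induction l generalizing acc with
  | nil => simp [foldP, mapP, PMF.pure_map]
  | cons a l ih =>
    simp only [foldP, mapP, ih, PMF.bind_map, PMF.map_bind, PMF.map_comp, Function.comp_def]
    simp

theorem PolyTime.mapP {g : γ × α → PMF β} (hg : PolyTime g) :
    PolyTime fun x : γ × List α => mapP (fun a => g (x.1, a)) x.2 := by
  have hg' := hg
  obtain ⟨P, p, hp⟩ := hg'
  have h1 : PolyTime fun x : γ × (α × List β) => (g (x.1, x.2.1)).map fun b => b :: x.2.2 :=
    PolyTime.bind (g := fun y : (γ × (α × List β)) × β => PMF.pure (y.2 :: y.1.2.2))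
      (hg.compFun (PolyTimeFun.fst.prod PolyTimeFun.snd.fst'))
      (PolyTimeFun.snd.cons PolyTimeFun.fst.snd'.snd')
  have h2 := PolyTime.fold h1 (p.comp (Polynomial.X + 1) + 1) (by
    intro c a b b' hb'
    simp only [PMF.support_map, Set.mem_image] at hb'
    obtain ⟨x, hx, rfl⟩ := hb'
    have : wt x ≤ p.eval (wt c + wt a + 1) := (hp (c, a)).2.2 x hx
    simp only [Polynomial.eval_add, Polynomial.eval_comp, Polynomial.eval_X, Polynomial.eval_one,
      wt_cons]
    omega)
  have h3 := h2.compFun (f := fun x : γ × List α => (x.1, (x.2, ([] : List β))))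
    (PolyTimeFun.fst.prod (PolyTimeFun.snd.prod (PolyTimeFun.const _)))
  have h4 := PolyTimeFun.compPMF (PolyTimeFun.id (α := List β)).reverse h3
  convert h4 using 2 with x
  simp only [foldP_mapP, PMF.map_comp, Function.comp_def]
  simp only [List.append_nil, List.reverse_reverse]
  exact (PMF.map_id _).symm

theorem PolyTimeFun.map {g : γ × α → β} (hg : PolyTimeFun g) :
    PolyTimeFun fun x : γ × List α => x.2.map fun a => g (x.1, a) := by
  have := PolyTime.mapP hg
  unfold PolyTimeFun
  simpa only [mapP_pure] using this

theorem foldl_filter_eq {α : Type} (p : α → Prop) [DecidablePred p] (l acc : List α) :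
    l.foldl (fun b a => if p a then a :: b else b) acc =
      (l.filter fun a => p a).reverse ++ acc := by
  induction l generalizing acc with
  | nil => rfl
  | cons a l ih => by_cases h : p a <;> simp [ih, h]

theorem PolyTimeFun.filter {p : γ × α → Prop} [DecidablePred p] (hp : PolyTimePred p) :
    PolyTimeFun fun x : γ × List α => x.2.filter fun a => p (x.1, a) := by
  have h1 : PolyTimeFun fun x : γ × (α × List α) =>
      if p (x.1, x.2.1) then x.2.1 :: x.2.2 else x.2.2 :=
    PolyTimeFun.ifPred (hp.comp (PolyTimeFun.fst.prod PolyTimeFun.snd.fst'))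
      (PolyTimeFun.snd.fst'.cons PolyTimeFun.snd.snd') PolyTimeFun.snd.snd'
  have h2 := PolyTimeFun.foldl h1 (Polynomial.X + 1) (by
    intro c a b
    simp only [Polynomial.eval_add, Polynomial.eval_X, Polynomial.eval_one]
    split
    · rw [wt_cons]; omega
    · omega)
  have h3 := (h2.comp (f := fun x : γ × List α => (x.1, (x.2, ([] : List α))))
    (PolyTimeFun.fst.prod (PolyTimeFun.snd.prod (PolyTimeFun.const _)))).reverse
  convert h3 using 2 with x
  simp only [foldl_filter_eq (fun a => p (x.1, a)), List.append_nil, List.reverse_reverse]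

theorem PolyTimeFun.length {f : α → List β} (hf : PolyTimeFun f) :
    PolyTimeFun fun a => (f a).length := by
  have h1 := PolyTimeFun.foldl (γ := ℕ) (α := β) (β := ℕ) (step := fun x => x.2.2 + 1)
    (PolyTimeFun.snd.snd'.add (PolyTimeFun.const 1)) 1 (fun c a b => by simp [wt_nat])
  have h2 := h1.comp (f := fun a : α => (0, (f a, 0)))
    ((PolyTimeFun.const 0).prod (hf.prod (PolyTimeFun.const 0)))
  convert h2 using 2 with a
  have : ∀ (l : List β) (n : ℕ), l.foldl (fun b _ => b + 1) n = n + l.length := by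
    intro l
    induction l with
    | nil => simp
    | cons a l ih => intro n; simp [ih]; omega
  simp [this]

theorem PolyTimePred.mem : PolyTimePred fun x : ℕ × List ℕ => x.1 ∈ x.2 := by
  have h1 := PolyTimeFun.filter (γ := ℕ) (α := ℕ) (p := fun x => x.2 = x.1)
    (PolyTimePred.eq PolyTimeFun.snd PolyTimeFun.fst)
  refine ((PolyTimePred.eqZero h1.length).not).congr fun x => ?_
  rw [← Ne, ← Nat.pos_iff_ne_zero, List.length_pos_iff_exists_mem]
  simp

/-- The entry of a list at a given position, with a default value. -/
theorem PolyTimeFun.getD : PolyTimeFun fun x : List ℕ × ℕ => x.1.getD x.2 0 := by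
  have htail : PolyTimeFun fun l : List ℕ => l.tail := by
    have := PolyTimeFun.listCases (f := fun l : List ℕ => l) (g := fun _ => ([] : List ℕ))
      (h := fun x => x.2.2) PolyTimeFun.id (PolyTimeFun.const _) PolyTimeFun.snd.snd'
    convert this using 2 with l
    cases l <;> rfl
  have hhead : PolyTimeFun fun l : List ℕ => l.headD 0 := by
    have := PolyTimeFun.listCases (f := fun l : List ℕ => l) (g := fun _ => 0)
      (h := fun x => x.2.1) PolyTimeFun.id (PolyTimeFun.const _) PolyTimeFun.snd.fst'
    convert this using 2 with l
    cases l <;> rfl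
  have hdrop : ∀ (k : ℕ) (l : List ℕ),
      iter (fun l : List ℕ => PMF.pure l.tail) k l = PMF.pure (l.drop k) := by
    intro k
    induction k with
    | zero => intro l; rfl
    | succ k ih => intro l; simp only [iter, PMF.pure_bind, ih, List.drop_tail]
  have hwt : ∀ (k : ℕ) (l : List ℕ), wt (l.drop k) ≤ wt l := by
    intro k
    induction k with
    | zero => intro l; rfl
    | succ k ih =>
      intro l
      cases l with
      | nil => simp
      | cons a l => rw [List.drop_succ_cons, wt_cons]; have := ih l; omega
  have h1 := PolyTime.iterate htail (t := fun x : List ℕ × ℕ => x.2) (s := fun x => x.1)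
    PolyTimeFun.snd PolyTimeFun.fst Polynomial.X (by
      intro x k _ b hb
      rw [hdrop, PMF.support_pure, Set.mem_singleton_iff] at hb
      subst hb
      have := hwt k x.1
      simp only [Polynomial.eval_X, wt_prod]; omega)
  simp only [hdrop] at h1
  have h2 := hhead.comp h1
  convert h2 using 2 with x
  simp [List.headD_eq_head?_getD, List.head?_drop, List.getD_eq_getElem?_getD]

theorem PolyTimeFun.range {f : α → ℕ} (hf : PolyTimeFun f) :
    PolyTimeFun fun a => List.range (f a) := by
  have hbody : PolyTimeFun fun x : ℕ × List ℕ => (x.1 - 1, (x.1 - 1) :: x.2) :=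
    (PolyTimeFun.fst.sub (PolyTimeFun.const 1)).prod
      ((PolyTimeFun.fst.sub (PolyTimeFun.const 1)).cons PolyTimeFun.snd)
  have key : ∀ (k n : ℕ) (l : List ℕ), iter (fun x : ℕ × List ℕ =>
      PMF.pure (x.1 - 1, (x.1 - 1) :: x.2)) k (n + k, l) =
        PMF.pure (n, (List.range k).map (fun i => n + i) ++ l) := by
    intro k
    induction k with
    | zero => intro n l; rfl
    | succ k ih =>
      intro n l
      simp only [iter, PMF.pure_bind]
      have : n + (k + 1) - 1 = n + k := by omega
      rw [this, ih]
      simp [List.range_succ]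
  have hw : ∀ n k : ℕ, wt ((List.range k).map fun i => n + i) ≤ k * (n + k + 2) + 1 := by
    intro n k
    have : ∀ l : List ℕ, (∀ a ∈ l, a ≤ n + k) → wt l ≤ l.length * (n + k + 2) + 1 := by
      intro l
      induction l with
      | nil => intro _; simp [wt_nil]
      | cons a l ih =>
        intro h
        have h1 := ih fun b hb => h b (List.mem_cons_of_mem _ hb)
        have h2 := h a List.mem_cons_self
        rw [wt_cons, wt_nat, List.length_cons, Nat.succ_mul]
        omega
    have := this ((List.range k).map fun i => n + i) (by
      intro a ha; simp at ha; obtain ⟨i, hi, rfl⟩ := ha; omega)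
    simpa using this
  have h1 := PolyTime.iterate hbody (t := f) (s := fun a => (f a, ([] : List ℕ))) hf
    (hf.prod (PolyTimeFun.const _))
  obtain ⟨P, p, hp⟩ := hf
  have h2 := h1 (p + p * (p + 2) + 2) (by
    intro a k hk b hb
    have h := key k (f a - k) []
    rw [Nat.sub_add_cancel hk] at h
    rw [h, PMF.support_pure, Set.mem_singleton_iff] at hb
    subst hb
    have h3 := (hp a).2.2 (f a) (by simp)
    rw [wt_nat] at h3
    have h4 := hw (f a - k) k
    rw [Nat.sub_add_cancel hk] at h4
    have h5 : k * (f a + 2) ≤ p.eval (wt a) * (p.eval (wt a) + 2) :=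
      Nat.mul_le_mul (by omega) (by omega)
    simp only [List.append_nil, wt_prod, Polynomial.eval_add, Polynomial.eval_mul,
      Polynomial.eval_ofNat, wt_nat]
    omega)
  have h3 := PolyTimeFun.snd.comp (f := fun a => (0, List.range (f a))) (by
    unfold PolyTimeFun
    convert h2 using 2 with a
    have := key (f a) 0 []
    rw [Nat.zero_add] at this
    rw [this]; simp)
  exact h3

end PRCode
end

noncomputable section
namespace PRCode
open Coded

/-! ### Rational approximations of `log 2` -/

open Filter Topology in
/-- From `ψ(N) ≤ N log 4 + o(N)` for the Chebyshev function `ψ(N) = log lcm(1, …, N)`. Any base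
between `4` and `5` in place of `9 / 2` would do, since the integrals below decay like `5 ^ (-N)`.
-/
theorem eventually_lcmUpto_le : ∀ᶠ N : ℕ in atTop, (Nat.lcmUpto N : ℝ) ≤ (9 / 2) ^ N := by
  have h1 : Tendsto (fun x : ℝ => Real.log x / x ^ (1 / 2 : ℝ)) atTop (𝓝 0) :=
    (isLittleO_log_rpow_atTop (by norm_num : (0 : ℝ) < 1 / 2)).tendsto_div_nhds_zero
  have hc : (0 : ℝ) < (Real.log (9 / 2) - Real.log 4) / 2 := by
    have := Real.log_lt_log (by norm_num : (0 : ℝ) < 4) (by norm_num : (4 : ℝ) < 9 / 2)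
    linarith
  have h2 := (h1.comp tendsto_natCast_atTop_atTop).eventually_lt_const hc
  filter_upwards [h2, eventually_ge_atTop 1] with N hN hN1
  have hN0 : (1 : ℝ) ≤ N := by exact_mod_cast hN1
  have h3 := Chebyshev.psi_le hN0
  rw [Chebyshev.psi_eq_log_lcmUpto] at h3
  have hpos : (0 : ℝ) < Nat.lcmUpto N := by exact_mod_cast Nat.lcmUpto_pos N
  rw [← Real.log_le_log_iff hpos (by positivity), Real.log_pow]
  refine h3.trans ?_
  simp only [Function.comp_apply, ← Real.sqrt_eq_rpow] at hN
  have hs : 0 < √(N : ℝ) := Real.sqrt_pos.2 (by linarith)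
  rw [div_lt_iff₀ hs] at hN
  have hss : √(N : ℝ) * √(N : ℝ) = N := Real.mul_self_sqrt (by linarith)
  nlinarith

/-- The integrand of the approximation integrals for `log 2`. -/
def logIntegrand (N : ℕ) (u : ℝ) : ℝ := (u - 1) ^ N * (2 - u) ^ N * u ^ (-(N : ℤ) - 1)

/-- The integral `∫₁² (u-1)^N (2-u)^N / u^(N+1) du`. -/
def logIntegral (N : ℕ) : ℝ := ∫ u in (1 : ℝ)..2, logIntegrand N u

theorem logIntegrand_eq (N : ℕ) {u : ℝ} (hu : 0 < u) :
    logIntegrand N u = ((u - 1) * (2 - u) / u) ^ N * u⁻¹ := by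
  rw [logIntegrand, zpow_sub_one₀ hu.ne', zpow_neg, zpow_natCast, div_pow, mul_pow]
  ring

theorem continuousOn_logIntegrand (N : ℕ) : ContinuousOn (logIntegrand N) (Set.Icc 1 2) := by
  unfold logIntegrand
  refine ContinuousOn.mul (by fun_prop) ?_
  exact (continuousOn_id).zpow₀ _ fun x hx => Or.inl (by
    have := hx.1; simp only [id_eq]; linarith)

/-- The maximum of `(u - 1) (2 - u) / u` on `[1, 2]` is `3 - 2 √2 < 1 / 5`. -/
theorem logIntegral_le (N : ℕ) : logIntegral N ≤ (1 / 5) ^ N := by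
  have h : ∀ u ∈ Set.Icc (1 : ℝ) 2, logIntegrand N u ≤ (1 / 5) ^ N := by
    intro u hu
    have hu0 : 0 < u := by linarith [hu.1]
    rw [logIntegrand_eq N hu0]
    have h1 : (u - 1) * (2 - u) / u ≤ 1 / 5 := by
      rw [div_le_iff₀ hu0]; nlinarith [sq_nonneg (u - 7 / 5)]
    have h0 : 0 ≤ (u - 1) * (2 - u) / u :=
      div_nonneg (mul_nonneg (by linarith [hu.1]) (by linarith [hu.2])) hu0.le
    have h2 := mul_le_mul (pow_le_pow_left₀ h0 h1 N) (inv_le_one_of_one_le₀ hu.1)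
      (by positivity) (by positivity)
    rwa [mul_one] at h2
  have := intervalIntegral.integral_mono_on (μ := MeasureTheory.volume) (by norm_num : (1 : ℝ) ≤ 2)
    ((continuousOn_logIntegrand N).intervalIntegrable_of_Icc (by norm_num))
    (g := fun _ => (1 / 5 : ℝ) ^ N) (by simp) h
  simp only [intervalIntegral.integral_const, smul_eq_mul] at this
  unfold logIntegral
  linarith

/-- On the middle half of the interval, `(u - 1) (2 - u) / u` is at least `1 / 10`. -/
theorem le_logIntegral (N : ℕ) : (1 / 10) ^ N / 4 ≤ logIntegral N := by
  have hsub : Set.Icc (5 / 4 : ℝ) (7 / 4) ⊆ Set.Icc 1 2 :=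
    Set.Icc_subset_Icc (by norm_num) (by norm_num)
  have h : ∀ u ∈ Set.Icc (5 / 4 : ℝ) (7 / 4), (1 / 10) ^ N * (1 / 2) ≤ logIntegrand N u := by
    intro u hu
    have hu0 : 0 < u := by linarith [hu.1]
    rw [logIntegrand_eq N hu0]
    have h1 : 1 / 10 ≤ (u - 1) * (2 - u) / u := by
      rw [le_div_iff₀ hu0]
      nlinarith [hu.1, hu.2, mul_nonneg (sub_nonneg.2 hu.1) (sub_nonneg.2 hu.2)]
    have h2 : 1 / 2 ≤ u⁻¹ := by
      rw [one_div]; exact inv_anti₀ hu0 (by linarith [hu.2])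
    gcongr
  have h1 := intervalIntegral.integral_mono_on (μ := MeasureTheory.volume)
    (by norm_num : (5 / 4 : ℝ) ≤ 7 / 4) (f := fun _ => (1 / 10 : ℝ) ^ N * (1 / 2)) (by simp)
    (((continuousOn_logIntegrand N).mono hsub).intervalIntegrable_of_Icc (by norm_num)) h
  have h2 := intervalIntegral.integral_mono_interval (μ := MeasureTheory.volume)
    (f := logIntegrand N) (a := 5 / 4) (b := 7 / 4) (c := 1) (d := 2) (by norm_num) (by norm_num)
    (by norm_num) (by
      refine (MeasureTheory.ae_restrict_iff' measurableSet_Ioc).2 (Filter.Eventually.of_forall ?_)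
      intro u hu
      have hu0 : 0 < u := by linarith [hu.1]
      simp only [Pi.zero_apply]
      rw [logIntegrand_eq N hu0]
      have h0 : 0 ≤ (u - 1) * (2 - u) / u :=
        div_nonneg (mul_nonneg (by linarith [hu.1]) (by linarith [hu.2])) hu0.le
      positivity)
    ((continuousOn_logIntegrand N).intervalIntegrable_of_Icc (by norm_num))
  simp only [intervalIntegral.integral_const, smul_eq_mul] at h1
  unfold logIntegral
  linarith

theorem zero_notMem_uIcc : (0 : ℝ) ∉ Set.uIcc (1 : ℝ) 2 := by
  rw [Set.uIcc_of_le (by norm_num)]; intro h; linarith [h.1]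

/-- One term of the expanded integral, multiplied by the least common multiple of `1, …, N`, is an
integer combination of `1` and `log 2`. -/
theorem exists_int_term (N a b : ℕ) (ha : a ≤ N) (hb : b ≤ N) :
    ∃ A B : ℤ, (Nat.lcmUpto N : ℝ) * (2 ^ (N - b) *
        ∫ u in (1 : ℝ)..2, u ^ ((a : ℤ) + b - N - 1)) = A + B * Real.log 2 ∧
      |(B : ℝ)| ≤ Nat.lcmUpto N * 2 ^ (N - b) := by
  have hdvd : ∀ t : ℕ, 1 ≤ t → t ≤ N → t ∣ Nat.lcmUpto N := fun t h1 h2 =>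
    Finset.dvd_lcm (f := _root_.id) (Finset.mem_Icc.2 ⟨h1, h2⟩)
  rcases lt_trichotomy (a + b) N with h | h | h
  · obtain ⟨j, hj⟩ : ∃ j, N = a + b + j := ⟨N - (a + b), by omega⟩
    obtain ⟨e, he⟩ := hdvd j (by omega) (by omega)
    have hj0 : (j : ℝ) ≠ 0 := by
      have : j ≠ 0 := by omega
      exact_mod_cast this
    refine ⟨e * 2 ^ a * (2 ^ j - 1), 0, ?_, by simp⟩
    have hexp : ((a : ℤ) + b - N - 1) = -(j : ℤ) - 1 := by rw [hj]; push_cast; ring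
    have hNb : N - b = a + j := by omega
    rw [hexp, integral_zpow (Or.inr ⟨by omega, zero_notMem_uIcc⟩), he, hNb]
    have : (-(j : ℤ) - 1 + 1) = -(j : ℤ) := by ring
    rw [this, zpow_neg, zpow_natCast, one_zpow]
    push_cast
    have h4 : (-(j : ℝ) - 1 + 1) = -j := by ring
    rw [h4]
    have h2 : (2 : ℝ) ^ j ≠ 0 := by positivity
    field_simp
    ring
  · refine ⟨0, Nat.lcmUpto N * 2 ^ (N - b), ?_, ?_⟩
    · have hexp : ((a : ℤ) + b - N - 1) = -1 := by rw [← h]; push_cast; ring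
      rw [hexp]
      simp only [zpow_neg_one]
      rw [integral_inv_of_pos (by norm_num) (by norm_num)]
      push_cast; simp; ring
    · push_cast
      rw [abs_of_nonneg (by positivity)]
  · obtain ⟨j, hj⟩ : ∃ j, a + b = N + j := ⟨a + b - N, by omega⟩
    obtain ⟨e, he⟩ := hdvd j (by omega) (by omega)
    have hj0 : (j : ℝ) ≠ 0 := by
      have : j ≠ 0 := by omega
      exact_mod_cast this
    refine ⟨e * 2 ^ (N - b) * (2 ^ j - 1), 0, ?_, by simp⟩
    have hexp : ((a : ℤ) + b - N - 1) = (j : ℤ) - 1 := by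
      have : (a : ℤ) + b = N + j := by exact_mod_cast hj
      linarith
    rw [hexp, integral_zpow (Or.inl (by omega)), he]
    have : ((j : ℤ) - 1 + 1) = (j : ℤ) := by ring
    rw [this, zpow_natCast, one_zpow]
    push_cast
    have h4 : ((j : ℝ) - 1 + 1) = j := by ring
    rw [h4]
    field_simp
    ring

theorem logIntegral_eq_sum (N : ℕ) : logIntegral N =
    ∑ a ∈ Finset.range (N + 1), ∑ b ∈ Finset.range (N + 1),
      ((-1) ^ (N - a) * N.choose a * ((-1) ^ b * N.choose b)) * (2 ^ (N - b) *
        ∫ u in (1 : ℝ)..2, u ^ ((a : ℤ) + b - N - 1)) := by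
  have hint : ∀ k : ℤ, IntervalIntegrable (fun u : ℝ => u ^ k) MeasureTheory.volume 1 2 := fun k =>
    intervalIntegral.intervalIntegrable_zpow (Or.inr zero_notMem_uIcc)
  have h1 : logIntegral N = ∫ u in (1 : ℝ)..2, ∑ a ∈ Finset.range (N + 1),
      ∑ b ∈ Finset.range (N + 1), ((-1) ^ (N - a) * N.choose a * ((-1) ^ b * N.choose b)) *
        (2 ^ (N - b) * u ^ ((a : ℤ) + b - N - 1)) := by
    refine intervalIntegral.integral_congr fun u hu => ?_
    rw [Set.uIcc_of_le (by norm_num)] at hu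
    have hu0 : u ≠ 0 := by linarith [hu.1]
    simp only [logIntegrand]
    have e1 : (u - 1) ^ N = ∑ a ∈ Finset.range (N + 1), (-1) ^ (N - a) * N.choose a * u ^ a := by
      rw [sub_eq_add_neg, add_pow]
      exact Finset.sum_congr rfl fun a _ => by ring
    have e2 : (2 - u) ^ N =
        ∑ b ∈ Finset.range (N + 1), (-1) ^ b * N.choose b * 2 ^ (N - b) * u ^ b := by
      rw [sub_eq_neg_add, add_pow]
      refine Finset.sum_congr rfl fun a _ => ?_
      rw [neg_pow u]; ring
    rw [e1, e2, Finset.sum_mul_sum, Finset.sum_mul]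
    refine Finset.sum_congr rfl fun a _ => ?_
    rw [Finset.sum_mul]
    refine Finset.sum_congr rfl fun b _ => ?_
    have : u ^ ((a : ℤ) + b - N - 1) = u ^ a * u ^ b * u ^ (-(N : ℤ) - 1) := by
      rw [← zpow_natCast, ← zpow_natCast, ← zpow_add₀ hu0, ← zpow_add₀ hu0]
      congr 1; ring
    rw [this]; ring
  have h2 : ∀ a : ℕ, IntervalIntegrable (fun u : ℝ => ∑ b ∈ Finset.range (N + 1),
      ((-1) ^ (N - a) * N.choose a * ((-1) ^ b * N.choose b)) *
        (2 ^ (N - b) * u ^ ((a : ℤ) + b - N - 1))) MeasureTheory.volume 1 2 := by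
    intro a
    have := IntervalIntegrable.sum (Finset.range (N + 1)) fun b _ =>
      ((hint ((a : ℤ) + b - N - 1)).const_mul (2 ^ (N - b))).const_mul
        ((-1) ^ (N - a) * N.choose a * ((-1) ^ b * N.choose b))
    refine this.congr fun u _ => ?_
    simp [Finset.sum_apply]
  rw [h1, intervalIntegral.integral_finsetSum fun a _ => h2 a]
  refine Finset.sum_congr rfl fun a _ => ?_
  rw [intervalIntegral.integral_finsetSum fun b _ => ((hint _).const_mul _).const_mul _]
  refine Finset.sum_congr rfl fun b _ => ?_
  rw [intervalIntegral.integral_const_mul, intervalIntegral.integral_const_mul]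

/-- Multiplied by the least common multiple of `1, …, N`, the integral is an integer combination of
`1` and `log 2`, and the coefficient of `log 2` grows at most exponentially. -/
theorem exists_int_logIntegral (N : ℕ) :
    ∃ A B : ℤ, (Nat.lcmUpto N : ℝ) * logIntegral N = A + B * Real.log 2 ∧
      |(B : ℝ)| ≤ Nat.lcmUpto N * 6 ^ N := by
  have h : ∀ a b : ℕ, ∃ A B : ℤ, a ≤ N → b ≤ N → (Nat.lcmUpto N : ℝ) * (2 ^ (N - b) *
        ∫ u in (1 : ℝ)..2, u ^ ((a : ℤ) + b - N - 1)) = A + B * Real.log 2 ∧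
      |(B : ℝ)| ≤ Nat.lcmUpto N * 2 ^ (N - b) := by
    intro a b
    by_cases hab : a ≤ N ∧ b ≤ N
    · obtain ⟨A, B, h1⟩ := exists_int_term N a b hab.1 hab.2
      exact ⟨A, B, fun _ _ => h1⟩
    · exact ⟨0, 0, fun h1 h2 => absurd ⟨h1, h2⟩ hab⟩
  choose A B hAB using h
  refine ⟨∑ a ∈ Finset.range (N + 1), ∑ b ∈ Finset.range (N + 1),
      ((-1) ^ (N - a) * N.choose a * ((-1) ^ b * N.choose b)) * A a b,
    ∑ a ∈ Finset.range (N + 1), ∑ b ∈ Finset.range (N + 1),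
      ((-1) ^ (N - a) * N.choose a * ((-1) ^ b * N.choose b)) * B a b, ?_, ?_⟩
  · rw [logIntegral_eq_sum]
    push_cast
    simp only [Finset.mul_sum, Finset.sum_mul, ← Finset.sum_add_distrib]
    refine Finset.sum_congr rfl fun a ha => Finset.sum_congr rfl fun b hb => ?_
    have h1 := (hAB a b (by simpa [Nat.lt_succ_iff] using ha)
      (by simpa [Nat.lt_succ_iff] using hb)).1
    rw [mul_left_comm, h1]; ring
  · push_cast
    calc _ ≤ ∑ a ∈ Finset.range (N + 1), ∑ b ∈ Finset.range (N + 1),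
          (N.choose a * N.choose b : ℝ) * (Nat.lcmUpto N * 2 ^ (N - b)) := by
          refine (Finset.abs_sum_le_sum_abs _ _).trans (Finset.sum_le_sum fun a ha =>
            (Finset.abs_sum_le_sum_abs _ _).trans (Finset.sum_le_sum fun b hb => ?_))
          have h1 := (hAB a b (by simpa [Nat.lt_succ_iff] using ha)
            (by simpa [Nat.lt_succ_iff] using hb)).2
          simp only [abs_mul, abs_pow, abs_neg, abs_one, one_pow, one_mul, Nat.abs_cast]
          gcongr
      _ = Nat.lcmUpto N * ((∑ a ∈ Finset.range (N + 1), (N.choose a : ℝ)) *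
            ∑ b ∈ Finset.range (N + 1), (1 : ℝ) ^ b * 2 ^ (N - b) * N.choose b) := by
          rw [Finset.sum_mul_sum, Finset.mul_sum]
          refine Finset.sum_congr rfl fun a _ => ?_
          rw [Finset.mul_sum]
          refine Finset.sum_congr rfl fun b _ => ?_
          ring
      _ = _ := by
          rw [← add_pow]
          have : (∑ a ∈ Finset.range (N + 1), (N.choose a : ℝ)) = 2 ^ N := by
            exact_mod_cast Nat.sum_range_choose N
          rw [this, ← mul_pow]; norm_num

/-- A quantitative form of the irrationality of `log 2`.  For suitable `N`, the integer combination
`A + B log 2 = lcm(1, …, N) * logIntegral N` is so small that `q (A + B log 2) ≤ 1 / 2`.  It equals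
`(A q + B p) + B (q log 2 - p)`; the bracketed integer is either nonzero, or it vanishes and
`B (q log 2 - p)` is as large as the positive left side.  In both cases `|q log 2 - p|` cannot be
much smaller than `|B|⁻¹`, which is exponential in `N = O(q)`. -/
theorem exists_le_abs_sub_log_two : ∃ K : ℕ, ∀ (q : ℕ) (p : ℤ), 1 ≤ q →
    ((2 : ℝ) ^ (180 * q + K))⁻¹ ≤ |q * Real.log 2 - p| := by
  obtain ⟨N₀, hN₀⟩ := Filter.eventually_atTop.1 eventually_lcmUpto_le
  refine ⟨9 * N₀ + 2, fun q p hq => ?_⟩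
  -- `(9 / 10) ^ 20 ≤ 1 / 4`, so that the factor `q ≤ 2 ^ q` is absorbed; the exponent
  -- `180 = 9 * 20` comes from `10 * 27 ≤ 2 ^ 9`.
  set N := N₀ + 20 * q with hN
  have hd := hN₀ N (by omega)
  have hd1 : (1 : ℝ) ≤ Nat.lcmUpto N := by exact_mod_cast Nat.lcmUpto_pos N
  set d : ℝ := (Nat.lcmUpto N : ℝ) with hdd
  obtain ⟨A, B, hAB, hB⟩ := exists_int_logIntegral N
  have hI := logIntegral_le N
  have hI' := le_logIntegral N
  set ε := |q * Real.log 2 - p| with hε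
  have hε0 : 0 ≤ ε := abs_nonneg _
  have hq1 : (1 : ℝ) ≤ q := by exact_mod_cast hq
  have hI0 : 0 < logIntegral N := lt_of_lt_of_le (by positivity) hI'
  have key : (q : ℝ) * (d * logIntegral N) = (A * q + B * p : ℤ) + B * (q * Real.log 2 - p) := by
    rw [hAB]; push_cast; ring
  have hsmall : (q : ℝ) * (d * logIntegral N) ≤ 1 / 2 := by
    have h1 : d * logIntegral N ≤ (9 / 10) ^ N := by
      calc d * logIntegral N ≤ (9 / 2) ^ N * (1 / 5) ^ N := by gcongr
        _ = _ := by rw [← mul_pow]; norm_num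
    have h2 : (9 / 10 : ℝ) ^ N ≤ (1 / 4) ^ q := by
      calc (9 / 10 : ℝ) ^ N ≤ (9 / 10) ^ (20 * q) :=
            pow_le_pow_of_le_one (by norm_num) (by norm_num) (by omega)
        _ = ((9 / 10) ^ 20) ^ q := pow_mul _ _ _
        _ ≤ _ := by gcongr; norm_num
    have h3 : (q : ℝ) ≤ 2 ^ q := by exact_mod_cast Nat.lt_two_pow_self.le
    calc (q : ℝ) * (d * logIntegral N) ≤ 2 ^ q * (1 / 4) ^ q := by
          gcongr; exact h1.trans h2
      _ = (1 / 2) ^ q := by rw [← mul_pow]; norm_num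
      _ ≤ (1 / 2) ^ 1 := pow_le_pow_of_le_one (by norm_num) (by norm_num) hq
      _ = _ := by norm_num
  have hbig : (1 / 10) ^ N / 4 ≤ |(B : ℝ)| * ε := by
    have habs : |(B : ℝ)| * ε = |(B : ℝ) * (q * Real.log 2 - p)| := (abs_mul _ _).symm
    have hp : (1 / 10 : ℝ) ^ N ≤ 1 := pow_le_one₀ (by norm_num) (by norm_num)
    rw [habs]
    by_cases h0 : A * q + B * p = 0
    · rw [h0] at key
      simp only [Int.cast_zero, zero_add] at key
      rw [← key, abs_of_nonneg (by positivity)]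
      nlinarith [mul_le_mul hq1 hd1 zero_le_one (by linarith),
        mul_pos (by linarith : (0 : ℝ) < q) hI0,
        mul_le_mul_of_nonneg_right (mul_le_mul hq1 hd1 zero_le_one (by linarith)) hI0.le]
    · have h1 : (1 : ℝ) ≤ |((A * q + B * p : ℤ) : ℝ)| := by exact_mod_cast Int.one_le_abs h0
      have h2 : ((A * q + B * p : ℤ) : ℝ) =
          q * (d * logIntegral N) - B * (q * Real.log 2 - p) := by rw [key]; ring
      rw [h2] at h1
      have h3 := abs_sub (q * (d * logIntegral N)) (B * (q * Real.log 2 - p))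
      rw [abs_of_nonneg (by positivity : 0 ≤ q * (d * logIntegral N))] at h3
      linarith
  have hB' : |(B : ℝ)| ≤ 27 ^ N := by
    calc |(B : ℝ)| ≤ d * 6 ^ N := hB
      _ ≤ (9 / 2) ^ N * 6 ^ N := by gcongr
      _ = _ := by rw [← mul_pow]; norm_num
  have hfin : (1 / 10) ^ N / 4 ≤ 27 ^ N * ε := hbig.trans (by gcongr)
  have he : 180 * q + (9 * N₀ + 2) = 9 * N + 2 := by omega
  rw [he, inv_le_iff_one_le_mul₀ (by positivity), pow_add, pow_mul]
  have h5 : (1 : ℝ) ≤ 270 ^ N * 4 * ε := by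
    have : (270 : ℝ) ^ N = 10 ^ N * 27 ^ N := by rw [← mul_pow]; norm_num
    have h10 : (0 : ℝ) < 10 ^ N := by positivity
    have h6 : (10 : ℝ) ^ N * (1 / 10) ^ N = 1 := by rw [← mul_pow]; norm_num
    rw [this]
    nlinarith [mul_le_mul_of_nonneg_left hfin h10.le]
  calc (1 : ℝ) ≤ 270 ^ N * 4 * ε := h5
    _ ≤ (2 ^ 9) ^ N * 2 ^ 2 * ε := by gcongr <;> norm_num
    _ = _ := by ring

end PRCode
end

noncomputable section
namespace PRCode
open Coded

/-! ### The block length `⌈n log 2⌉` in polynomial time -/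

theorem natSize_add_le (a b : ℕ) : Nat.size (a + b) ≤ Nat.size a + Nat.size b := by
  rw [Nat.size_le]
  have h1 := Nat.lt_size_self a
  have h2 := Nat.lt_size_self b
  have h3 : 1 ≤ 2 ^ a.size := Nat.one_le_two_pow
  have h4 : 1 ≤ 2 ^ b.size := Nat.one_le_two_pow
  rw [pow_add]
  generalize 2 ^ a.size = x at *
  generalize 2 ^ b.size = y at *
  nlinarith [Nat.mul_le_mul h3 h4, mul_nonneg (Nat.zero_le (x - 1)) (Nat.zero_le (y - 1)),
    Nat.mul_le_mul (Nat.le_sub_one_of_lt (Nat.lt_succ_of_le h3)) h4]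

theorem natSize_mul_le (a b : ℕ) : Nat.size (a * b) ≤ Nat.size a + Nat.size b := by
  rw [Nat.size_le, pow_add]
  exact Nat.mul_lt_mul'' (Nat.lt_size_self a) (Nat.lt_size_self b)

theorem natSize_mono {a b : ℕ} (h : a ≤ b) : Nat.size a ≤ Nat.size b :=
  Nat.size_le.2 (lt_of_le_of_lt h (Nat.lt_size_self b))

theorem PolyTimeFun.binAdd : PolyTimeFun fun p : Bin × Bin => Bin.mk (p.1.val + p.2.val) :=
  .of_basic .add Polynomial.X (fun _ => rfl) fun p => by
    have := natSize_add_le p.1.val p.2.val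
    simp only [wt_bin, wt_prod, Polynomial.eval_X]; omega

theorem PolyTimeFun.binDivNat : PolyTimeFun fun p : Bin × ℕ => Bin.mk (p.1.val / p.2) :=
  .of_basic .div Polynomial.X (fun _ => rfl) fun p => by
    have := natSize_mono (Nat.div_le_self p.1.val p.2)
    simp only [wt_bin, wt_prod, Polynomial.eval_X]; omega

theorem PolyTimeFun.binDiv : PolyTimeFun fun p : Bin × Bin => Bin.mk (p.1.val / p.2.val) :=
  .of_basic .div Polynomial.X (fun _ => rfl) fun p => by
    have := natSize_mono (Nat.div_le_self p.1.val p.2.val)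
    simp only [wt_bin, wt_prod, Polynomial.eval_X]; omega

theorem PolyTimeFun.natMulBin : PolyTimeFun fun p : ℕ × Bin => Bin.mk (p.1 * p.2.val) :=
  .of_basic .mul Polynomial.X (fun _ => rfl) fun p => by
    have := natSize_mul_le p.1 p.2.val
    have := natSize_le p.1
    simp only [wt_bin, wt_prod, wt_nat, Polynomial.eval_X]; omega

theorem PolyTimeFun.natSubBin : PolyTimeFun fun p : ℕ × Bin => p.1 - p.2.val :=
  .of_basic .sub Polynomial.X (fun _ => rfl) fun p => by
    simp only [wt_prod, wt_nat, Polynomial.eval_X]; omega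

theorem PolyTimeFun.twoPow : PolyTimeFun fun n : ℕ => Bin.mk (2 ^ n) := by
  have h1 : PolyTimeFun fun x : ℕ × (ℕ × Bin) => Bin.mk (x.2.2.val + x.2.2.val) :=
    PolyTimeFun.binAdd.comp (PolyTimeFun.snd.snd'.prod PolyTimeFun.snd.snd')
  have h2 := PolyTimeFun.foldl h1 1 (fun c a b => by
    have : Nat.size (b.val + b.val) ≤ Nat.size b.val + 1 := by
      rw [Nat.size_le, pow_succ]
      have := Nat.lt_size_self b.val
      omega
    simp only [wt_bin, Polynomial.eval_one]; omega)
  have h3 := h2.comp (f := fun n : ℕ => (0, (List.range n, Bin.mk 1)))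
    ((PolyTimeFun.const 0).prod ((PolyTimeFun.range PolyTimeFun.id).prod (PolyTimeFun.const _)))
  convert h3 using 2 with n
  simp only
  induction n with
  | zero => rfl
  | succ n ih => rw [List.range_succ, List.foldl_append, ← ih]; simp [pow_succ]; ring

/-- One step of the Horner scheme for `X * ∑ 2⁻ⁱ / i`, in integer arithmetic. -/
def logStep (X : ℕ) (T k : ℕ) : ℕ := (T + X / (k + 1)) / 2

/-- An integer slightly below `2 ^ M * log 2`. -/
def logApprox (M : ℕ) : ℕ := (List.range M).reverse.foldl (logStep (2 ^ M)) 0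

/-- The Horner scheme started at `T ≈ X * H` stays within `2` below the exact value: each step
adds at most `1` to the loss by its first division, halves it, and adds at most `1 / 2`. -/
theorem logStep_bounds (X : ℕ) (m : ℕ) (T : ℕ) (H : ℝ) (h1 : X * H - 2 ≤ T) (h2 : (T : ℝ) ≤ X * H) :
    X * (∑ i ∈ Finset.range m, (1 / 2 : ℝ) ^ (i + 1) / (i + 1) + (1 / 2) ^ m * H) - 2 ≤
        ((List.range m).reverse.foldl (logStep X) T : ℕ) ∧
      (((List.range m).reverse.foldl (logStep X) T : ℕ) : ℝ) ≤
        X * (∑ i ∈ Finset.range m, (1 / 2 : ℝ) ^ (i + 1) / (i + 1) + (1 / 2) ^ m * H) := by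
  induction m generalizing T H with
  | zero => simpa using ⟨by linarith, h2⟩
  | succ m ih =>
    have e : (List.range (m + 1)).reverse = m :: (List.range m).reverse := by
      rw [List.range_succ, List.reverse_append]; rfl
    rw [e, List.foldl_cons]
    have hm : (0 : ℝ) < m + 1 := by positivity
    have d1 : ((X / (m + 1) : ℕ) : ℝ) ≤ X / (m + 1) := by
      have := Nat.cast_div_le (α := ℝ) (m := X) (n := m + 1); push_cast at this; exact this
    have d2 : (X : ℝ) / (m + 1) - 1 ≤ ((X / (m + 1) : ℕ) : ℝ) := by
      have h : (X : ℝ) < (m + 1) * ((X / (m + 1) : ℕ) + 1) := by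
        exact_mod_cast Nat.lt_mul_div_succ X (Nat.succ_pos m)
      have : (X : ℝ) / (m + 1) < (X / (m + 1) : ℕ) + 1 := by
        rw [div_lt_iff₀ hm]; linarith
      linarith
    have d3 : (logStep X T m : ℝ) ≤ (T + (X / (m + 1) : ℕ) : ℝ) / 2 := by
      have := Nat.cast_div_le (α := ℝ) (m := T + X / (m + 1)) (n := 2)
      push_cast at this ⊢; exact this
    have d4 : ((T + (X / (m + 1) : ℕ) : ℝ) - 1) / 2 ≤ (logStep X T m : ℝ) := by
      have h : T + X / (m + 1) ≤ 2 * logStep X T m + 1 := by unfold logStep; omega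
      have h' : (T : ℝ) + (X / (m + 1) : ℕ) ≤ 2 * logStep X T m + 1 := by exact_mod_cast h
      linarith
    have hH : (X : ℝ) * ((H + 1 / (m + 1)) / 2) = (X * H + X / (m + 1)) / 2 := by ring
    have := ih (logStep X T m) ((H + 1 / (m + 1)) / 2) (by rw [hH]; linarith)
      (by rw [hH]; linarith)
    have e2 : ∑ i ∈ Finset.range (m + 1), (1 / 2 : ℝ) ^ (i + 1) / (i + 1) + (1 / 2) ^ (m + 1) * H =
        ∑ i ∈ Finset.range m, (1 / 2 : ℝ) ^ (i + 1) / (i + 1) +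
          (1 / 2) ^ m * ((H + 1 / (m + 1)) / 2) := by
      rw [Finset.sum_range_succ, pow_succ]; ring
    rw [e2]
    exact this

theorem logApprox_bounds (M : ℕ) :
    2 ^ M * Real.log 2 - 3 ≤ logApprox M ∧ (logApprox M : ℝ) ≤ 2 ^ M * Real.log 2 := by
  have h := logStep_bounds (2 ^ M) M 0 0 (by simp) (by simp)
  rw [mul_zero, add_zero] at h
  have hlog : Real.log (1 - 1 / 2) = - Real.log 2 := by
    rw [← Real.log_inv]; norm_num
  have h1 := Real.abs_log_sub_add_sum_range_le (x := 1 / 2) (by norm_num [abs_of_pos]) M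
  rw [hlog] at h1
  have h2 := Real.hasSum_pow_div_log_of_abs_lt_one (x := 1 / 2) (by norm_num [abs_of_pos])
  rw [hlog, neg_neg] at h2
  have h3 := sum_le_hasSum (Finset.range M) (fun i _ => by positivity) h2
  have h4 : |(1 / 2 : ℝ)| ^ (M + 1) / (1 - |(1 / 2 : ℝ)|) = (1 / 2) ^ M := by
    rw [abs_of_pos (by norm_num), pow_succ]; ring
  rw [h4] at h1
  have h5 := (abs_le.1 h1).1
  have h6 : (2 : ℝ) ^ M * (1 / 2) ^ M = 1 := by rw [← mul_pow]; norm_num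
  have hX : (0 : ℝ) < 2 ^ M := by positivity
  push_cast at h
  refine ⟨?_, ?_⟩
  · refine le_trans ?_ h.1
    nlinarith [mul_le_mul_of_nonneg_left h5 hX.le]
  · refine h.2.trans ?_
    gcongr

theorem polyTimeFun_logApprox : PolyTimeFun fun M : ℕ => Bin.mk (logApprox M) := by
  have h1 : PolyTimeFun fun x : Bin × (ℕ × Bin) => Bin.mk (logStep x.1.val x.2.2.val x.2.1) := by
    have := PolyTimeFun.binDivNat.comp ((PolyTimeFun.binAdd.comp (PolyTimeFun.snd.snd'.prod
      (PolyTimeFun.binDivNat.comp (PolyTimeFun.fst.prod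
        (PolyTimeFun.snd.fst'.add (PolyTimeFun.const 1)))))).prod (PolyTimeFun.const
          (α := Bin × (ℕ × Bin)) 2))
    exact this
  have h2 := PolyTimeFun.foldl h1 Polynomial.X (fun c a b => by
    have h : logStep c.val b.val a ≤ b.val + c.val := by
      unfold logStep
      have := Nat.div_le_self c.val (a + 1)
      omega
    have h' := natSize_add_le b.val c.val
    have h'' := natSize_mono h
    simp only [wt_bin, Polynomial.eval_X]; omega)
  have h3 := h2.comp (f := fun M : ℕ => (Bin.mk (2 ^ M), ((List.range M).reverse, Bin.mk 0)))
    (PolyTimeFun.twoPow.prod ((PolyTimeFun.range PolyTimeFun.id).reverse.prod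
      (PolyTimeFun.const _)))
  convert h3 using 2 with M
  have : ∀ (X : ℕ) (l : List ℕ) (T : ℕ), Bin.mk (l.foldl (logStep X) T) =
      l.foldl (fun (b : Bin) a => Bin.mk (logStep X b.val a)) (Bin.mk T) := by
    intro X l
    induction l with
    | nil => intro T; rfl
    | cons a l ih => intro T; simp [ih]
  exact this _ _ _

/-- `⌈n log 2⌉` is computed as `1 + ⌊n * logApprox M / 2 ^ M⌋` (as `0` if `n = 0`). The subtractions
from `n` in the program only turn a number of many digits into one of value at most `n`. -/
theorem polyTimeFun_indexLength : PolyTimeFun indexLength := by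
  obtain ⟨K, hK⟩ := exists_le_abs_sub_log_two
  -- a number `M` of digits with `3 * n / 2 ^ M` below the distance from `n * log 2` to any integer
  have hM : PolyTimeFun fun n : ℕ => 180 * n + K + (n + 2) :=
    (((PolyTimeFun.const 180).mul PolyTimeFun.id).add (PolyTimeFun.const K)).add
      (PolyTimeFun.id.add (PolyTimeFun.const 2))
  have hq : PolyTimeFun fun n : ℕ =>
      n - (n - n * logApprox (180 * n + K + (n + 2)) / 2 ^ (180 * n + K + (n + 2))) :=
    PolyTimeFun.id.sub (PolyTimeFun.natSubBin.comp (PolyTimeFun.id.prod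
      (PolyTimeFun.binDiv.comp ((PolyTimeFun.natMulBin.comp (PolyTimeFun.id.prod
        (polyTimeFun_logApprox.comp hM))).prod (PolyTimeFun.twoPow.comp hM)))))
  have := PolyTimeFun.ifPred (PolyTimePred.eqZero PolyTimeFun.id) (PolyTimeFun.const 0)
    (hq.add (PolyTimeFun.const 1))
  convert this using 2 with n
  by_cases hn : n = 0
  · subst hn; simp [indexLength]
  rw [if_neg hn]
  set M := 180 * n + K + (n + 2) with hMdef
  have hn1 : 1 ≤ n := by omega
  have hnR : (1 : ℝ) ≤ n := by exact_mod_cast hn1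
  obtain ⟨b1, b2⟩ := logApprox_bounds M
  have hlog0 : 0 < Real.log 2 := Real.log_pos (by norm_num)
  have hlog1 : Real.log 2 ≤ 1 := by linarith [Real.log_two_lt_d9]
  have hX : (0 : ℝ) < 2 ^ M := by positivity
  set f := ⌊(n : ℝ) * Real.log 2⌋₊ with hf
  have hfle : (f : ℝ) ≤ n * Real.log 2 := Nat.floor_le (by positivity)
  have hflt : n * Real.log 2 < f + 1 := Nat.lt_floor_add_one _
  have hgap := hK n f hn1
  rw [Int.cast_natCast, abs_of_nonneg (by linarith)] at hgap
  have hgpos : (0 : ℝ) < ((2 : ℝ) ^ (180 * n + K))⁻¹ := by positivity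
  have hpow : (2 : ℝ) ^ M = 2 ^ (180 * n + K) * 2 ^ (n + 2) := by rw [← pow_add]
  have h3n : 3 * (n : ℝ) ≤ 2 ^ (n + 2) := by
    have : (n : ℝ) ≤ 2 ^ n := by exact_mod_cast Nat.lt_two_pow_self.le
    rw [pow_add]; linarith
  have hdiv : n * logApprox M / 2 ^ M = f := by
    refine Nat.div_eq_of_lt_le ?_ ?_
    · have h1 : (f : ℝ) * 2 ^ M ≤ n * logApprox M := by
        have h2 : (2 : ℝ) ^ (n + 2) ≤ (n * Real.log 2 - f) * 2 ^ M := by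
          rw [hpow]
          calc (2 : ℝ) ^ (n + 2) = ((2 : ℝ) ^ (180 * n + K))⁻¹ *
                (2 ^ (180 * n + K) * 2 ^ (n + 2)) := by
                rw [← mul_assoc, inv_mul_cancel₀ (by positivity), one_mul]
            _ ≤ _ := by gcongr
        nlinarith
      exact_mod_cast h1
    · have h1 : (n : ℝ) * logApprox M < (f + 1) * 2 ^ M := by nlinarith
      exact_mod_cast h1
  rw [hdiv]
  have hfn : f ≤ n := by
    have : (f : ℝ) ≤ n := by nlinarith
    exact_mod_cast this
  rw [Nat.sub_sub_self hfn, indexLength, mul_comm]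
  rw [Nat.ceil_eq_iff (by omega)]
  push_cast
  constructor
  · linarith
  · linarith

end PRCode
end

noncomputable section
namespace PRCode
open Coded
open scoped ENNReal

/-! ### Exact sampling of words, permutations and preimages -/

/-- Both distributions have total mass `1`. -/
theorem pmf_eq_of_le {α : Type*} {p q : PMF α} (h : ∀ a, p a ≤ q a) : p = q := by
  ext a
  refine le_antisymm (h a) ?_
  by_contra hlt
  have h1 : ∑' a, p a < ∑' a, q a :=
    ENNReal.tsum_lt_tsum (by rw [p.tsum_coe]; exact ENNReal.one_ne_top) h (not_le.1 hlt)
  rw [p.tsum_coe, q.tsum_coe] at h1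
  exact lt_irrefl _ h1

theorem le_bind_apply {α β : Type*} (p : PMF α) (f : α → PMF β) (a : α) (b : β) :
    p a * f a b ≤ p.bind f b := by
  rw [PMF.bind_apply]; exact ENNReal.le_tsum a

theorem le_map_apply {α β : Type*} (p : PMF α) (f : α → β) (a : α) : p a ≤ p.map f (f a) := by
  have := le_bind_apply p (PMF.pure ∘ f) a (f a)
  simpa [PMF.map] using this

theorem map_apply_of_injective {α β : Type*} (p : PMF α) {f : α → β} (hf : Function.Injective f)
    (a : α) : p.map f (f a) = p a := by
  rw [PMF.map_apply, tsum_eq_single a]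
  · simp
  · intro b hb; rw [if_neg fun h => hb (hf h).symm]

/-- To compare the image of a distribution under an injective map with another distribution, it is
enough to bound the latter from below. -/
theorem map_eq_of_le {α β : Type*} {p : PMF α} {q : PMF β} {f : α → β}
    (hf : Function.Injective f) (h : ∀ a, p a ≤ q (f a)) : q = p.map f := by
  refine (pmf_eq_of_le fun b => ?_).symm
  by_cases hb : ∃ a, f a = b
  · obtain ⟨a, rfl⟩ := hb
    rw [map_apply_of_injective p hf]; exact h a
  · have : p.map f b = 0 := by
      rw [PMF.apply_eq_zero_iff, PMF.support_map]
      rintro ⟨a, _, rfl⟩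
      exact hb ⟨a, rfl⟩
    rw [this]; exact zero_le

theorem uniformBelow_apply {n i : ℕ} (h : i < n) : uniformBelow n i = (n : ℝ≥0∞)⁻¹ := by
  cases n with
  | zero => omega
  | succ k =>
    rw [uniformBelow_succ]
    have := map_apply_of_injective (PMF.uniformOfFintype (Fin (k + 1))) Fin.val_injective ⟨i, h⟩
    simp only at this
    rw [this, PMF.uniformOfFintype_apply, Fintype.card_fin]

theorem mapP_ofFn_apply {α β : Type} (f : α → PMF β) {m : ℕ} (y : Fin m → α) (z : Fin m → β) :
    ∏ i, f (y i) (z i) ≤ mapP f (List.ofFn y) (List.ofFn z) := by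
  induction m with
  | zero => simp [mapP]
  | succ m ih =>
    rw [Fin.prod_univ_succ, List.ofFn_succ, List.ofFn_succ, mapP]
    refine le_trans ?_ (le_bind_apply _ _ (z 0) _)
    gcongr
    refine (ih (fun i => y i.succ) fun i => z i.succ).trans ?_
    exact le_map_apply _ (fun r => z 0 :: r) _

/-- The list of the values of a word. -/
def wordList {m n : ℕ} (w : Fin m → Fin n) : List ℕ := List.ofFn fun i => (w i : ℕ)

theorem wordList_injective {m n : ℕ} :
    Function.Injective (wordList : (Fin m → Fin n) → List ℕ) := by
  intro v w h
  have := List.ofFn_injective h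
  funext i
  exact Fin.ext (congrFun this i)

theorem wordList_eq_map {m n : ℕ} (w : Fin m → Fin n) :
    wordList w = (List.ofFn w).map Fin.val := by
  rw [List.map_ofFn]; rfl

theorem mem_wordList {m n : ℕ} (w : Fin m → Fin n) (a : Fin n) :
    (a : ℕ) ∈ wordList w ↔ a ∈ unique w := by
  simp [wordList, unique, List.mem_ofFn, Fin.ext_iff]

theorem code_wordList {m n : ℕ} (w : Fin m → Fin n) : code (wordList w) = codeWord w := by
  simp only [Coded.code, codeWord, codeString, wordList_eq_map, List.map_map]; rfl

/-- A list of `m` independent uniform numbers below `n`. -/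
def randomWord (n m : ℕ) : PMF (List ℕ) := mapP (fun _ => uniformBelow n) (List.range m)

theorem randomWord_eq (n m : ℕ) [Nonempty (Fin m → Fin n)] :
    randomWord n m = (PMF.uniformOfFintype (Fin m → Fin n)).map wordList := by
  refine map_eq_of_le wordList_injective fun w => ?_
  have := mapP_ofFn_apply (fun _ : ℕ => uniformBelow n) (fun i : Fin m => (i : ℕ))
    fun i => (w i : ℕ)
  have hr : List.ofFn (fun i : Fin m => (i : ℕ)) = List.range m := by
    rw [List.range_eq_range', List.ofFn_eq_map]; simp [← List.range_eq_range']
  rw [hr] at this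
  refine le_trans (le_of_eq ?_) this
  simp only [uniformBelow_apply (w _).isLt, PMF.uniformOfFintype_apply, Finset.prod_const,
    Finset.card_univ, Fintype.card_fin, Fintype.card_pi]
  push_cast
  rw [ENNReal.inv_pow]

/-- One step of the shuffle: move a random element from the first list to the second one. -/
def shuffleStep (s : List ℕ × List ℕ) : PMF (List ℕ × List ℕ) :=
  (uniformBelow s.1.length).map fun r =>
    (s.1.filter fun b => ¬ b = s.1.getD r 0, s.1.getD r 0 :: s.2)

/-- A random permutation of `0, …, n - 1`, as a list.  The entries of the list folded over are not
used; they only count the steps. -/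
def shuffle (n : ℕ) : PMF (List ℕ) :=
  (foldP (fun s (_ : ℕ) => shuffleStep s) (List.range n) (List.range n, [])).map Prod.snd

/-- Each arrangement of the remaining elements comes out of the shuffle with at least its
probability under the uniform distribution; by total mass, these bounds are equalities. -/
theorem shuffle_aux (L rem acc σ : List ℕ) (hnd : rem.Nodup) (hL : L.length = rem.length)
    (hσ : σ.Perm rem) : ((rem.length.factorial : ℕ) : ℝ≥0∞)⁻¹ ≤
      (foldP (fun s (_ : ℕ) => shuffleStep s) L (rem, acc)).map Prod.snd (σ ++ acc) := by
  induction L generalizing rem acc σ with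
  | nil =>
    have : rem = [] := List.length_eq_zero_iff.1 hL.symm
    subst this
    rw [List.perm_nil.1 hσ]
    simp [foldP, PMF.pure_map]
  | cons a L ih =>
    have hlen : rem.length = L.length + 1 := by rw [← hL]; rfl
    rcases List.eq_nil_or_concat σ with h | ⟨σ', x, rfl⟩
    · rw [h] at hσ; rw [hσ.symm.eq_nil] at hlen; simp at hlen
    have hx : x ∈ rem := hσ.subset (by simp)
    have hperm : (x :: σ').Perm rem := (List.perm_append_comm (l₁ := [x])).trans (by simpa using hσ)
    have hfilter : (rem.filter fun b => ¬ b = x) = rem.erase x := by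
      rw [hnd.erase_eq_filter]; congr 1; funext b; simp [bne, beq_eq_decide]
    have hσ' : σ'.Perm (rem.filter fun b => ¬ b = x) := by
      rw [hfilter]; have := hperm.erase x; simpa using this
    obtain ⟨r, hr, hrx⟩ := List.getElem_of_mem hx
    have hget : rem.getD r 0 = x := by rw [List.getD_eq_getElem _ _ hr, hrx]
    have hl' : (rem.filter fun b => ¬ b = x).length = L.length := by
      rw [hfilter, List.length_erase_of_mem hx]; omega
    have h1 := ih (rem.filter fun b => ¬ b = x) (x :: acc) σ' (hnd.filter _) hl'.symm hσ'
    rw [hl'] at h1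
    rw [foldP, PMF.map_bind]
    refine le_trans ?_ (le_bind_apply _ _ (rem.filter fun b => ¬ b = x, x :: acc) _)
    have h2 : ((rem.length : ℕ) : ℝ≥0∞)⁻¹ ≤
        shuffleStep (rem, acc) (rem.filter fun b => ¬ b = x, x :: acc) := by
      have := le_map_apply (uniformBelow rem.length) (fun r =>
        (rem.filter fun b => ¬ b = rem.getD r 0, rem.getD r 0 :: acc)) r
      rw [uniformBelow_apply hr, hget] at this
      exact this
    have h3 : σ'.concat x ++ acc = σ' ++ x :: acc := by simp
    rw [h3, hlen, Nat.factorial_succ]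
    push_cast
    rw [hlen] at h2
    push_cast at h2
    rw [ENNReal.mul_inv (Or.inl (by simp)) (Or.inl (by finiteness))]
    exact mul_le_mul' h2 h1

theorem shuffle_eq (n : ℕ) : shuffle n =
    (PMF.uniformOfFintype (Equiv.Perm (Fin n))).map fun π : Equiv.Perm (Fin n) =>
      wordList (π : Fin n → Fin n) := by
  refine map_eq_of_le (fun π π' h => Equiv.coe_fn_injective (wordList_injective h)) fun π => ?_
  have hr : List.range n = wordList (_root_.id : Fin n → Fin n) := by
    rw [wordList, List.ofFn_eq_map]; simp [List.range_eq_range']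
  have hp : (wordList π).Perm (List.range n) := by
    rw [hr, wordList_eq_map, wordList_eq_map]
    exact (Equiv.Perm.ofFn_comp_perm π _root_.id).map _
  have := shuffle_aux (List.range n) (List.range n) [] (wordList π) List.nodup_range rfl hp
  rw [List.append_nil, List.length_range] at this
  rw [PMF.uniformOfFintype_apply, Fintype.card_perm, Fintype.card_fin]
  exact this

/-- A uniformly random position at which the list `ψ` has the entry `b`. -/
def randomPreimage (ψ : List ℕ) (b : ℕ) : PMF ℕ :=
  (uniformBelow ((List.range ψ.length).filter fun a => ψ.getD a 0 = b).length).map fun r =>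
    ((List.range ψ.length).filter fun a => ψ.getD a 0 = b).getD r 0

theorem mapP_randomPreimage_eq {ρ n m : ℕ} (hρ : 0 < ρ) (ψ : BalancedMap ρ n) (y : Fin m → Fin n) :
    mapP (randomPreimage (wordList ψ.1)) (wordList y) = (liftWord hρ ψ y).map wordList := by
  have hlen : (wordList ψ.1).length = ρ * n := by simp [wordList]
  have hget : ∀ a : Fin (ρ * n), (wordList ψ.1).getD a 0 = ψ.1 a := by
    intro a; simp [wordList, List.getD_eq_getElem?_getD]
  have hfil : ∀ b : Fin n, ((List.range (ρ * n)).filter fun a =>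
      (wordList ψ.1).getD a 0 = (b : ℕ)).length = ρ := by
    intro b
    refine Eq.trans ?_ (ψ.2 b)
    rw [← List.toFinset_card_of_nodup (List.nodup_range.filter _)]
    refine (Finset.card_bij (fun (a : Fin (ρ * n)) _ => (a : ℕ)) ?_ ?_ ?_).symm
    · intro a ha
      have := hget a
      simp only [Finset.mem_filter, Finset.mem_univ, true_and] at ha
      simp only [List.mem_toFinset, List.mem_filter, List.mem_range, a.isLt, true_and, this, ha,
        decide_true]
    · intro a _ a' _ h; exact Fin.ext h
    · intro a ha
      simp only [List.mem_toFinset, List.mem_filter, List.mem_range, decide_eq_true_eq] at ha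
      have := hget ⟨a, ha.1⟩
      simp only at this
      refine ⟨⟨a, ha.1⟩, ?_, rfl⟩
      simp only [Finset.mem_filter, Finset.mem_univ, true_and]
      exact Fin.ext (this.symm.trans ha.2)
  have hpre : ∀ (a : Fin (ρ * n)) , (ρ : ℝ≥0∞)⁻¹ ≤ randomPreimage (wordList ψ.1) (ψ.1 a) a := by
    intro a
    have hmem : (a : ℕ) ∈ ((List.range (ρ * n)).filter fun c =>
        (wordList ψ.1).getD c 0 = (ψ.1 a : ℕ)) := by
      simp only [List.mem_filter, List.mem_range, a.isLt, true_and, hget a, decide_true]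
    obtain ⟨r, hr, hra⟩ := List.getElem_of_mem hmem
    have h1 := le_map_apply (uniformBelow ((List.range (ρ * n)).filter fun c =>
        (wordList ψ.1).getD c 0 = (ψ.1 a : ℕ)).length)
      (fun r => ((List.range (ρ * n)).filter fun c =>
        (wordList ψ.1).getD c 0 = (ψ.1 a : ℕ)).getD r 0) r
    rw [uniformBelow_apply hr, hfil] at h1
    simp only [List.getD_eq_getElem _ _ hr, hra] at h1
    rw [randomPreimage, hlen, hfil]
    exact h1
  refine map_eq_of_le wordList_injective fun z => ?_
  by_cases hz : ∀ j, ψ.1 (z j) = y j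
  · have h1 := mapP_ofFn_apply (randomPreimage (wordList ψ.1)) (fun i => (y i : ℕ))
      fun i => (z i : ℕ)
    refine le_trans ?_ h1
    rw [liftWord, PMF.uniformOfFinset_apply, if_pos (by simpa [Fintype.mem_piFinset] using hz),
      Fintype.card_piFinset]
    simp only [ψ.2, Finset.prod_const, Finset.card_univ, Fintype.card_fin]
    calc ((ρ ^ m : ℕ) : ℝ≥0∞)⁻¹ = ∏ _i : Fin m, (ρ : ℝ≥0∞)⁻¹ := by
          push_cast
          rw [Finset.prod_const, Finset.card_univ, Fintype.card_fin, ENNReal.inv_pow]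
      _ ≤ _ := Finset.prod_le_prod' fun i _ => by
          rw [← hz i]; exact hpre _
  · rw [liftWord, PMF.uniformOfFinset_apply, if_neg (by simpa [Fintype.mem_piFinset] using hz)]
    exact zero_le

end PRCode
end

noncomputable section
namespace PRCode
open Coded
open scoped ENNReal

/-! ### The law of the perturbation -/

/-- One step of the table lookup `swapSymbol`. -/
def swapStep {α : Type} [DecidableEq α] (x : α) (s : List α × α) (a : α) : List α × α :=
  match s.1 with
  | [] => s
  | b :: B => (B, if a = x then b else s.2)

/-- The symbol `B[i]` if `x = A[i]` and `i` is a position of both lists, and `x` otherwise. -/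
def swapSymbol {α : Type} [DecidableEq α] (A B : List α) (x : α) : α :=
  (A.foldl (swapStep x) (B, x)).2

section
variable {α β : Type}

theorem mem_zip_swap {A B : List α} {x b : α} (h : (x, b) ∈ A.zip B) : (b, x) ∈ B.zip A := by
  rw [← List.zip_swap]
  exact List.mem_map.2 ⟨(x, b), h, rfl⟩

theorem exists_mem_zip {A B : List α} (hlen : A.length ≤ B.length) {x : α} (hx : x ∈ A) :
    ∃ b, (x, b) ∈ A.zip B := by
  obtain ⟨i, hi, rfl⟩ := List.getElem_of_mem hx
  refine ⟨B[i]'(by omega), ?_⟩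
  have : (A.zip B)[i]'(by simp; omega) = (A[i], B[i]'(by omega)) := List.getElem_zip
  rw [← this]
  exact List.getElem_mem _

variable [DecidableEq α] [DecidableEq β]

theorem foldl_swapStep_map {f : α → β} (hf : Function.Injective f) (A B : List α) (x r : α) :
    ((A.map f).foldl (swapStep (f x)) (B.map f, f r)).2 = f (A.foldl (swapStep x) (B, r)).2 := by
  induction A generalizing B r with
  | nil => rfl
  | cons a A ih =>
    cases B with
    | nil => exact ih [] r
    | cons b B =>
      simp only [List.map_cons, List.foldl_cons, swapStep, hf.eq_iff]
      rw [← ih]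
      split <;> rfl

theorem swapSymbol_map {f : α → β} (hf : Function.Injective f) (A B : List α) (x : α) :
    swapSymbol (A.map f) (B.map f) (f x) = f (swapSymbol A B x) :=
  foldl_swapStep_map hf A B x x

theorem foldl_swapStep_of_notMem {A B : List α} {x r : α} (h : ∀ b, (x, b) ∉ A.zip B) :
    (A.foldl (swapStep x) (B, r)).2 = r := by
  induction A generalizing B with
  | nil => rfl
  | cons a A ih =>
    cases B with
    | nil => exact ih (B := []) (by simp)
    | cons b B =>
      have hax : ¬ a = x := by
        rintro rfl
        exact h b (by simp)
      simp only [List.foldl_cons, swapStep, if_neg hax]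
      exact ih fun b' hb' => h b' (by simp [hb'])

theorem foldl_swapStep_of_mem {A B : List α} (hA : A.Nodup) {x b r : α} (h : (x, b) ∈ A.zip B) :
    (A.foldl (swapStep x) (B, r)).2 = b := by
  induction A generalizing B r with
  | nil => simp at h
  | cons a A ih =>
    cases B with
    | nil => simp at h
    | cons b' B =>
      simp only [List.zip_cons_cons, List.mem_cons, Prod.mk.injEq] at h
      rw [List.nodup_cons] at hA
      rcases h with ⟨rfl, rfl⟩ | h
      · simp only [List.foldl_cons, swapStep, if_true]
        exact foldl_swapStep_of_notMem fun c hc => hA.1 (List.of_mem_zip hc).1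
      · simp only [List.foldl_cons, swapStep]
        exact ih hA.2 h

theorem swapSymbol_of_notMem {A B : List α} {x : α} (h : ∀ b, (x, b) ∉ A.zip B) :
    swapSymbol A B x = x := foldl_swapStep_of_notMem h

theorem swapSymbol_of_mem {A B : List α} (hA : A.Nodup) {x b : α} (h : (x, b) ∈ A.zip B) :
    swapSymbol A B x = b := foldl_swapStep_of_mem hA h

theorem eq_of_mem_zip {A B : List α} (hB : B.Nodup) {x x' b : α} (h : (x, b) ∈ A.zip B)
    (h' : (x', b) ∈ A.zip B) : x = x' :=
  (swapSymbol_of_mem hB (mem_zip_swap h)).symm.trans (swapSymbol_of_mem hB (mem_zip_swap h'))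

end

section
variable {n m : ℕ}

/-- The elements of `D` in the order given by the permutation `π`. -/
def orderedBy (D : Finset (Fin n)) (π : Equiv.Perm (Fin n)) : List (Fin n) :=
  (List.ofFn π).filter fun a => a ∈ D

theorem nodup_orderedBy (D : Finset (Fin n)) (π : Equiv.Perm (Fin n)) : (orderedBy D π).Nodup :=
  (List.nodup_ofFn.2 π.injective).filter _

theorem mem_orderedBy {D : Finset (Fin n)} {π : Equiv.Perm (Fin n)} {a : Fin n} :
    a ∈ orderedBy D π ↔ a ∈ D := by
  simp only [orderedBy, List.mem_filter, List.mem_ofFn, decide_eq_true_eq,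
    and_iff_right_iff_imp]
  exact fun _ => π.surjective a

theorem length_orderedBy (D : Finset (Fin n)) (π : Equiv.Perm (Fin n)) :
    (orderedBy D π).length = D.card := by
  rw [← List.toFinset_card_of_nodup (nodup_orderedBy D π)]
  congr 1; ext a; rw [List.mem_toFinset, mem_orderedBy]

theorem orderedBy_mul {D D' : Finset (Fin n)} (τ π : Equiv.Perm (Fin n))
    (h : ∀ a, τ a ∈ D' ↔ a ∈ D) : orderedBy D' (τ * π) = (orderedBy D π).map τ := by
  have : List.ofFn (τ * π : Equiv.Perm (Fin n)) = (List.ofFn π).map τ := by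
    rw [List.map_ofFn]; rfl
  rw [orderedBy, this, List.filter_map, orderedBy]
  congr 1
  apply List.filter_congr
  intro a _
  simp [h]

/-- Replace the `i`-th element of `D₁` by the `i`-th element of `D₂`, in the order given by `π`. -/
def swapBy (D₁ D₂ : Finset (Fin n)) (π : Equiv.Perm (Fin n)) (x : Fin n) : Fin n :=
  swapSymbol (orderedBy D₁ π) (orderedBy D₂ π) x

theorem swapBy_mul {D₁ D₂ D₁' D₂' : Finset (Fin n)} (τ π : Equiv.Perm (Fin n))
    (h₁ : ∀ a, τ a ∈ D₁' ↔ a ∈ D₁) (h₂ : ∀ a, τ a ∈ D₂' ↔ a ∈ D₂) (x : Fin n) :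
    swapBy D₁' D₂' (τ * π) (τ x) = τ (swapBy D₁ D₂ π x) := by
  rw [swapBy, orderedBy_mul τ π h₁, orderedBy_mul τ π h₂, swapSymbol_map τ.injective, swapBy]

theorem pair_mem_zip {D₁ D₂ : Finset (Fin n)} (h : D₁.card ≤ D₂.card) (π : Equiv.Perm (Fin n))
    {a : Fin n} (ha : a ∈ D₁) :
    (a, swapBy D₁ D₂ π a) ∈ (orderedBy D₁ π).zip (orderedBy D₂ π) := by
  obtain ⟨b, hb⟩ := exists_mem_zip (A := orderedBy D₁ π) (B := orderedBy D₂ π)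
    (by rwa [length_orderedBy, length_orderedBy]) (mem_orderedBy.2 ha)
  rwa [swapBy, swapSymbol_of_mem (nodup_orderedBy _ _) hb]

/-- The injection `D₁ → D₂` that matches the two sets in the order given by `π`. -/
def swapEmbedding {D₁ D₂ : Finset (Fin n)} (h : D₁.card ≤ D₂.card) (π : Equiv.Perm (Fin n)) :
    D₁ ↪ D₂ where
  toFun a := ⟨swapBy D₁ D₂ π a, mem_orderedBy.1 (List.of_mem_zip (pair_mem_zip h π a.2)).2⟩
  inj' a a' haa := by
    have h1 := pair_mem_zip h π a.2
    have h2 := pair_mem_zip h π a'.2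
    rw [Subtype.mk.injEq] at haa
    rw [haa] at h1
    exact Subtype.ext (eq_of_mem_zip (nodup_orderedBy _ _) h1 h2)

theorem pmf_eq_uniform {α : Type*} [Fintype α] [Nonempty α] (p : PMF α)
    (h : ∀ a b, p a ≤ p b) : p = PMF.uniformOfFintype α := by
  refine (pmf_eq_of_le fun a => ?_).symm
  have h1 : ∑ b : α, p b = 1 := by rw [← tsum_fintype (L := .unconditional _), p.tsum_coe]
  have h2 : (1 : ℝ≥0∞) ≤ Fintype.card α * p a := by
    rw [← h1, ← nsmul_eq_mul, ← Finset.card_univ, ← Finset.sum_const]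
    exact Finset.sum_le_sum fun b _ => h b a
  rw [PMF.uniformOfFintype_apply]
  rw [← one_div]
  exact ENNReal.div_le_of_le_mul' h2

theorem map_uniform_equiv {α β : Type*} [Fintype α] [Nonempty α] [Fintype β] [Nonempty β]
    (e : α ≃ β) : (PMF.uniformOfFintype α).map e = PMF.uniformOfFintype β := by
  refine (map_eq_of_le e.injective fun a => ?_).symm
  rw [PMF.uniformOfFintype_apply, PMF.uniformOfFintype_apply, Fintype.card_congr e]

/-- The image of a uniform distribution is uniform if any value can be turned into any other
value by a bijection of the source. -/
theorem map_uniform_of_transitive {α β : Type*} [Fintype α] [Nonempty α] [Fintype β] [Nonempty β]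
    (f : α → β) (h : ∀ b b', ∃ e : α ≃ α, ∀ a, f a = b → f (e a) = b') :
    (PMF.uniformOfFintype α).map f = PMF.uniformOfFintype β := by
  classical
  refine pmf_eq_uniform _ fun b b' => ?_
  obtain ⟨e, he⟩ := h b b'
  conv_rhs => rw [← map_uniform_equiv e, PMF.map_comp]
  rw [PMF.map_apply, PMF.map_apply]
  refine ENNReal.tsum_le_tsum fun a => ?_
  by_cases hb : b = f a
  · rw [if_pos hb, if_pos (show b' = (f ∘ e) a from (he a hb.symm).symm)]
  · rw [if_neg hb]; exact zero_le

theorem exists_perm_extending (s : Set (Fin n)) (f : Fin n → Fin n) (hf : Set.InjOn f s) :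
    ∃ τ : Equiv.Perm (Fin n), ∀ x ∈ s, τ x = f x := by
  obtain ⟨g, hg⟩ := Set.MapsTo.exists_equiv_extend_of_card_eq (α := Fin n) (β := Fin n)
    (t := Finset.univ) (by simp) (s := s) (f := f) (fun x _ => by simp) hf
  exact ⟨g.trans (Equiv.subtypeUnivEquiv fun x => Finset.mem_univ x), hg⟩

/-- A uniformly random order of all symbols induces a uniformly random injection `D₁ → D₂`, by
symmetry under the permutations that fix `D₁` pointwise and preserve `D₂`. -/
theorem map_swapEmbedding {D₁ D₂ : Finset (Fin n)} (hd : Disjoint D₁ D₂)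
    (h : D₁.card ≤ D₂.card) :
    haveI := nonempty_embedding h
    (PMF.uniformOfFintype (Equiv.Perm (Fin n))).map (swapEmbedding h) =
      PMF.uniformOfFintype (D₁ ↪ D₂) := by
  have := nonempty_embedding h
  classical
  refine map_uniform_of_transitive _ fun σ σ' => ?_
  -- a permutation that carries `σ` to `σ'` and fixes all points outside `D₂`
  obtain ⟨τ, hτ⟩ := exists_perm_extending (n := n) ({x | ∃ a, (σ a : Fin n) = x} ∪ {x | x ∉ D₂})
    (fun x => if h : ∃ a, (σ a : Fin n) = x then σ' h.choose else x) (by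
      have hv : ∀ a, (if h : ∃ a', (σ a' : Fin n) = σ a then (σ' h.choose : Fin n) else σ a)
          = σ' a := by
        intro a
        have hex : ∃ a', (σ a' : Fin n) = σ a := ⟨a, rfl⟩
        rw [dif_pos hex, σ.injective (Subtype.ext hex.choose_spec)]
      have hn : ∀ x, x ∉ D₂ → (if h : ∃ a', (σ a' : Fin n) = x then (σ' h.choose : Fin n) else x)
          = x := by
        intro x hx
        rw [dif_neg]
        rintro ⟨a, rfl⟩
        exact hx (σ a).2
      rintro x (⟨a, rfl⟩ | hx) y (⟨b, rfl⟩ | hy) hxy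
      · simp only [hv] at hxy
        rw [σ'.injective (Subtype.ext hxy)]
      · simp only [hv] at hxy
        rw [hn y hy] at hxy
        exact absurd (hxy ▸ (σ' a).2) hy
      · simp only [hv] at hxy
        rw [hn x hx] at hxy
        exact absurd (hxy ▸ (σ' b).2) hx
      · simp only at hxy
        rwa [hn x hx, hn y hy] at hxy)
  have hτσ : ∀ a, τ (σ a) = σ' a := by
    intro a
    rw [hτ _ (Or.inl ⟨a, rfl⟩)]
    have hex : ∃ a', (σ a' : Fin n) = σ a := ⟨a, rfl⟩
    rw [dif_pos hex, σ.injective (Subtype.ext hex.choose_spec)]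
  have hfix : ∀ x, x ∉ D₂ → τ x = x := by
    intro x hx
    rw [hτ _ (Or.inr hx), dif_neg]
    rintro ⟨a, rfl⟩
    exact hx (σ a).2
  have h2 : ∀ x, τ x ∈ D₂ ↔ x ∈ D₂ := by
    intro x
    constructor
    · intro hx
      by_contra hx'
      rw [hfix x hx'] at hx; exact hx' hx
    · intro hx
      by_contra hx'
      have := τ.injective (hfix (τ x) hx')
      rw [this] at hx'; exact hx' hx
  have h1 : ∀ x, τ x ∈ D₁ ↔ x ∈ D₁ := by
    intro x
    by_cases hx : x ∈ D₂
    · exact ⟨fun h => absurd ((h2 x).2 hx) (Finset.disjoint_left.1 hd h),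
        fun h => absurd hx (Finset.disjoint_left.1 hd h)⟩
    · rw [hfix x hx]
  refine ⟨Equiv.mulLeft τ, fun π hπ => ?_⟩
  ext a
  have h3 := swapBy_mul τ π h1 h2 (a : Fin n)
  rw [hfix a (Finset.disjoint_left.1 hd a.2)] at h3
  have h4 : swapBy D₁ D₂ π a = σ a := congrArg Subtype.val (DFunLike.congr_fun hπ a)
  rw [h4, hτσ] at h3
  exact congrArg Fin.val h3

/-- The word that the perturbation returns when its injection is chosen by the permutation `π`. -/
def perturbed (y₀ : Fin n → Fin 2) (y₁ : Fin m → Fin n) (π : Equiv.Perm (Fin n)) : Fin m → Fin n :=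
  fun j => swapBy (unique y₁ \ ones y₀) (ones y₀ \ unique y₁) π (y₁ j)

/-- One formula covers both cases of the perturbation: matching the two difference sets in a random
order embeds the smaller one into the larger one, and unmatched symbols stay. -/
theorem perturbWith_eq (y₀ : Fin n → Fin 2) (y₁ : Fin m → Fin n) :
    perturbWith y₀ y₁ = (PMF.uniformOfFintype (Equiv.Perm (Fin n))).map (perturbed y₀ y₁) := by
  have hdisj : Disjoint (unique y₁ \ ones y₀) (ones y₀ \ unique y₁) :=
    Finset.disjoint_left.2 fun a h1 h2 =>
      (Finset.mem_sdiff.1 h1).2 (Finset.mem_sdiff.1 h2).1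
  unfold perturbWith
  split
  · rename_i h
    rw [← map_swapEmbedding hdisj h, PMF.map_comp]
    congr 1; funext π j
    simp only [Function.comp_apply, replaceBy, perturbed]
    by_cases hj : y₁ j ∈ unique y₁ \ ones y₀
    · rw [dif_pos hj]; rfl
    · rw [dif_neg hj]
      exact (swapSymbol_of_notMem fun b hb => hj (mem_orderedBy.1 (List.of_mem_zip hb).1)).symm
  · rename_i h
    have h' := le_of_not_ge h
    rw [← map_swapEmbedding hdisj.symm h', PMF.map_comp]
    congr 1; funext π j
    simp only [Function.comp_apply, replaceFrom, perturbed]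
    have hz : ∀ a : ↥(ones y₀ \ unique y₁), ((swapEmbedding h' π a : Fin n), (a : Fin n)) ∈
        (orderedBy (unique y₁ \ ones y₀) π).zip (orderedBy (ones y₀ \ unique y₁) π) :=
      fun a => mem_zip_swap (pair_mem_zip h' π a.2)
    split
    · rename_i hex
      have := hz hex.choose
      rw [hex.choose_spec] at this
      exact (swapSymbol_of_mem (nodup_orderedBy _ _) this).symm
    · rename_i hex
      refine (swapSymbol_of_notMem fun b hb => hex ?_).symm
      have hb2 : b ∈ ones y₀ \ unique y₁ := mem_orderedBy.1 (List.of_mem_zip hb).2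
      refine ⟨⟨b, hb2⟩, ?_⟩
      exact eq_of_mem_zip (nodup_orderedBy _ _) (hz ⟨b, hb2⟩) hb

/-- The perturbation relabels the symbols of its random word by a permutation. -/
theorem exists_perturbed_eq (y₀ : Fin n → Fin 2) (y₁ : Fin m → Fin n) (π : Equiv.Perm (Fin n)) :
    ∃ g : Equiv.Perm (Fin n), perturbed y₀ y₁ π = g ∘ y₁ := by
  obtain ⟨g, hg⟩ := exists_perm_extending {x | x ∈ unique y₁}
    (swapBy (unique y₁ \ ones y₀) (ones y₀ \ unique y₁) π) (by
      have hc : ∀ x : Fin n, (∃ b ∈ ones y₀ \ unique y₁, (x, b) ∈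
          (orderedBy (unique y₁ \ ones y₀) π).zip (orderedBy (ones y₀ \ unique y₁) π) ∧
            swapBy (unique y₁ \ ones y₀) (ones y₀ \ unique y₁) π x = b) ∨
          swapBy (unique y₁ \ ones y₀) (ones y₀ \ unique y₁) π x = x := by
        intro x
        by_cases hx : ∃ b, (x, b) ∈
          (orderedBy (unique y₁ \ ones y₀) π).zip (orderedBy (ones y₀ \ unique y₁) π)
        · obtain ⟨b, hb⟩ := hx
          exact Or.inl ⟨b, mem_orderedBy.1 (List.of_mem_zip hb).2, hb,
            swapSymbol_of_mem (nodup_orderedBy _ _) hb⟩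
        · exact Or.inr (swapSymbol_of_notMem fun b hb => hx ⟨b, hb⟩)
      intro x hx x' hx' hxx
      rcases hc x with ⟨b, hb, hz, he⟩ | he <;> rcases hc x' with ⟨b', hb', hz', he'⟩ | he'
      · rw [he, he'] at hxx
        subst hxx
        exact eq_of_mem_zip (nodup_orderedBy _ _) hz hz'
      · rw [he, he'] at hxx
        subst hxx
        exact absurd hx' (Finset.mem_sdiff.1 hb).2
      · rw [he, he'] at hxx
        subst hxx
        exact absurd hx (Finset.mem_sdiff.1 hb').2
      · rwa [he, he'] at hxx)
  refine ⟨g, funext fun j => (hg (y₁ j) ?_).symm⟩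
  exact Finset.mem_image_of_mem y₁ (Finset.mem_univ j)

/-- Relabelling all the inputs of the perturbation relabels its output. -/
theorem perturbed_equivariant (y₀ : Fin n → Fin 2) (y₁ : Fin m → Fin n) (τ π : Equiv.Perm (Fin n)) :
    perturbed (y₀ ∘ τ.symm) (τ ∘ y₁) (τ * π) = τ ∘ perturbed y₀ y₁ π := by
  have hu : ∀ a, τ a ∈ unique (τ ∘ y₁ : Fin m → Fin n) ↔ a ∈ unique y₁ := by
    intro a; simp [unique]
  have ho : ∀ a, τ a ∈ ones (y₀ ∘ τ.symm) ↔ a ∈ ones y₀ := by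
    intro a; simp [ones]
  funext j
  exact swapBy_mul τ π (fun a => by simp only [Finset.mem_sdiff, hu, ho])
    (fun a => by simp only [Finset.mem_sdiff, hu, ho]) (y₁ j)

theorem perturbDifference_eq [Nonempty (Fin m → Fin n)] (y₀ : Fin n → Fin 2) :
    perturbDifference n m y₀ = (PMF.uniformOfFintype (Fin m → Fin n)).bind fun y₁ =>
      (PMF.uniformOfFintype (Equiv.Perm (Fin n))).map (perturbed y₀ y₁) := by
  simp only [perturbDifference, perturbWith_eq]

/-- On a uniformly random binary word, the perturbation returns an exactly uniform word: its
output is a relabelling of a uniform word, and its law is invariant under relabelling. -/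
theorem bind_perturbDifference_uniform [Nonempty (Fin m → Fin n)] :
    ((PMF.uniformOfFintype (Fin n → Fin 2)).bind fun y₀ => perturbDifference n m y₀) =
      PMF.uniformOfFintype (Fin m → Fin n) := by
  set μ := (PMF.uniformOfFintype (Fin n → Fin 2)).bind fun y₀ => perturbDifference n m y₀ with hμ
  have hpost : ∀ τ : Equiv.Perm (Fin n), (PMF.uniformOfFintype (Fin m → Fin n)).map (τ ∘ ·) =
      PMF.uniformOfFintype (Fin m → Fin n) := fun τ =>
    map_uniform_equiv (Equiv.arrowCongr (Equiv.refl _) τ)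
  have hinv : ∀ τ : Equiv.Perm (Fin n), μ.map (τ ∘ ·) = μ := by
    intro τ
    have h0 : (PMF.uniformOfFintype (Fin n → Fin 2)).map (· ∘ τ.symm) =
        PMF.uniformOfFintype (Fin n → Fin 2) :=
      map_uniform_equiv (Equiv.arrowCongr τ (Equiv.refl _))
    have h2 : (PMF.uniformOfFintype (Equiv.Perm (Fin n))).map (τ * ·) =
        PMF.uniformOfFintype (Equiv.Perm (Fin n)) := map_uniform_equiv (Equiv.mulLeft τ)
    conv_rhs => rw [hμ, ← h0]
    simp only [hμ, perturbDifference_eq, PMF.map_bind, PMF.map_comp, PMF.bind_map]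
    congr 1; funext y₀
    conv_rhs => simp only [Function.comp_apply]; rw [← hpost τ, ← h2]
    simp only [PMF.bind_map, PMF.map_comp]
    congr 1; funext y₁
    simp only [Function.comp_apply]
    congr 1; funext π
    exact (perturbed_equivariant y₀ y₁ τ π).symm
  have hrel : ∀ y₁ : Fin m → Fin n, ∀ g : Equiv.Perm (Fin n),
      (PMF.uniformOfFintype (Equiv.Perm (Fin n))).map
          (fun τ : Equiv.Perm (Fin n) => (τ : Fin n → Fin n) ∘ (g ∘ y₁)) =
        (PMF.uniformOfFintype (Equiv.Perm (Fin n))).map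
          (fun τ : Equiv.Perm (Fin n) => (τ : Fin n → Fin n) ∘ y₁) := by
    intro y₁ g
    conv_rhs => rw [← map_uniform_equiv (Equiv.mulRight g), PMF.map_comp]
    rfl
  calc μ = (PMF.uniformOfFintype (Equiv.Perm (Fin n))).bind fun τ => μ.map (τ ∘ ·) := by
        simp only [hinv, PMF.bind_const]
    _ = μ.bind fun y => (PMF.uniformOfFintype (Equiv.Perm (Fin n))).map
          fun τ : Equiv.Perm (Fin n) => (τ : Fin n → Fin n) ∘ y := by
        simp only [PMF.map]; rw [PMF.bind_comm]; rfl
    _ = (PMF.uniformOfFintype (Fin m → Fin n)).bind fun y₁ =>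
          (PMF.uniformOfFintype (Equiv.Perm (Fin n))).map fun τ : Equiv.Perm (Fin n) =>
            (τ : Fin n → Fin n) ∘ y₁ := by
        simp only [hμ, perturbDifference_eq, PMF.bind_bind, PMF.bind_map]
        rw [← PMF.bind_const (PMF.uniformOfFintype (Fin n → Fin 2))
          ((PMF.uniformOfFintype (Fin m → Fin n)).bind fun y₁ =>
          (PMF.uniformOfFintype (Equiv.Perm (Fin n))).map fun τ : Equiv.Perm (Fin n) =>
            (τ : Fin n → Fin n) ∘ y₁)]
        congr 1; funext y₀; congr 1; funext y₁
        rw [← PMF.bind_const (PMF.uniformOfFintype (Equiv.Perm (Fin n)))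
          ((PMF.uniformOfFintype (Equiv.Perm (Fin n))).map fun τ : Equiv.Perm (Fin n) =>
            (τ : Fin n → Fin n) ∘ y₁)]
        congr 1; funext π
        obtain ⟨g, hg⟩ := exists_perturbed_eq y₀ y₁ π
        simp only [Function.comp_apply, hg]
        exact hrel y₁ g
    _ = (PMF.uniformOfFintype (Equiv.Perm (Fin n))).bind fun τ =>
          (PMF.uniformOfFintype (Fin m → Fin n)).map (τ ∘ ·) := by
        simp only [PMF.map]; rw [PMF.bind_comm]; rfl
    _ = _ := by simp only [hpost, PMF.bind_const]

end

end PRCode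
end

noncomputable section
namespace PRCode
open Coded
open scoped ENNReal

/-! ### The sampling procedures run in polynomial time -/

theorem polyTime_randomWord : PolyTime fun x : ℕ × ℕ => randomWord x.1 x.2 :=
  (PolyTime.mapP (g := fun x : ℕ × ℕ => uniformBelow x.1)
    (polyTime_uniformBelow.compFun PolyTimeFun.fst)).compFun
      (PolyTimeFun.fst.prod (PolyTimeFun.range PolyTimeFun.snd))

theorem wt_filter_le (l : List ℕ) (p : ℕ → Bool) : wt (l.filter p) ≤ wt l := by
  induction l with
  | nil => simp
  | cons a l ih =>
    rw [List.filter_cons]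
    split
    · rw [wt_cons, wt_cons]; omega
    · rw [wt_cons]; omega

theorem wt_filter_add_le (l : List ℕ) (x : ℕ) (hx : x ∈ l) :
    wt (l.filter fun b => ¬ b = x) + wt x + 1 ≤ wt l := by
  induction l with
  | nil => simp at hx
  | cons a l ih =>
    by_cases h : a = x
    · subst h
      have := wt_filter_le l fun b => ¬ b = a
      rw [List.filter_cons_of_neg (by simp), wt_cons]
      omega
    · have hx' : x ∈ l := by
        rcases List.mem_cons.1 hx with h' | h'
        · exact absurd h'.symm h
        · exact h'
      have := ih hx'
      rw [List.filter_cons_of_pos (by simpa using h), wt_cons, wt_cons]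
      omega

theorem polyTime_shuffle : PolyTime shuffle := by
  have h1 : PolyTime fun x : ℕ × (ℕ × (List ℕ × List ℕ)) => shuffleStep x.2.2 := by
    have hget : PolyTimeFun fun y : (ℕ × (ℕ × (List ℕ × List ℕ))) × ℕ => y.1.2.2.1.getD y.2 0 :=
      PolyTimeFun.getD.comp (PolyTimeFun.fst.snd'.snd'.fst'.prod PolyTimeFun.snd)
    have hfil : PolyTimeFun fun y : (ℕ × (ℕ × (List ℕ × List ℕ))) × ℕ =>
        y.1.2.2.1.filter fun b => ¬ b = y.1.2.2.1.getD y.2 0 :=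
      (PolyTimeFun.filter (γ := ℕ) (α := ℕ) (p := fun z => ¬ z.2 = z.1)
        (PolyTimePred.eq PolyTimeFun.snd PolyTimeFun.fst).not).comp
          (hget.prod PolyTimeFun.fst.snd'.snd'.fst')
    exact PolyTime.bind (polyTime_uniformBelow.compFun PolyTimeFun.snd.snd'.fst'.length)
      (hfil.prod (hget.cons PolyTimeFun.fst.snd'.snd'.snd'))
  have h2 := PolyTime.fold h1 2 (by
    rintro c a ⟨rem, acc⟩ s' hs
    simp only [shuffleStep, PMF.support_map, Set.mem_image] at hs
    obtain ⟨r, -, rfl⟩ := hs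
    simp only [wt_prod, wt_cons, Polynomial.eval_ofNat]
    -- the element appended to the second list has just been removed from the first, so that the
    -- total weight does not grow; beyond the end of the list, the default value `0` is appended
    by_cases hr : r < rem.length
    · have hm : rem.getD r 0 ∈ rem := by
        rw [List.getD_eq_getElem _ _ hr]; exact List.getElem_mem _
      have := wt_filter_add_le rem _ hm
      omega
    · have h0 : rem.getD r 0 = 0 := by
        rw [List.getD_eq_getElem?_getD, List.getElem?_eq_none (by omega)]; rfl
      rw [h0]
      have := wt_filter_le rem fun b => ¬ b = 0
      rw [wt_nat]
      omega)
  have hr : PolyTimeFun fun n : ℕ => List.range n := PolyTimeFun.range PolyTimeFun.id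
  have h3 := h2.compFun (f := fun n : ℕ => (0, (List.range n, (List.range n, ([] : List ℕ)))))
    ((PolyTimeFun.const 0).prod (hr.prod (hr.prod (PolyTimeFun.const _))))
  exact PolyTimeFun.compPMF PolyTimeFun.snd h3

theorem polyTime_randomPreimage : PolyTime fun x : List ℕ × ℕ => randomPreimage x.1 x.2 := by
  have hfil : PolyTimeFun fun x : List ℕ × ℕ =>
      (List.range x.1.length).filter fun a => x.1.getD a 0 = x.2 :=
    (PolyTimeFun.filter (γ := List ℕ × ℕ) (α := ℕ) (p := fun z => z.1.1.getD z.2 0 = z.1.2)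
      (PolyTimePred.eq (PolyTimeFun.getD.comp (PolyTimeFun.fst.fst'.prod PolyTimeFun.snd))
        PolyTimeFun.fst.snd')).comp
      (PolyTimeFun.id.prod (PolyTimeFun.range PolyTimeFun.fst.length))
  exact PolyTime.bind (polyTime_uniformBelow.compFun hfil.length)
    (PolyTimeFun.getD.comp ((hfil.comp PolyTimeFun.fst).prod PolyTimeFun.snd))

theorem polyTimeFun_swapSymbol :
    PolyTimeFun fun x : (List ℕ × List ℕ) × ℕ => swapSymbol x.1.1 x.1.2 x.2 := by
  have hstep : PolyTimeFun fun x : ℕ × (ℕ × (List ℕ × ℕ)) => swapStep x.1 x.2.2 x.2.1 := by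
    have hc : PolyTimeFun fun y : (ℕ × (ℕ × (List ℕ × ℕ))) × (ℕ × List ℕ) =>
        (y.2.2, if y.1.2.1 = y.1.1 then y.2.1 else y.1.2.2.2) :=
      PolyTimeFun.snd.snd'.prod (PolyTimeFun.ifPred
        (PolyTimePred.eq PolyTimeFun.fst.snd'.fst' PolyTimeFun.fst.fst') PolyTimeFun.snd.fst'
        PolyTimeFun.fst.snd'.snd'.snd')
    have := PolyTimeFun.listCases (f := fun x : ℕ × (ℕ × (List ℕ × ℕ)) => x.2.2.1)
      PolyTimeFun.snd.snd'.fst' PolyTimeFun.snd.snd' hc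
    convert this using 2 with x
    rcases x with ⟨x, a, B, r⟩
    cases B <;> rfl
  have h := PolyTimeFun.foldl hstep 0 (by
    rintro c a ⟨B, r⟩
    cases B with
    | nil => simp [swapStep]
    | cons b B =>
      simp only [swapStep, wt_prod, wt_cons, Polynomial.eval_zero]
      split <;> omega)
  exact (h.comp (f := fun x : (List ℕ × List ℕ) × ℕ => (x.2, (x.1.1, (x.1.2, x.2))))
    (PolyTimeFun.snd.prod (PolyTimeFun.fst.fst'.prod (PolyTimeFun.fst.snd'.prod
      PolyTimeFun.snd)))).snd'

/-- The encoder of the indexing construction after the call of the binary encoder, on lists of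
numbers. -/
def postprocess (n : ℕ) (ψ y₀ : List ℕ) : PMF (List ℕ) :=
  (randomWord n (indexLength n)).bind fun y₁ => (shuffle n).bind fun P =>
    mapP (randomPreimage ψ) (y₁.map fun x =>
      swapSymbol (P.filter fun a => a ∈ y₁ ∧ ¬ y₀.getD a 0 = 1)
        (P.filter fun a => y₀.getD a 0 = 1 ∧ ¬ a ∈ y₁) x)

theorem polyTime_postprocess :
    PolyTime fun x : (ℕ × List ℕ) × List ℕ => postprocess x.1.1 x.1.2 x.2 := by
  -- the two tests, in the context `((y₀, y₁), a)`
  have hone : PolyTimePred fun z : (List ℕ × List ℕ) × ℕ => z.1.1.getD z.2 0 = 1 :=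
    PolyTimePred.eq (PolyTimeFun.getD.comp (PolyTimeFun.fst.fst'.prod PolyTimeFun.snd))
      (PolyTimeFun.const 1)
  have hmem : PolyTimePred fun z : (List ℕ × List ℕ) × ℕ => z.2 ∈ z.1.2 :=
    PolyTimePred.mem.comp (PolyTimeFun.snd.prod PolyTimeFun.fst.snd')
  have hctx : PolyTimeFun fun w : (((ℕ × List ℕ) × List ℕ) × List ℕ) × List ℕ =>
      (((w.1.1.2, w.1.2), w.2) : (List ℕ × List ℕ) × List ℕ) :=
    (PolyTimeFun.fst.fst'.snd'.prod PolyTimeFun.fst.snd').prod PolyTimeFun.snd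
  have hA := (PolyTimeFun.filter (hmem.and hone.not)).comp hctx
  have hB := (PolyTimeFun.filter (hone.and hmem.not)).comp hctx
  have hmap := (PolyTimeFun.map polyTimeFun_swapSymbol).comp
    ((hA.prod hB).prod PolyTimeFun.fst.snd')
  have hlift := (PolyTime.mapP polyTime_randomPreimage).compFun
    (PolyTimeFun.fst.fst'.fst'.snd'.prod hmap)
  have h2 := PolyTime.bind (polyTime_shuffle.compFun
    (f := fun w : ((ℕ × List ℕ) × List ℕ) × List ℕ => w.1.1.1) PolyTimeFun.fst.fst'.fst') hlift
  exact PolyTime.bind (polyTime_randomWord.compFun (PolyTimeFun.fst.fst'.prod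
    (polyTimeFun_indexLength.comp PolyTimeFun.fst.fst'))) h2

/-- On lists of numbers, `postprocess` samples exactly the distribution prescribed by the
construction. -/
theorem postprocess_eq {ρ n : ℕ} (hρ : 0 < ρ) (ψ : BalancedMap ρ n) (y₀ : Fin n → Fin 2) :
    postprocess n (wordList ψ.1) (wordList y₀) =
      ((perturbDifference n (indexLength n) y₀).bind fun y => liftWord hρ ψ y).map wordList := by
  have hget : ∀ a : Fin n, (wordList y₀).getD a 0 = 1 ↔ a ∈ ones y₀ := by
    intro a
    simp [wordList, List.getD_eq_getElem?_getD, ones, Fin.ext_iff]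
  rw [perturbDifference_eq, postprocess, randomWord_eq, shuffle_eq]
  simp only [PMF.bind_map, PMF.bind_bind, PMF.map_bind, Function.comp_def]
  congr 1; funext y₁; congr 1; funext π
  rw [← mapP_randomPreimage_eq hρ]
  congr 1
  have hf : ∀ (D : Finset (Fin n)) (p : ℕ → Bool), (∀ a : Fin n, p a = true ↔ a ∈ D) →
      (wordList π).filter p = (orderedBy D π).map Fin.val := by
    intro D p hp
    rw [wordList_eq_map, List.filter_map, orderedBy]
    congr 1
    apply List.filter_congr
    intro a _
    rw [Bool.eq_iff_iff]
    simp [hp a]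
  rw [hf (unique y₁ \ ones y₀) _ (fun a => by
      rw [decide_eq_true_eq, mem_wordList, hget, Finset.mem_sdiff]),
    hf (ones y₀ \ unique y₁) _ (fun a => by
      rw [decide_eq_true_eq, mem_wordList, hget, Finset.mem_sdiff])]
  conv_rhs => rw [wordList]
  rw [wordList, List.map_ofFn]
  congr 1
  funext j
  exact swapSymbol_map Fin.val_injective _ _ _

/-! ### Uniform balanced maps -/

/-- Relabelling the source of a balanced map. -/
def BalancedMap.precomp {ρ n : ℕ} (ψ : BalancedMap ρ n) (π : Equiv.Perm (Fin (ρ * n))) :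
    BalancedMap ρ n :=
  ⟨ψ.1 ∘ π, fun j => by
    refine Eq.trans ?_ (ψ.2 j)
    exact Finset.card_equiv π fun a => by simp⟩

/-- Relabelling the target of a balanced map. -/
def BalancedMap.postcomp {ρ n : ℕ} (g : Equiv.Perm (Fin n)) (ψ : BalancedMap ρ n) :
    BalancedMap ρ n :=
  ⟨g ∘ ψ.1, fun j => by
    refine Eq.trans ?_ (ψ.2 (g.symm j))
    congr 1; ext a; simp [Equiv.eq_symm_apply]⟩

theorem BalancedMap.exists_precomp_eq {ρ n : ℕ} (ψ ψ' : BalancedMap ρ n) :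
    ∃ π : Equiv.Perm (Fin (ρ * n)), ψ.precomp π = ψ' := by
  have h : ∀ j, Nonempty ({a // ψ'.1 a = j} ≃ {a // ψ.1 a = j}) := fun j =>
    ⟨Fintype.equivOfCardEq (by
      rw [Fintype.card_subtype, Fintype.card_subtype]
      exact (ψ'.2 j).trans (ψ.2 j).symm)⟩
  let π := (Equiv.sigmaFiberEquiv ψ'.1).symm.trans
    ((Equiv.sigmaCongrRight fun j => (h j).some).trans (Equiv.sigmaFiberEquiv ψ.1))
  refine ⟨π, Subtype.ext (funext fun a => ?_)⟩
  exact ((h (ψ'.1 a)).some ⟨a, rfl⟩).2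

/-- The balanced map `a ↦ a mod n`. -/
def baseBalanced (ρ n : ℕ) : BalancedMap ρ n :=
  ⟨Fin.modNat, fun j => by
    refine Eq.trans ?_ (Fintype.card_fin ρ)
    rw [← Finset.card_univ]
    refine (Finset.card_bij (fun i _ => finProdFinEquiv (i, j)) ?_ ?_ ?_).symm
    · intro i _
      simp only [Finset.mem_filter, Finset.mem_univ, true_and]
      exact congrArg Prod.snd (finProdFinEquiv.symm_apply_apply (i, j))
    · intro i _ i' _ h
      exact congrArg Prod.fst (finProdFinEquiv.injective h)
    · intro a ha
      simp only [Finset.mem_filter, Finset.mem_univ, true_and] at ha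
      refine ⟨a.divNat, Finset.mem_univ _, ?_⟩
      rw [← ha]
      exact finProdFinEquiv.apply_symm_apply a⟩

/-- Permutations of the source act transitively on balanced maps. -/
theorem map_precomp_baseBalanced (ρ n : ℕ) :
    (PMF.uniformOfFintype (Equiv.Perm (Fin (ρ * n)))).map (baseBalanced ρ n).precomp =
      PMF.uniformOfFintype (BalancedMap ρ n) := by
  refine map_uniform_of_transitive _ fun b b' => ?_
  obtain ⟨e, he⟩ := b.exists_precomp_eq b'
  refine ⟨Equiv.mulRight e, fun π hπ => ?_⟩
  rw [← he, ← hπ]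
  rfl

theorem map_postcomp_uniform {ρ n : ℕ} (g : Equiv.Perm (Fin n)) :
    (PMF.uniformOfFintype (BalancedMap ρ n)).map (BalancedMap.postcomp g) =
      PMF.uniformOfFintype (BalancedMap ρ n) := by
  refine map_uniform_equiv (α := BalancedMap ρ n) (β := BalancedMap ρ n)
    ⟨BalancedMap.postcomp g, BalancedMap.postcomp g.symm, fun ψ => ?_, fun ψ => ?_⟩ <;>
  · refine Subtype.ext (funext fun a => ?_)
    simp [BalancedMap.postcomp]

/-- A uniformly random balanced map, as a list: the map `a ↦ a mod n` after a random permutation. -/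
def randomBalanced (ρ n : ℕ) : PMF (List ℕ) :=
  (shuffle (ρ * n)).map fun P => P.map fun a => a % n

theorem randomBalanced_eq (ρ n : ℕ) : randomBalanced ρ n =
    (PMF.uniformOfFintype (BalancedMap ρ n)).map fun ψ => wordList ψ.1 := by
  rw [randomBalanced, shuffle_eq, ← map_precomp_baseBalanced, PMF.map_comp, PMF.map_comp]
  congr 1; funext π
  simp only [Function.comp_apply, wordList, List.map_ofFn]
  rfl

theorem polyTime_randomBalanced (ρ : ℕ) : PolyTime fun n : ℕ => randomBalanced ρ n :=
  PolyTime.bind (f := fun n : ℕ => shuffle (ρ * n))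
    (g := fun x : ℕ × List ℕ => PMF.pure (x.2.map fun a => a % x.1))
    (polyTime_shuffle.compFun ((PolyTimeFun.const ρ).mul PolyTimeFun.id))
    (PolyTimeFun.map (g := fun x : ℕ × ℕ => x.2 % x.1) (PolyTimeFun.snd.mod PolyTimeFun.fst))

/-- The indicator word of the image of a word under a map, on lists of numbers. -/
def indicatorList (n : ℕ) (ψ z : List ℕ) : List ℕ :=
  (List.range n).map fun i => if i ∈ z.map (fun a => ψ.getD a 0) then 1 else 0

theorem polyTimeFun_indicatorList :
    PolyTimeFun fun x : (ℕ × List ℕ) × List ℕ => indicatorList x.1.1 x.1.2 x.2 := by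
  have himg : PolyTimeFun fun x : (ℕ × List ℕ) × List ℕ => x.2.map fun a => x.1.2.getD a 0 :=
    (PolyTimeFun.map (g := fun y : List ℕ × ℕ => y.1.getD y.2 0) PolyTimeFun.getD).comp
      (PolyTimeFun.fst.snd'.prod PolyTimeFun.snd)
  exact (PolyTimeFun.map (g := fun y : List ℕ × ℕ => if y.2 ∈ y.1 then 1 else 0)
    (PolyTimePred.mem.comp (PolyTimeFun.snd.prod PolyTimeFun.fst))).comp
      (himg.prod (PolyTimeFun.range PolyTimeFun.fst.fst'))

theorem indicatorList_eq {ρ n : ℕ} (ψ : BalancedMap ρ n) (z : List (Fin (ρ * n))) :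
    indicatorList n (wordList ψ.1) (z.map Fin.val) = wordList (indicatorWord ψ z) := by
  have hget : ∀ a : Fin (ρ * n), (wordList ψ.1).getD a 0 = ψ.1 a := by
    intro a; simp [wordList, List.getD_eq_getElem?_getD]
  have hr : List.range n = List.ofFn (fun i : Fin n => (i : ℕ)) := by
    rw [List.ofFn_eq_map]; simp [List.range_eq_range']
  have hz : (z.map Fin.val).map (fun a => (wordList ψ.1).getD a 0) =
      z.map fun a => ((ψ.1 a : Fin n) : ℕ) := by
    rw [List.map_map]; exact List.map_congr_left fun a _ => hget a
  rw [indicatorList, hz, hr, List.map_ofFn, wordList]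
  congr 1; funext i
  simp only [Function.comp_apply, indicatorWord]
  have : ((i : ℕ) ∈ z.map fun a => ((ψ.1 a : Fin n) : ℕ)) ↔ i ∈ z.map ψ.1 := by
    simp [Fin.ext_iff]
  by_cases h : i ∈ z.map ψ.1
  · rw [if_pos (this.2 h), if_pos h]; rfl
  · rw [if_neg fun h' => h (this.1 h'), if_neg h]; rfl

end PRCode
end

noncomputable section
namespace PRCode
open Coded
open scoped ENNReal

/-! ### Efficiency of the indexing construction -/

section
variable {α β γ : Type} [Coded α] [Coded β] [Coded γ]

/-- From the notion of efficiency in the definition of a scheme to the typed one, provided that the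
weight of an argument is at least the security parameter. -/
theorem IsPPT.polyTime {sec : α → ℕ} {inp : α → Data} {out : α → PMF Data} (h : IsPPT sec inp out)
    (hc : ∀ a, code a = inp a) (hs : ∀ a, sec a ≤ wt a) : PolyTime out := by
  obtain ⟨P, p, hP⟩ := h
  have hp : ∀ a, p.eval (sec a + (inp a).size) ≤ (p.comp (2 * Polynomial.X)).eval (wt a) := by
    intro a
    rw [Polynomial.eval_comp]
    refine eval_mono p ?_
    have := size_le a
    rw [hc] at this
    have := hs a
    simp only [Polynomial.eval_mul, Polynomial.eval_ofNat, Polynomial.eval_X]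
    omega
  refine PolyTime.of_bounds P (p.comp (2 * Polynomial.X)) (p.comp (2 * Polynomial.X) + Polynomial.X)
    (fun a => ?_) (fun a r hr => ?_) fun a d hd => ?_
  · rw [hc, (hP a).1]; exact (PMF.map_id _).symm
  · rw [hc] at hr
    exact ((hP a).2 r hr).trans (hp a)
  · rw [← (hP a).1, Prog.output, PMF.support_map] at hd
    obtain ⟨r, hr, rfl⟩ := hd
    have h1 := size_le_of_mem_run _ _ _ r hr
    have h2 := ((hP a).2 r hr).trans (hp a)
    have h3 := size_le a
    rw [hc] at h3
    simp only [Polynomial.eval_add, Polynomial.eval_X]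
    exact h1.trans (add_le_add h2 h3)

/-- From the typed notion of efficiency back to the one in the definition of a scheme. -/
theorem PolyTime.isPPT {sec : α → ℕ} {inp : α → Data} {f : α → PMF β} (h : PolyTime f)
    (hc : ∀ a, code a = inp a) (hw : ∀ a, wt a ≤ sec a + (inp a).size + 1) :
    IsPPT sec inp fun a => (f a).map code := by
  obtain ⟨P, p, hP⟩ := h
  refine ⟨P, p.comp (Polynomial.X + 1), fun a => ⟨?_, fun r hr => ?_⟩⟩
  · rw [← hc]; exact (hP a).1
  · rw [← hc] at hr
    refine ((hP a).2.1 r hr).trans ?_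
    rw [Polynomial.eval_comp]
    refine eval_mono p ?_
    simpa using hw a

/-- A program returns codes only; the bound on the weights has to be supplied. -/
theorem PolyTime.of_code {f : α → PMF β} (h : PolyTime fun a => (f a).map (code : β → Data))
    (q : Polynomial ℕ) (hq : ∀ a, ∀ b ∈ (f a).support, wt b ≤ q.eval (wt a)) : PolyTime f := by
  obtain ⟨P, p, hP⟩ := h
  refine PolyTime.of_bounds P p q (fun a => ?_) (fun a => (hP a).2.1) hq
  rw [(hP a).1, PMF.map_comp]; rfl

theorem PolyTimeFun.of_code {f : α → β} (h : PolyTimeFun fun a => code (f a)) (q : Polynomial ℕ)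
    (hq : ∀ a, wt (f a) ≤ q.eval (wt a)) : PolyTimeFun f := by
  refine PolyTime.of_code ?_ q fun a b hb => ?_
  · unfold PolyTimeFun at h
    simpa only [PMF.pure_map] using h
  · rw [PMF.support_pure, Set.mem_singleton_iff] at hb
    rw [hb]; exact hq a

theorem PolyTimeFun.code {f : α → β} (hf : PolyTimeFun f) : PolyTimeFun fun a => code (f a) := by
  have : PolyTimeFun (Coded.code : β → Data) :=
    .of_basic .id Polynomial.X (fun _ => rfl) fun b => by
      rw [Polynomial.eval_X]; exact size_le b
  exact this.comp hf

theorem PolyTimeFun.dataFst {f : α → Data} (hf : PolyTimeFun f) :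
    PolyTimeFun fun a => (f a).fst := by
  have : PolyTimeFun Data.fst := .of_basic .fst (Polynomial.X + 1) (fun _ => rfl) fun d => by
    cases d <;> simp [Data.fst, Coded.wt, Data.size]; omega
  exact this.comp hf

theorem PolyTimeFun.dataSnd {f : α → Data} (hf : PolyTimeFun f) :
    PolyTimeFun fun a => (f a).snd := by
  have : PolyTimeFun Data.snd := .of_basic .snd (Polynomial.X + 1) (fun _ => rfl) fun d => by
    cases d <;> simp [Data.snd, Coded.wt, Data.size]; omega
  exact this.comp hf

theorem PolyTimeFun.dataPair {f g : α → Data} (hf : PolyTimeFun f) (hg : PolyTimeFun g) :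
    PolyTimeFun fun a => Data.pair (f a) (g a) := (hf.prod hg).code

end

theorem indexLength_le (n : ℕ) : indexLength n ≤ n := by
  rw [indexLength, Nat.ceil_le]
  have : Real.log 2 ≤ 1 := by linarith [Real.log_two_lt_d9]
  nlinarith [(Nat.cast_nonneg n : (0 : ℝ) ≤ n)]

theorem wt_le_of_forall_le {l : List ℕ} {b : ℕ} (h : ∀ a ∈ l, a ≤ b) :
    wt l ≤ l.length * (b + 2) + 1 := by
  induction l with
  | nil => simp [wt_nil]
  | cons a l ih =>
    have h1 := ih fun c hc => h c (List.mem_cons_of_mem _ hc)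
    have h2 := h a List.mem_cons_self
    rw [wt_cons, wt_nat, List.length_cons, Nat.succ_mul]
    omega

theorem wt_wordList_le {m n : ℕ} (w : Fin m → Fin n) : wt (wordList w) ≤ m * (n + 2) + 1 := by
  have := wt_le_of_forall_le (l := wordList w) (b := n) (by
    intro a ha
    rw [wordList, List.mem_ofFn] at ha
    obtain ⟨i, rfl⟩ := ha
    exact (w i).isLt.le)
  simpa [wordList] using this

variable {q : ℕ → ℕ}

/-- The inputs of the encoder, for all security parameters.  Their weight counts the security
parameter in unary. -/
def EncInput (S : Scheme q) : Type := Σ l, S.Key l × (Fin (S.msgLength l) → Fin 2)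

instance (S : Scheme q) : Coded (EncInput S) where
  code i := .pair (.num i.1) (.pair (S.codeKey i.1 i.2.1) (codeWord i.2.2))
  wt i := i.1 + (Data.pair (.num i.1) (.pair (S.codeKey i.1 i.2.1) (codeWord i.2.2))).size
  size_le _ := Nat.le_add_left _ _

/-- The input of the encoder that consists of a given key and message. -/
def EncInput.of (S : Scheme q) (l : ℕ) (sk : S.Key l) (msg : Fin (S.msgLength l) → Fin 2) :
    EncInput S := ⟨l, (sk, msg)⟩

/-- The inputs of the decoder, for all security parameters. -/
def DecInput (S : Scheme q) : Type := Σ l, S.Key l × List (Fin (q l))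

instance (S : Scheme q) : Coded (DecInput S) where
  code i := .pair (.num i.1) (.pair (S.codeKey i.1 i.2.1) (codeString i.2.2))
  wt i := i.1 + (Data.pair (.num i.1) (.pair (S.codeKey i.1 i.2.1) (codeString i.2.2))).size
  size_le _ := Nat.le_add_left _ _

/-- The input of the decoder that consists of a given key and string. -/
def DecInput.of (S : Scheme q) (l : ℕ) (sk : S.Key l) (z : List (Fin (q l))) : DecInput S :=
  ⟨l, (sk, z)⟩

namespace Scheme.Efficient

variable {S : Scheme fun _ => 2}

theorem polyTimeFun_blockLength (hS : S.Efficient) : PolyTimeFun S.blockLength := by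
  obtain ⟨p, hp⟩ := hS.lengths_poly
  refine PolyTimeFun.of_code (hS.blockLength_ppt.polyTime (fun _ => rfl) fun l => Nat.le_succ l)
    (p + 1) fun l => ?_
  have := (hp l).1
  have h2 := eval_mono p (Nat.le_succ l)
  simp only [Polynomial.eval_add, Polynomial.eval_one, wt_nat]
  exact Nat.succ_le_succ (this.trans h2)

/-- Encoder and decoder of the indexing construction can extract the block length of the binary code
and the table of the balanced map from their input. -/
theorem polyTimeFun_context (hS : S.Efficient) (ρ : ℕ) {α : Type} [Coded α] {l : α → ℕ}
    {ψ : ∀ a, BalancedMap ρ (S.blockLength (l a))} {d : α → Data} (hd : PolyTimeFun d)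
    (hl : ∀ a, (d a).fst = .num (l a)) (hw : ∀ a, l a ≤ wt a)
    (hψ : ∀ a, (d a).snd.fst.snd = codeWord (ψ a).1) :
    PolyTimeFun fun a => (S.blockLength (l a), wordList (ψ a).1) := by
  obtain ⟨p, hp⟩ := hS.lengths_poly
  have h1 : PolyTimeFun l := by
    refine PolyTimeFun.of_code ?_ (Polynomial.X + 1) fun a => ?_
    · have := hd.dataFst
      simp only [hl] at this
      exact this
    · simpa [wt_nat] using hw a
  refine (hS.polyTimeFun_blockLength.comp h1).prod ?_
  refine PolyTimeFun.of_code ?_ ((Polynomial.C ρ * p) * (p + 2) + 1) fun a => ?_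
  · have := hd.dataSnd.dataFst.dataSnd
    simp only [hψ] at this
    simpa only [code_wordList] using this
  · refine (wt_wordList_le _).trans ?_
    have := ((hp (l a)).1).trans (eval_mono p (hw a))
    simp only [Polynomial.eval_add, Polynomial.eval_mul, Polynomial.eval_C, Polynomial.eval_ofNat,
      Polynomial.eval_one]
    gcongr

theorem indexing_enc (hS : S.Efficient) (ρ : ℕ) (hρ : 0 < ρ) :
    PolyTime fun i : EncInput (indexing S ρ hρ) =>
    ((indexing S ρ hρ).enc i.1 i.2.1 i.2.2).map wordList := by
  obtain ⟨p, hp⟩ := hS.lengths_poly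
  have hctx : PolyTimeFun fun i : EncInput (indexing S ρ hρ) =>
      (S.blockLength i.1, wordList i.2.1.2.1) :=
    hS.polyTimeFun_context ρ (d := fun i => code i) PolyTimeFun.id.code (fun _ => rfl)
      (fun i => Nat.le_add_right _ _) fun _ => rfl
  have hin : PolyTimeFun fun i : EncInput (indexing S ρ hρ) =>
      EncInput.of S i.1 i.2.1.1 i.2.2 := by
    refine PolyTimeFun.of_code ?_ Polynomial.X fun i => ?_
    · have hd : PolyTimeFun fun i : EncInput (indexing S ρ hρ) => code i := PolyTimeFun.id.code
      exact hd.dataFst.dataPair (hd.dataSnd.dataFst.dataFst.dataPair hd.dataSnd.dataSnd)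
    · rw [Polynomial.eval_X]
      simp only [Coded.wt, indexing, Data.size, EncInput.of]
      omega
  have henc : PolyTime fun i : EncInput S => (S.enc i.1 i.2.1 i.2.2).map wordList := by
    refine PolyTime.of_code ?_ (p * (2 + 2) + 1) ?_
    · have := IsPPT.polyTime (α := EncInput S) hS.enc_ppt (fun _ => rfl)
        fun i => Nat.le_add_right _ _
      simp only [PMF.map_comp, Function.comp_def, code_wordList]
      exact this
    · intro i b hb
      rw [PMF.support_map] at hb
      obtain ⟨w, -, rfl⟩ := hb
      refine (wt_wordList_le w).trans ?_
      have : S.blockLength i.1 ≤ p.eval (wt i) :=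
        ((hp i.1).1).trans (eval_mono p (Nat.le_add_right _ _))
      simp only [Polynomial.eval_add, Polynomial.eval_mul, Polynomial.eval_ofNat,
        Polynomial.eval_one]
      gcongr
  have h := PolyTime.bind (henc.compFun hin) (polyTime_postprocess.compFun
    ((hctx.comp PolyTimeFun.fst).prod PolyTimeFun.snd))
  convert h using 2 with i
  simp only [PMF.bind_map, Function.comp_def]
  simp only [indexing, PMF.map_bind]
  refine congrArg _ (funext fun y₀ => ?_)
  rw [← PMF.map_bind]
  exact (postprocess_eq hρ i.2.1.2 y₀).symm

theorem indexing_dec (hS : S.Efficient) (ρ : ℕ) (hρ : 0 < ρ) :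
    PolyTime fun i : DecInput (indexing S ρ hρ) =>
    ((indexing S ρ hρ).dec i.1 i.2.1 i.2.2).map codeResult := by
  obtain ⟨p, hp⟩ := hS.lengths_poly
  have hd : PolyTimeFun fun i : DecInput (indexing S ρ hρ) => code i := PolyTimeFun.id.code
  have hctx : PolyTimeFun fun i : DecInput (indexing S ρ hρ) =>
      (S.blockLength i.1, wordList i.2.1.2.1) :=
    hS.polyTimeFun_context ρ hd (fun _ => rfl) (fun i => Nat.le_add_right _ _) fun _ => rfl
  have hcode : ∀ (k : ℕ) (z : List (Fin k)), code (z.map Fin.val) = codeString z := by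
    intro k z
    simp only [Coded.code, codeString, List.map_map]; rfl
  have hz : PolyTimeFun fun i : DecInput (indexing S ρ hρ) => i.2.2.map Fin.val := by
    refine PolyTimeFun.of_code ?_ (Polynomial.X * (Polynomial.C ρ * p + 2) + 1) fun i => ?_
    · simp only [hcode]
      exact hd.dataSnd.dataSnd
    · refine (wt_le_of_forall_le (b := ρ * S.blockLength i.1) ?_).trans ?_
      · intro a ha
        rw [List.mem_map] at ha
        obtain ⟨x, -, rfl⟩ := ha
        exact x.isLt.le
      · have h1 : S.blockLength i.1 ≤ p.eval (wt i) :=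
          ((hp i.1).1).trans (eval_mono p (Nat.le_add_right _ _))
        have h2 := length_le_listSize (i.2.2.map Fin.val)
        rw [hcode] at h2
        have h3 : (codeString i.2.2).size ≤ wt i := by
          simp only [Coded.wt, Data.size]; omega
        simp only [Polynomial.eval_add, Polynomial.eval_mul, Polynomial.eval_ofNat,
          Polynomial.eval_one, Polynomial.eval_X, Polynomial.eval_C]
        have h4 := h2.trans h3
        gcongr
  have hy := polyTimeFun_indicatorList.comp (hctx.prod hz)
  have hin : PolyTimeFun fun i : DecInput (indexing S ρ hρ) =>
      DecInput.of S i.1 i.2.1.1 (List.ofFn (indicatorWord i.2.1.2 i.2.2)) := by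
    refine PolyTimeFun.of_code ?_ (3 * Polynomial.X + (p * (2 + 2) + 1)) fun i => ?_
    · have := hd.dataFst.dataPair (hd.dataSnd.dataFst.dataFst.dataPair hy.code)
      simp only [indicatorList_eq, code_wordList] at this
      exact this
    · have h1 : S.blockLength i.1 ≤ p.eval (wt i) :=
        ((hp i.1).1).trans (eval_mono p (Nat.le_add_right _ _))
      have h2 := (size_le (wordList (indicatorWord i.2.1.2 i.2.2))).trans (wt_wordList_le _)
      rw [code_wordList] at h2
      have h3 : S.blockLength i.1 * (2 + 2) ≤ p.eval (wt i) * (2 + 2) := Nat.mul_le_mul_right _ h1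
      have h4 : wt i = i.1 + (Data.pair (.num i.1) (.pair
        (.pair (S.codeKey i.1 i.2.1.1) (codeWord i.2.1.2.1)) (codeString i.2.2))).size := rfl
      have h5 : wt (DecInput.of S i.1 i.2.1.1 (List.ofFn (indicatorWord i.2.1.2 i.2.2))) =
        i.1 + (Data.pair (.num i.1) (.pair (S.codeKey i.1 i.2.1.1)
          (codeWord (indicatorWord i.2.1.2 i.2.2)))).size := rfl
      simp only [Data.size] at h4 h5
      simp only [Polynomial.eval_add, Polynomial.eval_mul, Polynomial.eval_ofNat,
        Polynomial.eval_one, Polynomial.eval_X]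
      omega
  exact (IsPPT.polyTime (α := DecInput S) hS.dec_ppt (fun _ => rfl)
    fun i => Nat.le_add_right _ _).compFun hin

theorem indexing_efficient (hS : S.Efficient) (ρ : ℕ) (hρ : 0 < ρ) :
    (indexing S ρ hρ).Efficient where
  key_ppt := by
    have h1 : PolyTime fun l : ℕ => (S.key l).map (S.codeKey l) :=
      hS.key_ppt.polyTime (fun _ => rfl) fun l => Nat.le_succ l
    have h2 := (polyTime_randomBalanced ρ).compFun hS.polyTimeFun_blockLength
    have h3 := (PolyTime.prod h1 h2).isPPT (sec := fun l : ℕ => l) (inp := fun l => Data.num l)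
      (fun _ => rfl) (fun l => by rw [wt_nat]; omega)
    convert h3 using 2 with l
    simp only [indexing, randomBalanced_eq, PMF.map_bind, PMF.bind_map, PMF.map_comp,
      Function.comp_def, code_prod, code_wordList]
    rfl
  enc_ppt := by
    have h := (hS.indexing_enc ρ hρ).isPPT (sec := fun i => i.1) (inp := fun i => code i)
      (fun _ => rfl) (fun i => Nat.le_succ _)
    simp only [PMF.map_comp, Function.comp_def, code_wordList] at h
    exact h
  dec_ppt := by
    have h := (hS.indexing_dec ρ hρ).isPPT (sec := fun i => i.1) (inp := fun i => code i)
      (fun _ => rfl) (fun i => Nat.le_succ _)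
    simp only [PMF.map_comp] at h
    exact h
  blockLength_ppt := by
    have h := (polyTimeFun_indexLength.comp hS.polyTimeFun_blockLength).isPPT
      (sec := fun l : ℕ => l) (inp := fun l => Data.num l) (fun _ => rfl)
      (fun l => by rw [wt_nat]; omega)
    simp only [PMF.pure_map] at h
    exact h
  lengths_poly := by
    obtain ⟨p, hp⟩ := hS.lengths_poly
    refine ⟨p + (Polynomial.C ρ * p * (p + 2) + 1) + 1, fun l => ⟨?_, ?_, fun sk => ?_⟩⟩
    · have := (indexLength_le (S.blockLength l)).trans (hp l).1
      simp only [Polynomial.eval_add]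
      exact this.trans (by omega)
    · have := (hp l).2.1
      simp only [Polynomial.eval_add]
      exact this.trans (by omega)
    · have h1 := (hp l).2.2 sk.1
      have h2 := (size_le (wordList sk.2.1)).trans (wt_wordList_le _)
      rw [code_wordList] at h2
      have h3 : ρ * S.blockLength l * (S.blockLength l + 2) ≤ ρ * p.eval l * (p.eval l + 2) := by
        have := (hp l).1
        gcongr
      have h4 : ((indexing S ρ hρ).codeKey l sk).size =
        (S.codeKey l sk.1).size + (codeWord sk.2.1).size + 1 := rfl
      simp only [Polynomial.eval_add, Polynomial.eval_mul, Polynomial.eval_C,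
        Polynomial.eval_ofNat, Polynomial.eval_one]
      omega

end Scheme.Efficient

end PRCode
end

noncomputable section
namespace PRCode
open Coded
open scoped ENNReal

/-! ### Simulating an adversary -/

/-- The program with every query replaced by the answer `0`, so that its behaviour with any oracle
is that of the original program with `noOracle`. -/
def Prog.strip : Prog → Prog
  | .ask => .const (.num 0)
  | .fork f g => .fork f.strip g.strip
  | .comp g f => .comp g.strip f.strip
  | .ite c f g => .ite c.strip f.strip g.strip
  | .loop f => .loop f.strip
  | P => P

theorem run_strip (O : Oracle) (P : Prog) (x : Data) : P.strip.run O x = P.run noOracle x := by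
  induction P generalizing x with
  | ask => simp [Prog.strip, Prog.run, noOracle, PMF.pure_map]
  | fork f g hf hg => simp only [Prog.strip, Prog.run, hf, hg]
  | comp g f hg hf => simp only [Prog.strip, Prog.run, hf, hg]
  | ite c f g hc hf hg => simp only [Prog.strip, Prog.run, hc, hf, hg]
  | loop f hf =>
    have : f.strip.run O = f.run noOracle := funext hf
    match x with
    | .pair (.num t) x => simp only [Prog.strip, Prog.run, this]
    | .num k => rfl
    | .pair (.pair _ _) _ => rfl
  | rand => cases x <;> rfl
  | _ => rfl

/-- The program that runs a given program on the second component of its input, and passes every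
answer of the oracle, together with the first component of the input, through the program `T`.  A
loop must carry the first component along; on an input that is not a pair starting with a number,
where a loop does nothing, its translation does nothing either. -/
def Prog.relay (T : Prog) : Prog → Prog
  | .ask => .comp T (.fork .fst (.comp .ask .snd))
  | .fork f g => .fork (Prog.relay T f) (Prog.relay T g)
  | .comp g f => .comp (Prog.relay T g) (.fork .fst (Prog.relay T f))
  | .ite c f g => .ite (Prog.relay T c) (Prog.relay T f) (Prog.relay T g)
  | .loop f => .ite (.comp .isPair .snd)
      (.ite (.comp .isPair (.comp .fst .snd)) .snd
        (.comp .snd (.comp (.loop (.fork .fst (Prog.relay T f)))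
          (.fork (.comp .fst .snd) (.fork .fst (.comp .snd .snd)))))) .snd
  | P => .comp P .snd

theorem output_fst (O : Oracle) (x : Data) : Prog.fst.output O x = PMF.pure x.fst := by
  simp [Prog.output, Prog.run, PMF.pure_map, basic]

theorem output_snd (O : Oracle) (x : Data) : Prog.snd.output O x = PMF.pure x.snd := by
  simp [Prog.output, Prog.run, PMF.pure_map, basic]

theorem output_isPair (O : Oracle) (x : Data) : Prog.isPair.output O x = PMF.pure x.isPair := by
  simp [Prog.output, Prog.run, PMF.pure_map, basic]

theorem output_ask (O : Oracle) (x : Data) : Prog.ask.output O x = O x := by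
  simp only [Prog.output, Prog.run, PMF.map_comp]
  exact PMF.map_id _

/-- Relaying the answers of `O` through `T` simulates the oracle whose answers are those of `O`
processed by `T`. -/
theorem output_relay (T A : Prog) {O O' : Oracle} {c : Data}
    (hO : ∀ d, ((O d).bind fun y => T.output O (.pair c y)) = O' d) (x : Data) :
    (Prog.relay T A).output O (.pair c x) = A.output O' x := by
  induction A generalizing x with
  | ask =>
    rw [Prog.relay, output_comp, output_fork, output_fst, output_comp, output_snd, output_ask,
      PMF.pure_bind, PMF.pure_bind, Data.snd, output_ask, PMF.bind_map, ← hO]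
    rfl
  | fork f g hf hg => rw [Prog.relay, output_fork, output_fork, hf, hg]
  | comp g f hg hf =>
    rw [Prog.relay, output_comp, output_comp, output_fork, output_fst, PMF.pure_bind, hf,
      PMF.bind_map]
    congr 1; funext y; exact hg y
  | ite c f g hc hf hg => rw [Prog.relay, output_ite, output_ite, hc, hf, hg]
  | loop f hf =>
    rw [Prog.relay, output_ite, output_comp, output_snd, PMF.pure_bind, output_isPair,
      PMF.pure_bind]
    match x with
    | .num k => simp [Data.snd, Data.isPair, Data.isZero, Prog.output, Prog.run, basic,
        PMF.pure_map]
    | .pair (.pair a b) s =>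
      simp [Data.snd, Data.fst, Data.isPair, Data.isZero, output_snd, output_ite, output_comp,
        output_fst, output_isPair]
      simp [Prog.output, Prog.run, basic, PMF.pure_map]
    | .pair (.num t) s =>
      simp only [Data.snd, Data.fst, Data.isPair, Data.isZero, output_snd, output_ite,
        output_comp, output_fst, output_isPair, output_fork, PMF.pure_bind, PMF.pure_map,
        output_loop, if_true, if_false, Bool.false_eq_true]
      have : ∀ (t : ℕ) (s : Data), iter ((Prog.fork .fst (Prog.relay T f)).output O) t (.pair c s) =
          (iter (f.output O') t s).map (Data.pair c) := by
        intro t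
        induction t with
        | zero => intro s; simp [iter, PMF.pure_map]
        | succ t ih =>
          intro s
          simp only [iter, output_fork, output_fst, Data.fst, PMF.pure_bind, hf, PMF.bind_map,
            PMF.map_bind, Function.comp_def, ih]
      rw [this, PMF.bind_map]
      have h : Prog.snd.output O ∘ Data.pair c = PMF.pure := funext fun y => output_snd O _
      rw [h, PMF.bind_pure]
  | rand =>
    simp only [Prog.relay, output_comp, output_snd, PMF.pure_bind]
    cases x <;> rfl
  | _ => simp only [Prog.relay, output_comp, output_snd, PMF.pure_bind]; rfl

/-- The cost of the translated loop, if the body obeys the bound of `relay_cost`. Every round of the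
original loop costs at least `1`, so the number `t` of rounds is at most its running time. -/
theorem relay_cost_loop {T f : Prog} {p : Polynomial ℕ} {O O' : Oracle} {c : Data} {M : ℕ}
    (hc : c.size ≤ M)
    (hf : ∀ x, ∀ r' ∈ ((Prog.relay T f).run O (.pair c x)).support,
      ∃ r ∈ (f.run O' x).support, r.1 = r'.1 ∧ r'.2 ≤ p.eval (r.2 + x.size + M))
    (t : ℕ) (s : Data) :
    ∀ r' ∈ (iterCost ((Prog.fork .fst (Prog.relay T f)).run O) t (.pair c s)).support,
      ∃ r ∈ (iterCost (f.run O') t s).support, r'.1 = .pair c r.1 ∧ t ≤ r.2 ∧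
        ∀ K, r.2 + s.size + M ≤ K → r'.2 ≤ t * (p.eval K + 4 * K + 8) + 1 := by
  induction t generalizing s with
  | zero => intro r' hr; simp [iterCost] at hr; subst hr; simp [iterCost]
  | succ t ih =>
    intro r' hr
    simp only [iterCost, Prog.run, PMF.mem_support_bind_iff, PMF.support_map, Set.mem_image,
      PMF.support_pure, Set.mem_singleton_iff] at hr
    obtain ⟨_, ⟨_, rfl, b, hb, rfl⟩, e, he, rfl⟩ := hr
    obtain ⟨u, hu, hub, hcost⟩ := hf s b hb
    simp only [basic, Data.fst] at he
    obtain ⟨r, hr, hre, htr, hK⟩ := ih b.1 e he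
    have hsz := size_le_of_mem_run _ _ _ u hu
    refine ⟨(r.1, u.2 + r.2 + 1), ?_, hre, by simp only; omega, fun K hKK => ?_⟩
    · simp only [iterCost, PMF.mem_support_bind_iff, PMF.support_map, Set.mem_image]
      exact ⟨u, hu, r, by rw [hub]; exact hr, rfl⟩
    · simp only at hKK
      rw [hub] at hsz
      have h1 := hK K (by omega)
      have h2 := hcost.trans (eval_mono p (b := K) (by omega))
      simp only [basic, Data.fst, Data.size]
      rw [Nat.succ_mul]
      omega

/-- Relaying slows a program down only polynomially.  Every run of the translated program is matched
with a run of the original one that has the same result, and compared with its cost. -/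
theorem relay_cost (T A : Prog) : ∃ p : Polynomial ℕ, ∀ (O O' : Oracle) (c : Data) (M : ℕ),
    c.size ≤ M →
    (∀ d, ∀ y ∈ (O d).support, y.size ≤ M ∧ T.RunsWithin O (.pair c y) M) →
    (∀ d, ((O d).bind fun y => T.output O (.pair c y)) = O' d) →
    ∀ x, ∀ r' ∈ ((Prog.relay T A).run O (.pair c x)).support,
      ∃ r ∈ (A.run O' x).support, r.1 = r'.1 ∧ r'.2 ≤ p.eval (r.2 + x.size + M) := by
  induction A with
  | ask =>
    refine ⟨20 * Polynomial.X, fun O O' c M hc hy hO x r' hr => ?_⟩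
    simp only [Prog.relay, Prog.run, PMF.mem_support_bind_iff, PMF.support_map, Set.mem_image,
      PMF.support_pure, Set.mem_singleton_iff] at hr
    obtain ⟨_, ⟨_, rfl, _, ⟨_, rfl, _, ⟨y, hyx, rfl⟩, rfl⟩, rfl⟩, z, hz, rfl⟩ := hr
    simp only [basic, Data.fst, Data.snd] at hyx hz ⊢
    obtain ⟨h1, h2⟩ := hy x y hyx
    have h3 := h2 z hz
    refine ⟨basic x z.1, ?_, rfl, ?_⟩
    · simp only [Prog.run, PMF.support_map, Set.mem_image]
      refine ⟨z.1, ?_, rfl⟩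
      rw [← hO, PMF.mem_support_bind_iff]
      refine ⟨y, hyx, ?_⟩
      rw [Prog.output, PMF.support_map]
      exact ⟨z, hz, rfl⟩
    · have := x.size_pos
      simp only [basic, Data.size, Polynomial.eval_mul, Polynomial.eval_ofNat, Polynomial.eval_X]
      omega
  | fork f g hf hg =>
    obtain ⟨p, hp⟩ := hf
    obtain ⟨q, hq⟩ := hg
    refine ⟨p + q + Polynomial.X, fun O O' c M hc hy hO x r' hr => ?_⟩
    simp only [Prog.relay, Prog.run, PMF.mem_support_bind_iff, PMF.support_map, Set.mem_image]
      at hr ⊢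
    obtain ⟨a, ha, b, hb, rfl⟩ := hr
    obtain ⟨u, hu, hua, hu2⟩ := hp O O' c M hc hy hO x a ha
    obtain ⟨v, hv, hvb, hv2⟩ := hq O O' c M hc hy hO x b hb
    refine ⟨_, ⟨u, hu, v, hv, rfl⟩, by simp only [hua, hvb], ?_⟩
    rw [← hua, ← hvb]
    simp only [Polynomial.eval_add, Polynomial.eval_X]
    have h1 := hu2.trans (eval_mono p (b := u.2 + v.2 + 1 + (Data.pair u.1 v.1).size + x.size + M)
      (by omega))
    have h2 := hv2.trans (eval_mono q (b := u.2 + v.2 + 1 + (Data.pair u.1 v.1).size + x.size + M)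
      (by omega))
    omega
  | comp g f hg hf =>
    obtain ⟨p, hp⟩ := hf
    obtain ⟨q, hq⟩ := hg
    refine ⟨p + q + 10 * Polynomial.X, fun O O' c M hc hy hO x r' hr => ?_⟩
    simp only [Prog.relay, Prog.run, PMF.mem_support_bind_iff, PMF.support_map, Set.mem_image,
      PMF.support_pure, Set.mem_singleton_iff] at hr ⊢
    obtain ⟨_, ⟨_, rfl, a, ha, rfl⟩, b, hb, rfl⟩ := hr
    obtain ⟨u, hu, hua, hu2⟩ := hp O O' c M hc hy hO x a ha
    simp only [basic, Data.fst] at hb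
    obtain ⟨v, hv, hvb, hv2⟩ := hq O O' c M hc hy hO a.1 b hb
    refine ⟨_, ⟨u, hu, v, by rw [hua]; exact hv, rfl⟩, hvb, ?_⟩
    have hsz := size_le_of_mem_run _ _ _ u hu
    rw [hua] at hsz
    have h1 := hu2.trans (eval_mono p (b := u.2 + v.2 + 1 + x.size + M) (by omega))
    have h2 := hv2.trans (eval_mono q (b := u.2 + v.2 + 1 + x.size + M) (by omega))
    simp only [basic, Data.fst, Data.size, Polynomial.eval_add, Polynomial.eval_X,
      Polynomial.eval_mul, Polynomial.eval_ofNat]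
    omega
  | ite t f g ht hf hg =>
    obtain ⟨w, hw⟩ := ht
    obtain ⟨p, hp⟩ := hf
    obtain ⟨q, hq⟩ := hg
    refine ⟨w + p + q + 1, fun O O' c M hc hy hO x r' hr => ?_⟩
    simp only [Prog.relay, Prog.run, PMF.mem_support_bind_iff, PMF.support_map, Set.mem_image]
      at hr ⊢
    obtain ⟨a, ha, b, hb, rfl⟩ := hr
    obtain ⟨u, hu, hua, hu2⟩ := hw O O' c M hc hy hO x a ha
    have : ∃ v ∈ (if u.1.isZero then g.run O' x else f.run O' x).support, v.1 = b.1 ∧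
        b.2 ≤ p.eval (v.2 + x.size + M) + q.eval (v.2 + x.size + M) := by
      rw [hua]
      split at hb
      · obtain ⟨v, hv, hvb, hv2⟩ := hq O O' c M hc hy hO x b hb
        exact ⟨v, by rw [if_pos ‹_›]; exact hv, hvb, by omega⟩
      · obtain ⟨v, hv, hvb, hv2⟩ := hp O O' c M hc hy hO x b hb
        exact ⟨v, by rw [if_neg ‹_›]; exact hv, hvb, by omega⟩
    obtain ⟨v, hv, hvb, hv2⟩ := this
    refine ⟨_, ⟨u, hu, v, hv, rfl⟩, hvb, ?_⟩
    have h1 := hu2.trans (eval_mono w (b := u.2 + v.2 + 1 + x.size + M) (by omega))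
    have h2 := eval_mono p (a := v.2 + x.size + M) (b := u.2 + v.2 + 1 + x.size + M) (by omega)
    have h3 := eval_mono q (a := v.2 + x.size + M) (b := u.2 + v.2 + 1 + x.size + M) (by omega)
    simp only [Polynomial.eval_add, Polynomial.eval_one]
    omega
  | loop f hf =>
    obtain ⟨p, hp⟩ := hf
    refine ⟨Polynomial.X * (p + 4 * Polynomial.X + 8) + 1 + 60 * Polynomial.X,
      fun O O' c M hc hy hO x r' hr => ?_⟩
    have hx := x.size_pos
    match x with
    | .num k =>
      simp [Prog.relay, Prog.run, Data.snd, Data.isPair, Data.isZero, basic] at hr ⊢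
      subst hr
      simp only [Data.size, Nat.size_zero]
      refine ⟨trivial, ?_⟩
      omega
    | .pair (.pair a b) s =>
      simp [Prog.relay, Prog.run, Data.snd, Data.fst, Data.isPair, Data.isZero, basic] at hr ⊢
      subst hr
      simp only [Data.size, Nat.size_one] at hx ⊢
      refine ⟨trivial, ?_⟩
      omega
    | .pair (.num t) s =>
      simp only [Prog.relay, Prog.run, Data.snd, Data.fst, Data.isPair, Data.isZero, basic,
        PMF.pure_bind, PMF.pure_map, if_true, if_false, Bool.false_eq_true,
        PMF.mem_support_bind_iff, PMF.support_map, Set.mem_image, PMF.support_pure,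
        Set.mem_singleton_iff] at hr
      obtain ⟨_, ⟨_, ⟨_, ⟨e, he, rfl⟩, rfl⟩, rfl⟩, rfl⟩ := hr
      have he' : e ∈
          (iterCost ((Prog.fork .fst (Prog.relay T f)).run O) t (.pair c s)).support := by
        simp only [Prog.run, PMF.pure_bind, basic, Data.fst]
        exact he
      obtain ⟨r, hr, hre, htr, hK⟩ := relay_cost_loop hc (hp O O' c M hc hy hO) t s e he'
      refine ⟨r, hr, by rw [hre], ?_⟩
      have h1 := hK (r.2 + (Data.pair (.num t) s).size + M) (by simp only [Data.size]; omega)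
      have h2 := size_le_of_mem_run O' (.loop f) (.pair (.num t) s) r hr
      have h3 : t * (p.eval (r.2 + (Data.pair (.num t) s).size + M) +
          4 * (r.2 + (Data.pair (.num t) s).size + M) + 8) ≤
          (r.2 + (Data.pair (.num t) s).size + M) *
            (p.eval (r.2 + (Data.pair (.num t) s).size + M) +
            4 * (r.2 + (Data.pair (.num t) s).size + M) + 8) := Nat.mul_le_mul_right _ (by omega)
      simp only [hre, Polynomial.eval_add, Polynomial.eval_X, Polynomial.eval_mul,
        Polynomial.eval_ofNat, Polynomial.eval_one]
      refine le_trans ?_ (Nat.add_le_add_right (Nat.add_le_add_right h3 _) _)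
      simp only [Data.size, Nat.size_zero, Nat.size_one] at h1 h2 ⊢
      omega
  | rand =>
    refine ⟨10 * Polynomial.X, fun O O' c M hc hy hO x r' hr => ?_⟩
    simp only [Prog.relay, Prog.run, PMF.pure_bind, PMF.support_map, Set.mem_image] at hr
    obtain ⟨a, ha, rfl⟩ := hr
    refine ⟨a, by cases x <;> exact ha, rfl, ?_⟩
    have := x.size_pos
    simp only [basic, Data.snd, Data.size, Polynomial.eval_mul, Polynomial.eval_ofNat,
      Polynomial.eval_X]
    omega
  | _ =>
    refine ⟨10 * Polynomial.X, fun O O' c M hc hy hO x r' hr => ?_⟩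
    simp only [Prog.relay, Prog.run, PMF.pure_bind, PMF.support_map, Set.mem_image] at hr
    obtain ⟨a, ha, rfl⟩ := hr
    refine ⟨a, ha, rfl, ?_⟩
    have := x.size_pos
    simp only [basic, Data.snd, Data.size, Polynomial.eval_mul, Polynomial.eval_ofNat,
      Polynomial.eval_X]
    omega

end PRCode
end

noncomputable section
namespace PRCode
open Coded
open scoped ENNReal

/-! ### Undetectability and soundness of the indexing construction -/

theorem output_strip (O : Oracle) (P : Prog) (x : Data) :
    P.strip.output O x = P.output noOracle x := by
  rw [Prog.output, run_strip]; rfl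

/-- Each symbol has the same number `ρ` of preimages. -/
theorem bind_liftWord_uniform {ρ n m : ℕ} (hρ : 0 < ρ) (ψ : BalancedMap ρ n)
    [Nonempty (Fin m → Fin n)] [Nonempty (Fin m → Fin (ρ * n))] :
    (PMF.uniformOfFintype (Fin m → Fin n)).bind (liftWord hρ ψ) =
      PMF.uniformOfFintype (Fin m → Fin (ρ * n)) := by
  refine (pmf_eq_of_le fun z => ?_).symm
  refine le_trans ?_ (le_bind_apply _ _ (ψ.1 ∘ z) z)
  rw [liftWord, PMF.uniformOfFinset_apply, if_pos (by simp [Fintype.mem_piFinset]),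
    Fintype.card_piFinset]
  simp only [ψ.2, PMF.uniformOfFintype_apply, Finset.prod_const, Finset.card_univ,
    Fintype.card_fin, Fintype.card_pi]
  push_cast
  rw [mul_pow, mul_comm, ENNReal.mul_inv (Or.inr (by finiteness)) (Or.inl (by finiteness))]

theorem le_bind_apply_of_forall_le {α β : Type*} (p : PMF α) {f : α → PMF β} {b : β} {c : ℝ≥0∞}
    (h : ∀ a, c ≤ f a b) : c ≤ p.bind f b := by
  rw [PMF.bind_apply]
  calc c = ∑' a, p a * c := by rw [ENNReal.tsum_mul_right, p.tsum_coe, one_mul]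
    _ ≤ _ := ENNReal.tsum_le_tsum fun a => mul_le_mul_right (h a) _

namespace Scheme

variable {S : Scheme fun _ => 2}

/-- The second half of the encoder of the indexing construction, applied to the answers of an
oracle for the code `S`. -/
def indexed (S : Scheme fun _ => 2) {ρ : ℕ} (hρ : 0 < ρ) (l : ℕ)
    (ψ : BalancedMap ρ (S.blockLength l))
    (f : (Fin (S.msgLength l) → Fin 2) → PMF (Fin (S.blockLength l) → Fin 2))
    (msg : Fin (S.msgLength l) → Fin 2) :
    PMF (Fin (indexLength (S.blockLength l)) → Fin (ρ * S.blockLength l)) :=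
  (f msg).bind fun y₀ =>
    (perturbDifference (S.blockLength l) (indexLength (S.blockLength l)) y₀).bind fun y =>
      liftWord hρ ψ y

theorem indexed_uniform {ρ : ℕ} (hρ : 0 < ρ) (l : ℕ) (ψ : BalancedMap ρ (S.blockLength l)) :
    S.indexed hρ l ψ (fun _ => S.uniformWord l) = fun _ => (indexing S ρ hρ).uniformWord l := by
  funext msg
  have := S.nonempty_word l
  have : Nonempty (Fin (indexLength (S.blockLength l)) → Fin (ρ * S.blockLength l)) :=
    (indexing S ρ hρ).nonempty_word l
  rw [indexed, ← PMF.bind_bind, uniformWord, bind_perturbDifference_uniform]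
  exact bind_liftWord_uniform hρ ψ

/-- Every adversary against the indexing construction is simulated by an adversary against the
underlying code, which draws the map `ψ` itself. -/
theorem exists_adversary (hS : S.Efficient) {ρ : ℕ} (hρ : 0 < ρ) {A : Prog}
    (hA : (indexing S ρ hρ).IsAdversary A) : ∃ A' : Prog, S.IsAdversary A' ∧ ∀ l f,
      A'.output (S.wordOracle l f) (.num l) =
        (PMF.uniformOfFintype (BalancedMap ρ (S.blockLength l))).bind fun ψ =>
          A.output ((indexing S ρ hρ).wordOracle l (S.indexed hρ l ψ f)) (.num l) := by
  obtain ⟨T, pT, hT⟩ := polyTime_postprocess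
  obtain ⟨C, pC, hC⟩ := PolyTime.prod hS.polyTimeFun_blockLength
    ((polyTime_randomBalanced ρ).compFun hS.polyTimeFun_blockLength)
  obtain ⟨pA, hA⟩ := hA
  obtain ⟨pS, hpS⟩ := hS.lengths_poly
  obtain ⟨q, hq⟩ := relay_cost T.strip A
  have hctx : ∀ l : ℕ, ((PMF.pure (S.blockLength l)).bind fun b =>
      (randomBalanced ρ (S.blockLength l)).map fun c => (b, c)) =
      (PMF.uniformOfFintype (BalancedMap ρ (S.blockLength l))).map fun ψ =>
        (S.blockLength l, wordList ψ.1) := by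
    intro l
    rw [PMF.pure_bind, randomBalanced_eq, PMF.map_comp]; rfl
  simp only [hctx] at hC
  have hO : ∀ l (ψ : BalancedMap ρ (S.blockLength l)) f d,
      ((S.wordOracle l f d).bind fun y => T.strip.output (S.wordOracle l f)
        (.pair (code (S.blockLength l, wordList ψ.1)) y)) =
      (indexing S ρ hρ).wordOracle l (S.indexed hρ l ψ f) d := by
    intro l ψ f d
    have h1 : ∀ y₀ : Fin (S.blockLength l) → Fin 2, T.strip.output (S.wordOracle l f)
        (.pair (code (S.blockLength l, wordList ψ.1)) (codeWord y₀)) =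
        ((perturbDifference (S.blockLength l) (indexLength (S.blockLength l)) y₀).bind fun y =>
          liftWord hρ ψ y).map codeWord := by
      intro y₀
      rw [output_strip, ← code_wordList]
      refine ((hT ((S.blockLength l, wordList ψ.1), wordList y₀)).1).trans ?_
      simp only [postprocess_eq hρ ψ y₀, PMF.map_comp, Function.comp_def, code_wordList]
    simp only [wordOracle, PMF.bind_map, Function.comp_def, h1]
    rw [← PMF.map_bind]
    rfl
  -- `C` computes the block length and draws `ψ`; `T` turns an answer of the binary code into one of
  -- the indexing construction; neither makes queries
  refine ⟨.comp (Prog.relay T.strip A) (.fork C.strip .id), ?_, fun l f => ?_⟩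
  -- `M` bounds the context, the answers of the oracle, and the running time of `T` on both
  · let M : Polynomial ℕ := pC.comp (Polynomial.X + 1) + (4 * pS + 1) +
      pT.comp (pC.comp (Polynomial.X + 1) + (4 * pS + 1) + 1)
    refine ⟨2 * M + 4 * Polynomial.X + 20 + q.comp (pA + Polynomial.X + 1 + M), fun l f r hr => ?_⟩
    simp only [Prog.run, PMF.mem_support_bind_iff, PMF.support_map, Set.mem_image,
      PMF.support_pure, Set.mem_singleton_iff] at hr
    obtain ⟨_, ⟨a, ha, _, rfl, rfl⟩, b, hb, rfl⟩ := hr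
    rw [run_strip] at ha
    obtain ⟨w, hw, hwa⟩ := exists_of_mem_run (hC l).1 ha
    have hwt := (hC l).2.2 w hw
    have ha2 := (hC l).2.1 a ha
    have hw' := hw
    rw [PMF.support_map] at hw'
    obtain ⟨ψ, -, rfl⟩ := hw'
    simp only [basic, ← hwa] at hb ⊢
    rw [wt_nat] at hwt ha2
    beta_reduce at hwt
    have hsz := (size_le (S.blockLength l, wordList ψ.1)).trans hwt
    have hpS' := (hpS l).1
    have hMc : (code (S.blockLength l, wordList ψ.1)).size ≤ M.eval l := by
      simp only [M, Polynomial.eval_add, Polynomial.eval_comp, Polynomial.eval_X,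
        Polynomial.eval_one]
      omega
    have hy : ∀ d, ∀ y ∈ (S.wordOracle l f d).support, y.size ≤ M.eval l ∧
        T.strip.RunsWithin (S.wordOracle l f)
          (.pair (code (S.blockLength l, wordList ψ.1)) y) (M.eval l) := by
      intro d y hy
      simp only [wordOracle, PMF.support_map, Set.mem_image] at hy
      obtain ⟨y₀, -, rfl⟩ := hy
      have h1 := wt_wordList_le y₀
      have h2 := size_le (wordList y₀)
      rw [code_wordList] at h2
      refine ⟨?_, fun v hv => ?_⟩
      · simp only [M, Polynomial.eval_add, Polynomial.eval_comp, Polynomial.eval_X,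
          Polynomial.eval_one, Polynomial.eval_mul, Polynomial.eval_ofNat]
        omega
      · rw [run_strip, ← code_wordList] at hv
        have h3 := (hT ((S.blockLength l, wordList ψ.1), wordList y₀)).2.1 v hv
        have h4 := eval_mono pT (a := wt ((S.blockLength l, wordList ψ.1), wordList y₀))
          (b := pC.eval (l + 1) + (4 * pS.eval l + 1) + 1) (by
            rw [wt_prod]; simp only; omega)
        simp only [M, Polynomial.eval_add, Polynomial.eval_comp, Polynomial.eval_X,
          Polynomial.eval_one, Polynomial.eval_mul, Polynomial.eval_ofNat]
        omega
    obtain ⟨u, hu, -, hcost⟩ := hq _ _ _ (M.eval l) hMc hy (hO l ψ f) _ b hb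
    have h1 := hA l _ u hu
    have h2 := natSize_le l
    have h3 := eval_mono q (a := u.2 + (Data.num l).size + M.eval l)
      (b := pA.eval l + l + 1 + M.eval l) (by simp only [Data.size]; omega)
    have hM2 : pC.eval (l + 1) ≤ M.eval l := by
      simp only [M, Polynomial.eval_add, Polynomial.eval_comp, Polynomial.eval_X,
        Polynomial.eval_one]
      omega
    simp only [Polynomial.eval_add, Polynomial.eval_mul, Polynomial.eval_ofNat,
      Polynomial.eval_comp, Polynomial.eval_X, Polynomial.eval_one]
    simp only [Data.size] at hcost h3 ⊢
    omega
  · have h1 : C.strip.output (S.wordOracle l f) (.num l) =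
        (PMF.uniformOfFintype (BalancedMap ρ (S.blockLength l))).map fun ψ =>
          code (S.blockLength l, wordList ψ.1) := by
      rw [output_strip]
      refine ((hC l).1).trans ?_
      rw [PMF.map_comp]; rfl
    have h2 : Prog.id.output (S.wordOracle l f) (.num l) = PMF.pure (.num l) := by
      simp [Prog.output, Prog.run, PMF.pure_map, basic]
    rw [output_comp, output_fork, h1, h2]
    simp only [PMF.bind_map, PMF.pure_map, PMF.pure_bind, PMF.bind_bind, Function.comp_def]
    congr 1; funext ψ
    exact output_relay _ _ (hO l ψ f) _

theorem Undetectable.indexing (hU : S.Undetectable) (hS : S.Efficient) {ρ : ℕ} (hρ : 0 < ρ) :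
    (indexing S ρ hρ).Undetectable := by
  intro A hA
  obtain ⟨A', hA', hout⟩ := exists_adversary hS hρ hA
  obtain ⟨ν, hν, h⟩ := hU A' hA'
  refine ⟨ν, hν, fun l => ?_⟩
  have h1 : (PRCode.indexing S ρ hρ).probReal A l = S.probReal A' l := by
    simp only [probReal, hout, PRCode.indexing, PMF.bind_bind, PMF.bind_map]
    rfl
  have h2 : (PRCode.indexing S ρ hρ).probIdeal A l = S.probIdeal A' l := by
    simp only [probIdeal, hout, indexed_uniform, PMF.bind_const]
    rfl
  rw [h1, h2]
  exact h l

/-- For each fixed `ψ`, the decoder applies the binary decoder to a fixed word. -/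
theorem Sound.indexing (h : S.Sound) {ρ : ℕ} (hρ : 0 < ρ) : (indexing S ρ hρ).Sound := by
  obtain ⟨ν, hν, h⟩ := h
  refine ⟨ν, hν, fun l z => ?_⟩
  have h1 : ((PRCode.indexing S ρ hρ).key l).bind
      (fun sk => (PRCode.indexing S ρ hρ).dec l sk z) =
      (PMF.uniformOfFintype (BalancedMap ρ (S.blockLength l))).bind fun ψ =>
        (S.key l).bind fun sk => S.dec l sk (List.ofFn (indicatorWord ψ z)) := by
    rw [PMF.bind_comm]
    simp only [PRCode.indexing, PMF.bind_bind, PMF.bind_map, Function.comp_def]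
  rw [h1]
  refine (ENNReal.ofReal_le_iff_le_toReal (PMF.apply_ne_top _ _)).1 ?_
  refine le_bind_apply_of_forall_le _ fun ψ => ?_
  exact (ENNReal.ofReal_le_iff_le_toReal (PMF.apply_ne_top _ _)).2 (h l _)

end Scheme
end PRCode
end

noncomputable section
namespace PRCode
open Coded
open scoped ENNReal

/-! ### Number of values missed by a random balanced map -/

section
variable {ρ n : ℕ}

/-- The number of elements of `[n]` that are not in the image of `T` under `ψ`. -/
def missed (ψ : BalancedMap ρ n) (T : Finset (Fin (ρ * n))) : ℕ := (T.image ψ.1)ᶜ.card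

theorem missed_empty (ψ : BalancedMap ρ n) : missed ψ ∅ = n := by simp [missed]

theorem missed_insert (ψ : BalancedMap ρ n) (T : Finset (Fin (ρ * n))) (a : Fin (ρ * n)) :
    missed ψ (insert a T) + (if ψ.1 a ∈ T.image ψ.1 then 0 else 1) = missed ψ T := by
  rw [missed, missed, Finset.image_insert]
  split
  · rename_i h
    rw [Finset.insert_eq_of_mem h, add_zero]
  · rename_i h
    rw [Finset.compl_insert, Finset.card_erase_add_one (Finset.mem_compl.2 h)]

theorem card_filter_notMem_image (ψ : BalancedMap ρ n) (T : Finset (Fin (ρ * n))) :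
    (Finset.univ.filter fun a => ψ.1 a ∉ T.image ψ.1).card = ρ * missed ψ T := by
  have h := Finset.card_eq_sum_card_fiberwise (f := ψ.1)
    (s := Finset.univ.filter fun a => ψ.1 a ∉ T.image ψ.1) (t := (T.image ψ.1)ᶜ)
    (fun a ha => by simpa using ha)
  rw [h, Finset.sum_congr rfl (g := fun _ => ρ), Finset.sum_const, smul_eq_mul, mul_comm, missed]
  intro j hj
  refine Eq.trans ?_ (ψ.2 j)
  rw [Finset.filter_filter]
  congr 1
  ext a
  simp only [Finset.mem_filter, Finset.mem_univ, true_and, and_iff_right_iff_imp]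
  rintro rfl
  exact Finset.mem_compl.1 hj

/-- Precomposition with a permutation, as a bijection of the set of balanced maps. -/
def BalancedMap.precompEquiv (ρ n : ℕ) (π : Equiv.Perm (Fin (ρ * n))) :
    BalancedMap ρ n ≃ BalancedMap ρ n where
  toFun ψ := ψ.precomp π
  invFun ψ := ψ.precomp π.symm
  left_inv ψ := Subtype.ext (funext fun a => by simp [BalancedMap.precomp])
  right_inv ψ := Subtype.ext (funext fun a => by simp [BalancedMap.precomp])

/-- Given the values of `ψ` on `T`, a further point is mapped to one of the `missed ψ T` missed
values with probability `ρ * missed ψ T / (ρ * n - |T|)`. -/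
theorem sum_ite_notMem_image (F : ℕ → ℝ) {T : Finset (Fin (ρ * n))} {a : Fin (ρ * n)}
    (ha : a ∉ T) :
    ((ρ * n : ℕ) - T.card : ℝ) *
        ∑ ψ : BalancedMap ρ n, (if ψ.1 a ∈ T.image ψ.1 then 0 else F (missed ψ T)) =
      ρ * ∑ ψ : BalancedMap ρ n, F (missed ψ T) * missed ψ T := by
  have hsym : ∀ b ∈ Tᶜ, ∑ ψ : BalancedMap ρ n,
      (if ψ.1 b ∈ T.image ψ.1 then 0 else F (missed ψ T)) =
      ∑ ψ : BalancedMap ρ n, (if ψ.1 a ∈ T.image ψ.1 then 0 else F (missed ψ T)) := by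
    intro b hb
    rw [Finset.mem_compl] at hb
    refine Fintype.sum_equiv (BalancedMap.precompEquiv ρ n (Equiv.swap a b)) _ _ fun ψ => ?_
    have him : T.image (ψ.1 ∘ Equiv.swap a b) = T.image ψ.1 := by
      refine Finset.image_congr fun x hx => ?_
      rw [Function.comp_apply, Equiv.swap_apply_of_ne_of_ne]
      · rintro rfl; exact ha hx
      · rintro rfl; exact hb hx
    simp only [BalancedMap.precompEquiv, Equiv.coe_fn_mk, BalancedMap.precomp, missed, him,
      Function.comp_apply, Equiv.swap_apply_left]
  have h1 : (((ρ * n : ℕ) : ℝ) - T.card) = ((Tᶜ).card : ℝ) := by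
    rw [Finset.card_compl, Fintype.card_fin, Nat.cast_sub]
    simpa using Finset.card_le_univ T
  rw [h1, ← nsmul_eq_mul, ← Finset.sum_const, ← Finset.sum_congr rfl hsym, Finset.sum_comm,
    Finset.mul_sum]
  refine Finset.sum_congr rfl fun ψ _ => ?_
  have h2 : (Tᶜ.filter fun b => ψ.1 b ∉ T.image ψ.1) =
      Finset.univ.filter fun b => ψ.1 b ∉ T.image ψ.1 := by
    ext b
    simp only [Finset.mem_filter, Finset.mem_compl, Finset.mem_univ, true_and,
      and_iff_right_iff_imp]
    exact fun h hb => h (Finset.mem_image_of_mem _ hb)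
  have h3 : ∀ b, (if ψ.1 b ∈ T.image ψ.1 then 0 else F (missed ψ T)) =
      if ψ.1 b ∉ T.image ψ.1 then F (missed ψ T) else 0 := by
    intro b; split <;> simp_all
  simp only [h3]
  rw [← Finset.sum_filter, h2, Finset.sum_const, card_filter_notMem_image, nsmul_eq_mul]
  push_cast; ring

theorem exp_neg_sub_one_le {s : ℝ} (hs : |s| ≤ 1) : Real.exp (-s) - 1 ≤ -s + s ^ 2 := by
  have := Real.abs_exp_sub_one_sub_id_le (x := -s) (by rwa [abs_neg])
  have := (abs_le.1 this).2
  nlinarith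

/-- The moment generating function of the number of missed values.  The rate `r` has to
underestimate the probability of hitting a given missed value if `s ≥ 0`, and to overestimate it
if `s ≤ 0`. -/
theorem sum_exp_missed_le {r : ℝ} (hr0 : 0 ≤ r) (hr : r ≤ 1 / 2) {t : ℕ} (htn : t ≤ ρ * n)
    {s : ℝ} (hs : |s| ≤ 1)
    (hrs : ∀ k < t, s * (r * ((ρ * n : ℕ) - k : ℝ)) ≤ s * ρ)
    (T : Finset (Fin (ρ * n))) (hT : T.card = t) :
    ∑ ψ : BalancedMap ρ n, Real.exp (s * missed ψ T) ≤
      Fintype.card (BalancedMap ρ n) *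
        Real.exp (n * (s * (1 - r) ^ t + s ^ 2 * (r * t))) := by
  induction t generalizing s T with
  | zero =>
    rw [Finset.card_eq_zero] at hT
    simp [hT, missed_empty, mul_comm s]
  | succ t ih =>
    obtain ⟨a, T, ha, rfl, hTt⟩ := Finset.card_eq_succ.1 hT
    have hs' := abs_le.1 hs
    set X := ∑ ψ : BalancedMap ρ n,
      (if ψ.1 a ∈ T.image ψ.1 then 0 else Real.exp (s * missed ψ T)) with hX
    set Y := ∑ ψ : BalancedMap ρ n, Real.exp (s * missed ψ T) * missed ψ T with hY
    have hXY : ((ρ * n : ℕ) - t : ℝ) * X = ρ * Y := by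
      have := sum_ite_notMem_image (fun k => Real.exp (s * k)) ha
      rwa [hTt] at this
    have hY0 : 0 ≤ Y := Finset.sum_nonneg fun ψ _ => by positivity
    have hpos : (0 : ℝ) < (ρ * n : ℕ) - t := by
      have : ((t + 1 : ℕ) : ℝ) ≤ (ρ * n : ℕ) := Nat.cast_le.2 htn
      push_cast at this ⊢
      linarith
    have hstep : (Real.exp (-s) - 1) * X ≤ (Real.exp (-s) - 1) * (r * Y) := by
      have h1 := hrs t (Nat.lt_succ_self t)
      have h2 : (Real.exp (-s) - 1) * (ρ - r * ((ρ * n : ℕ) - t : ℝ)) ≤ 0 := by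
        rcases lt_trichotomy s 0 with h | rfl | h
        · refine mul_nonpos_of_nonneg_of_nonpos ?_ ?_
          · linarith [Real.add_one_le_exp (-s)]
          · nlinarith
        · simp
        · refine mul_nonpos_of_nonpos_of_nonneg ?_ ?_
          · linarith [Real.exp_le_one_iff.2 (show -s ≤ 0 by linarith)]
          · nlinarith
      refine le_of_mul_le_mul_left ?_ hpos
      have h3 := mul_nonpos_of_nonpos_of_nonneg h2 hY0
      have h4 : ((ρ * n : ℕ) - t : ℝ) * ((Real.exp (-s) - 1) * X) -
          ((ρ * n : ℕ) - t : ℝ) * ((Real.exp (-s) - 1) * (r * Y)) =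
          (Real.exp (-s) - 1) * (ρ - r * ((ρ * n : ℕ) - t : ℝ)) * Y := by
        linear_combination (Real.exp (-s) - 1) * hXY
      linarith
    have hsplit : ∑ ψ : BalancedMap ρ n, Real.exp (s * missed ψ (insert a T)) =
        ∑ ψ : BalancedMap ρ n, Real.exp (s * missed ψ T) + (Real.exp (-s) - 1) * X := by
      rw [hX, Finset.mul_sum, ← Finset.sum_add_distrib]
      refine Finset.sum_congr rfl fun ψ _ => ?_
      have h := missed_insert ψ T a
      split at h
      · rename_i hm
        rw [if_pos hm, ← h]; simp
      · rename_i hm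
        rw [if_neg hm, ← h]
        push_cast
        have : s * ((missed ψ (insert a T) : ℝ) + 1) + -s = s * missed ψ (insert a T) := by ring
        rw [sub_mul, ← Real.exp_add, add_comm (-s), this]
        ring
    -- averaging over the new point replaces the exponent `s` by `s * (1 - r + s * r)`, whose
    -- quadratic term accounts for the error
    have hbound : ∑ ψ : BalancedMap ρ n, Real.exp (s * missed ψ (insert a T)) ≤
        ∑ ψ : BalancedMap ρ n, Real.exp (s * (1 - r + s * r) * missed ψ T) := by
      rw [hsplit]
      refine (add_le_add_right hstep _).trans ?_
      rw [hY, Finset.mul_sum, Finset.mul_sum, ← Finset.sum_add_distrib]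
      refine Finset.sum_le_sum fun ψ _ => ?_
      have h1 : s * (1 - r + s * r) * missed ψ T =
          s * missed ψ T + (-s + s ^ 2) * (r * missed ψ T) := by ring
      have h2 := Real.add_one_le_exp ((-s + s ^ 2) * (r * missed ψ T))
      have h3 : (Real.exp (-s) - 1) * (r * missed ψ T) ≤ (-s + s ^ 2) * (r * missed ψ T) :=
        mul_le_mul_of_nonneg_right (exp_neg_sub_one_le hs) (by positivity)
      rw [h1, Real.exp_add]
      have h4 := mul_le_mul_of_nonneg_left (h3.trans (le_sub_iff_add_le.2 h2))
        (Real.exp_pos (s * missed ψ T)).le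
      linarith
    have hc0 : 0 ≤ 1 - r + s * r := by nlinarith
    have hc1 : 1 - r + s * r ≤ 1 := by nlinarith
    have hsc : |s * (1 - r + s * r)| ≤ |s| := by
      rw [abs_mul, abs_of_nonneg hc0]
      exact mul_le_of_le_one_right (abs_nonneg s) hc1
    refine hbound.trans ((ih (by omega) (hsc.trans hs) (fun k hk => ?_) T hTt).trans ?_)
    · have := mul_le_mul_of_nonneg_right (hrs k (by omega)) hc0
      linarith
    · refine mul_le_mul_of_nonneg_left (Real.exp_le_exp.2 ?_) (Nat.cast_nonneg _)
      refine mul_le_mul_of_nonneg_left ?_ (Nat.cast_nonneg _)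
      have h1 : (s * (1 - r + s * r)) ^ 2 ≤ s ^ 2 := sq_le_sq.2 hsc
      have h2 : (1 - r) ^ t ≤ 1 := pow_le_one₀ (by linarith) (by linarith)
      have h3 := mul_le_mul_of_nonneg_right h1 (show 0 ≤ r * t by positivity)
      have h4 := mul_le_mul_of_nonneg_left h2 (show 0 ≤ s ^ 2 * r by positivity)
      rw [pow_succ (1 - r) t]
      push_cast
      nlinarith

open Classical in
/-- The exponential Markov inequality. -/
theorem card_filter_mul_exp_le {α : Type*} [Fintype α] (X : α → ℝ) (s c : ℝ) :
    ((Finset.univ.filter fun a => c ≤ s * X a).card : ℝ) * Real.exp c ≤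
      ∑ a, Real.exp (s * X a) := by
  rw [← nsmul_eq_mul, ← Finset.sum_const]
  refine (Finset.sum_le_sum fun a ha => Real.exp_le_exp.2 (Finset.mem_filter.1 ha).2).trans ?_
  exact Finset.sum_le_sum_of_subset_of_nonneg (Finset.filter_subset _ _)
    fun a _ _ => (Real.exp_pos _).le

theorem exp_neg_le_one_sub {r : ℝ} (h0 : 0 ≤ r) (h : r ≤ 1 / 3) :
    Real.exp (-(r + r ^ 2)) ≤ 1 - r := by
  have h1 := Real.quadratic_le_exp_of_nonneg (x := r + r ^ 2) (by positivity)
  rw [Real.exp_neg, inv_le_comm₀ (Real.exp_pos _) (by linarith)]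
  refine le_trans ?_ h1
  rw [inv_le_iff_one_le_mul₀ (by linarith)]
  nlinarith [mul_nonneg (sq_nonneg r) (show 0 ≤ 1 / 3 - r by linarith),
    mul_nonneg (mul_nonneg (sq_nonneg r) h0) (show 0 ≤ 1 / 3 - r by linarith),
    mul_nonneg (mul_nonneg (sq_nonneg r) (sq_nonneg r)) (show 0 ≤ 1 / 3 - r by linarith)]

variable {p : ℝ} {T : Finset (Fin (ρ * n))}

open Classical in
/-- The upper tail of the number of missed values. -/
theorem card_missed_ge_le (hp0 : 0 < p) (hp : p ≤ 1) (hn : 16 ≤ n * p) (hT : T.card ≤ 2 * n) :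
    ((Finset.univ.filter fun ψ : BalancedMap ρ n =>
      n * Real.exp (-(T.card / n)) + 2 * p * n ≤ missed ψ T).card : ℝ) ≤
      Fintype.card (BalancedMap ρ n) * Real.exp (-(p ^ 2 / 16 * n)) := by
  have hn16 : (16 : ℝ) ≤ n := by nlinarith [(Nat.cast_nonneg n : (0 : ℝ) ≤ n)]
  have hn0 : (0 : ℝ) < n := by linarith
  have hT' : (T.card : ℝ) ≤ 2 * n := by exact_mod_cast hT
  -- a missed value has all of its `ρ` preimages among the at most `ρ * n` remaining points,
  -- and is hit with probability at least `1 / n`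
  have h1 := sum_exp_missed_le (ρ := ρ) (n := n) (r := 1 / n) (by positivity)
    (by rw [div_le_div_iff₀ hn0 two_pos]; linarith) (by simpa using Finset.card_le_univ T)
    (s := p / 2) (by rw [abs_of_pos (by positivity)]; linarith) (fun k _ => by
      refine mul_le_mul_of_nonneg_left ?_ (by positivity)
      rw [one_div, inv_mul_le_iff₀ hn0]
      push_cast
      linarith [(Nat.cast_nonneg k : (0 : ℝ) ≤ k)]) T rfl
  have h2 := card_filter_mul_exp_le (fun ψ : BalancedMap ρ n => (missed ψ T : ℝ)) (p / 2)
    (p / 2 * (n * Real.exp (-(T.card / n)) + 2 * p * n))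
  simp only [mul_le_mul_iff_right₀ (half_pos hp0)] at h2
  have h3 : (1 - 1 / n : ℝ) ^ T.card ≤ Real.exp (-(T.card / n)) := by
    have := pow_le_pow_left₀ (by rw [sub_nonneg, div_le_one hn0]; linarith)
      (Real.one_sub_le_exp_neg (1 / n : ℝ)) T.card
    rw [← Real.exp_nat_mul] at this
    have he : (T.card : ℝ) * -(1 / n) = -(T.card / n) := by ring
    rwa [he] at this
  rw [← mul_le_mul_iff_left₀ (Real.exp_pos (p / 2 * (n * Real.exp (-(T.card / n)) + 2 * p * n)))]
  refine (h2.trans h1).trans ?_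
  rw [mul_assoc, ← Real.exp_add]
  refine mul_le_mul_of_nonneg_left (Real.exp_le_exp.2 ?_) (Nat.cast_nonneg _)
  have h4 : 1 / (n : ℝ) * T.card ≤ 2 := by rw [one_div, inv_mul_le_iff₀ hn0]; linarith
  have h5 : n * (p / 2 * (1 - 1 / n : ℝ) ^ T.card + (p / 2) ^ 2 * (1 / n * T.card)) ≤
      n * (p / 2 * Real.exp (-(T.card / n)) + (p / 2) ^ 2 * 2) := by gcongr
  refine h5.trans ?_
  nlinarith [mul_nonneg (sq_nonneg p) hn0.le]

open Classical in
/-- The lower tail of the number of missed values. -/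
theorem card_missed_le_le (hp0 : 0 < p) (hp : p ≤ 1) (hn : 16 ≤ n * p) (hρ : 100 ≤ ρ * p)
    (hT : T.card ≤ 2 * n) :
    ((Finset.univ.filter fun ψ : BalancedMap ρ n =>
      missed ψ T + 2 * p * n ≤ n * Real.exp (-(T.card / n))).card : ℝ) ≤
      Fintype.card (BalancedMap ρ n) * Real.exp (-(p ^ 2 / 16 * n)) := by
  have hn16 : (16 : ℝ) ≤ n := by nlinarith [(Nat.cast_nonneg n : (0 : ℝ) ≤ n)]
  have hρ100 : (100 : ℝ) ≤ ρ := by nlinarith [(Nat.cast_nonneg ρ : (0 : ℝ) ≤ ρ)]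
  have hn0 : (0 : ℝ) < n := by linarith
  have hρ0 : (0 : ℝ) < ρ - 2 := by linarith
  have hT' : (T.card : ℝ) ≤ 2 * n := by exact_mod_cast hT
  -- at least `(ρ - 2) * n` points remain at every step; the loss against `1 / n` is a factor
  -- `1 + O(p)`, because `ρ ≥ 100 / p`
  set r : ℝ := ρ / ((ρ - 2) * n) with hr
  have hr0 : 0 ≤ r := by positivity
  have hrn : r * n = ρ / (ρ - 2) := by rw [hr]; field_simp
  have hrn2 : r * n ≤ 1 + p / 4 := by
    rw [hrn, div_le_iff₀ hρ0]; nlinarith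
  have hr8 : r ≤ p / 8 := by
    have : r * n ≤ p / 8 * n := by linarith
    exact le_of_mul_le_mul_right this hn0
  have h1 := sum_exp_missed_le (ρ := ρ) (n := n) (r := r) hr0 (by linarith)
    (by simpa using Finset.card_le_univ T)
    (s := -(p / 8)) (by rw [abs_neg, abs_of_pos (by positivity)]; linarith) (fun k hk => by
      have hk' : (k : ℝ) ≤ 2 * n := (Nat.cast_le.2 hk.le).trans hT'
      have : (ρ : ℝ) ≤ r * ((ρ * n : ℕ) - k : ℝ) := by
        calc (ρ : ℝ) = r * ((ρ - 2) * n) := by rw [hr]; field_simp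
          _ ≤ _ := by
            refine mul_le_mul_of_nonneg_left ?_ hr0
            push_cast; linarith
      nlinarith) T rfl
  have h2 := card_filter_mul_exp_le (fun ψ : BalancedMap ρ n => (missed ψ T : ℝ)) (-(p / 8))
    (-(p / 8) * (n * Real.exp (-(T.card / n)) - 2 * p * n))
  have hiff : ∀ ψ : BalancedMap ρ n,
      (-(p / 8) * (n * Real.exp (-(T.card / n)) - 2 * p * n) ≤ -(p / 8) * missed ψ T) ↔
      (missed ψ T + 2 * p * n ≤ n * Real.exp (-(T.card / n))) := by
    intro ψ
    rw [mul_le_mul_left_of_neg (by linarith : -(p / 8) < 0), le_sub_iff_add_le]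
  simp only [hiff] at h2
  have h3 : Real.exp (-(T.card / n)) - p ≤ (1 - r) ^ T.card := by
    have h31 := pow_le_pow_left₀ (Real.exp_pos _).le (exp_neg_le_one_sub hr0 (by linarith)) T.card
    rw [← Real.exp_nat_mul] at h31
    refine le_trans ?_ h31
    have hx : (T.card : ℝ) * r ≤ T.card / n + p / 2 := by
      rw [div_add' _ _ _ hn0.ne', le_div_iff₀ hn0]
      nlinarith
    have hx2 : (T.card : ℝ) * r ^ 2 ≤ p / 2 := by
      have : (T.card : ℝ) * r ≤ 4 := by nlinarith
      nlinarith
    have hle : -((T.card : ℝ) / n) + -p ≤ T.card * -(r + r ^ 2) := by linarith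
    refine le_trans ?_ (Real.exp_le_exp.2 hle)
    rw [Real.exp_add]
    have h32 : Real.exp (-((T.card : ℝ) / n)) ≤ 1 := Real.exp_le_one_iff.2 (by
      rw [neg_nonpos]; positivity)
    have h33 := Real.one_sub_le_exp_neg p
    nlinarith [Real.exp_pos (-((T.card : ℝ) / n))]
  rw [← mul_le_mul_iff_left₀
    (Real.exp_pos (-(p / 8) * (n * Real.exp (-(T.card / n)) - 2 * p * n)))]
  refine (h2.trans h1).trans ?_
  rw [mul_assoc, ← Real.exp_add]
  refine mul_le_mul_of_nonneg_left (Real.exp_le_exp.2 ?_) (Nat.cast_nonneg _)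
  have h4 : n * (-(p / 8) * (1 - r) ^ T.card) ≤
      n * (-(p / 8) * (Real.exp (-(T.card / n)) - p)) := by
    refine mul_le_mul_of_nonneg_left ?_ hn0.le
    exact mul_le_mul_of_nonpos_left h3 (by linarith)
  have h5 : (-(p / 8)) ^ 2 * (r * T.card) ≤ (p / 8) ^ 2 * 4 := by
    rw [neg_sq]
    refine mul_le_mul_of_nonneg_left ?_ (sq_nonneg _)
    nlinarith
  have h6 := mul_le_mul_of_nonneg_left h5 hn0.le
  nlinarith

open Classical in
/-- The number of values that a random balanced map misses on a fixed set of size `t` is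
concentrated around `n * exp (-t / n)`. -/
theorem card_abs_missed_sub_gt_le (hp0 : 0 < p) (hp : p ≤ 1) (hn : 16 ≤ n * p) (hρ : 100 ≤ ρ * p)
    (hT : T.card ≤ 2 * n) :
    ((Finset.univ.filter fun ψ : BalancedMap ρ n =>
      2 * p * n < |(missed ψ T : ℝ) - n * Real.exp (-(T.card / n))|).card : ℝ) ≤
      2 * Fintype.card (BalancedMap ρ n) * Real.exp (-(p ^ 2 / 16 * n)) := by
  have h1 := card_missed_ge_le (ρ := ρ) (T := T) hp0 hp hn hT
  have h2 := card_missed_le_le (ρ := ρ) (T := T) hp0 hp hn hρ hT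
  have h3 : (Finset.univ.filter fun ψ : BalancedMap ρ n =>
      2 * p * n < |(missed ψ T : ℝ) - n * Real.exp (-(T.card / n))|) ⊆
      (Finset.univ.filter fun ψ : BalancedMap ρ n =>
        n * Real.exp (-(T.card / n)) + 2 * p * n ≤ missed ψ T) ∪
      (Finset.univ.filter fun ψ : BalancedMap ρ n =>
        missed ψ T + 2 * p * n ≤ n * Real.exp (-(T.card / n))) := by
    intro ψ hψ
    simp only [Finset.mem_filter, Finset.mem_univ, true_and, Finset.mem_union] at hψ ⊢
    rcases lt_abs.1 hψ with h | h
    · left; linarith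
    · right; linarith
  have h4 := (Finset.card_le_card h3).trans (Finset.card_union_le _ _)
  have h5 := (Nat.cast_le (α := ℝ)).2 h4
  push_cast at h5
  linarith

end
end PRCode
end

noncomputable section
namespace PRCode
open Coded
open scoped ENNReal

/-! ### Repeated symbols of a random word -/

theorem unique_cons {m N : ℕ} (a : Fin N) (z : Fin m → Fin N) :
    unique (Fin.cons a z : Fin (m + 1) → Fin N) = insert a (unique z) := by
  ext x
  simp [unique, Fin.exists_fin_succ, eq_comm]

theorem card_unique_le {m N : ℕ} (z : Fin m → Fin N) : (unique z).card ≤ m :=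
  Finset.card_image_le.trans (by simp)

/-- The moment generating function, at `log 2`, of the number of letters that repeat an earlier one.
-/
theorem sum_two_pow_repeats_le (N m : ℕ) :
    ∑ z : Fin m → Fin N, 2 ^ (m - (unique z).card) ≤ (N + m) ^ m := by
  induction m with
  | zero => simp
  | succ m ih =>
    rw [← (Fin.consEquiv fun _ : Fin (m + 1) => Fin N).sum_comp, Fintype.sum_prod_type,
      Finset.sum_comm]
    have h : ∀ z : Fin m → Fin N,
        ∑ a : Fin N, 2 ^ (m + 1 - (unique (Fin.consEquiv (fun _ => Fin N) (a, z))).card) ≤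
          2 ^ (m - (unique z).card) * (N + m) := by
      intro z
      have hz := card_unique_le z
      have h1 : ∀ a : Fin N,
          2 ^ (m + 1 - (unique (Fin.consEquiv (fun _ : Fin (m + 1) => Fin N) (a, z))).card) =
          2 ^ (m - (unique z).card) * (1 + if a ∈ unique z then 1 else 0) := by
        intro a
        have : unique (Fin.consEquiv (fun _ : Fin (m + 1) => Fin N) (a, z)) =
          insert a (unique z) := unique_cons a z
        rw [this]
        split
        · rename_i ha
          rw [Finset.insert_eq_of_mem ha, Nat.sub_add_comm hz, pow_succ]
        · rename_i ha
          rw [Finset.card_insert_of_notMem ha, Nat.add_sub_add_right, add_zero, mul_one]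
      simp only [h1]
      rw [← Finset.mul_sum, Finset.sum_add_distrib]
      refine Nat.mul_le_mul_left _ ?_
      simpa using hz
    refine (Finset.sum_le_sum fun z _ => h z).trans ?_
    rw [← Finset.sum_mul, pow_succ]
    refine Nat.mul_le_mul (ih.trans (Nat.pow_le_pow_left (by omega) _)) (by omega)

open Classical in
/-- A random word over a large alphabet repeats few symbols. -/
theorem card_repeats_le {ρ n m : ℕ} {p : ℝ} (hm : m ≤ n) (hp0 : 0 < p) (hn : 0 < n)
    (hρ : 100 ≤ ρ * p) :
    ((Finset.univ.filter fun z : Fin m → Fin (ρ * n) =>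
      p * n ≤ m - (unique z).card).card : ℝ) ≤
      Fintype.card (Fin m → Fin (ρ * n)) * Real.exp (-(p / 2 * n)) := by
  have hn0 : (0 : ℝ) < n := by exact_mod_cast hn
  have hρ0 : (0 : ℝ) < ρ := by
    by_contra h
    have : (ρ : ℝ) = 0 := le_antisymm (not_lt.1 h) (Nat.cast_nonneg _)
    rw [this] at hρ; linarith
  have h1 := card_filter_mul_exp_le
    (fun z : Fin m → Fin (ρ * n) => (m : ℝ) - (unique z).card) (Real.log 2) (Real.log 2 * (p * n))
  simp only [mul_le_mul_iff_right₀ (Real.log_pos one_lt_two)] at h1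
  have h2 : ∑ z : Fin m → Fin (ρ * n), Real.exp (Real.log 2 * ((m : ℝ) - (unique z).card)) ≤
      (ρ * n + m) ^ m := by
    have := sum_two_pow_repeats_le (ρ * n) m
    have h3 := (Nat.cast_le (α := ℝ)).2 this
    push_cast at h3
    refine le_trans (le_of_eq (Finset.sum_congr rfl fun z _ => ?_)) h3
    rw [← Nat.cast_sub (card_unique_le z), mul_comm, Real.exp_nat_mul, Real.exp_log two_pos]
  have hN : (0 : ℝ) < ρ * n := by positivity
  have h3 : ((ρ : ℝ) * n + m) ^ m ≤ (ρ * n) ^ m * Real.exp (n / ρ) := by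
    have : (ρ : ℝ) * n + m ≤ ρ * n * Real.exp (1 / ρ) := by
      have h4 := Real.add_one_le_exp (1 / ρ : ℝ)
      have hm' : (m : ℝ) ≤ n := by exact_mod_cast hm
      calc (ρ : ℝ) * n + m ≤ ρ * n + n := by linarith
        _ = ρ * n * (1 / ρ + 1) := by field_simp; ring
        _ ≤ _ := mul_le_mul_of_nonneg_left h4 hN.le
    refine (pow_le_pow_left₀ (by positivity) this m).trans ?_
    rw [mul_pow, ← Real.exp_nat_mul]
    refine mul_le_mul_of_nonneg_left (Real.exp_le_exp.2 ?_) (by positivity)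
    rw [mul_one_div]
    gcongr
  rw [← mul_le_mul_iff_left₀ (Real.exp_pos (Real.log 2 * (p * n)))]
  refine (h1.trans (h2.trans h3)).trans ?_
  rw [mul_assoc, ← Real.exp_add]
  have hc : ((Fintype.card (Fin m → Fin (ρ * n)) : ℕ) : ℝ) = (ρ * n) ^ m := by
    rw [Fintype.card_pi]; simp
  rw [hc]
  refine mul_le_mul_of_nonneg_left (Real.exp_le_exp.2 ?_) (by positivity)
  have h5 : (n : ℝ) / ρ ≤ p * n / 100 := by
    rw [div_le_div_iff₀ hρ0 (by norm_num)]; nlinarith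
  have h6 := Real.log_two_gt_d9
  have h7 : (0.69 : ℝ) * (p * n) ≤ Real.log 2 * (p * n) :=
    mul_le_mul_of_nonneg_right (by linarith) (by positivity)
  nlinarith [mul_pos hp0 hn0]

/-! ### Edits and the sets of symbols -/

/-- An edit makes at most one symbol appear and at most one disappear. -/
theorem EditStep.card_sdiff_le {α : Type} [DecidableEq α] {x y : List α} (h : EditStep x y) :
    (y.toFinset \ x.toFinset).card ≤ 1 ∧ (x.toFinset \ y.toFinset).card ≤ 1 := by
  have key : ∀ (b : α) (s t : Finset α), (∀ c ∈ s, c ∉ t → c = b) → (s \ t).card ≤ 1 := by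
    intro b s t hst
    refine Finset.card_le_one.2 fun c hc d hd => ?_
    rw [Finset.mem_sdiff] at hc hd
    rw [hst c hc.1 hc.2, hst d hd.1 hd.2]
  cases h with
  | subst u v a b => exact ⟨key b _ _ (by simp; tauto), key a _ _ (by simp; tauto)⟩
  | insert u v b => exact ⟨key b _ _ (by simp; tauto), key b _ _ (by simp; tauto)⟩
  | delete u v a => exact ⟨key a _ _ (by simp; tauto), key a _ _ (by simp; tauto)⟩

theorem card_sdiff_triangle {α : Type} [DecidableEq α] (s t u : Finset α) :
    (s \ u).card ≤ (s \ t).card + (t \ u).card := by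
  refine (Finset.card_le_card fun a ha => ?_).trans (Finset.card_union_le _ _)
  simp only [Finset.mem_sdiff, Finset.mem_union] at ha ⊢
  tauto

theorem Edits.card_sdiff_le {α : Type} [DecidableEq α] {k : ℕ} {x y : List α} (h : Edits k x y) :
    (y.toFinset \ x.toFinset).card ≤ k ∧ (x.toFinset \ y.toFinset).card ≤ k := by
  induction h with
  | refl => simp
  | step _ hs ih =>
    have := hs.card_sdiff_le
    exact ⟨(card_sdiff_triangle _ _ _).trans
      ((Nat.add_le_add this.1 ih.1).trans (Nat.add_comm _ _).le), (card_sdiff_triangle _ _ _).trans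
      (Nat.add_le_add ih.2 this.2)⟩

/-! ### Hamming distance and sets of ones -/

theorem hammingDist_eq_card {n : ℕ} (x y : Fin n → Fin 2) :
    hammingDist x y = (symmDiff (ones x) (ones y)).card := by
  unfold hammingDist
  congr 1
  ext i
  simp only [Finset.mem_filter, Finset.mem_univ, true_and, Finset.mem_symmDiff, ones]
  have h1 := Fin.exists_fin_two.1 ⟨x i, rfl⟩
  have h2 := Fin.exists_fin_two.1 ⟨y i, rfl⟩
  rcases h1 with h1 | h1 <;> rcases h2 with h2 | h2 <;> simp [h1, h2]

theorem card_symmDiff_triangle {α : Type} [DecidableEq α] (s t u : Finset α) :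
    (symmDiff s u).card ≤ (symmDiff s t).card + (symmDiff t u).card :=
  (Finset.card_le_card (symmDiff_triangle s t u)).trans (Finset.card_union_le _ _)

theorem ones_indicatorWord {ρ n : ℕ} (ψ : BalancedMap ρ n) (w : List (Fin (ρ * n))) :
    ones (indicatorWord ψ w) = w.toFinset.image ψ.1 := by
  ext i
  simp [ones, indicatorWord]

/-- The images differ in those values that one of the two sets misses but their union does not. -/
theorem card_symmDiff_image {ρ n : ℕ} (ψ : BalancedMap ρ n) (Z W : Finset (Fin (ρ * n))) :
    (symmDiff (Z.image ψ.1) (W.image ψ.1)).card + 2 * missed ψ (Z ∪ W) =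
      missed ψ Z + missed ψ W := by
  have h1 := Finset.card_add_card_compl (Z.image ψ.1)
  have h2 := Finset.card_add_card_compl (W.image ψ.1)
  have h3 := Finset.card_add_card_compl ((Z ∪ W).image ψ.1)
  rw [Finset.image_union] at h3
  have h4 := Finset.card_union_add_card_inter (Z.image ψ.1) (W.image ψ.1)
  have h5 : (symmDiff (Z.image ψ.1) (W.image ψ.1)).card + (Z.image ψ.1 ∩ W.image ψ.1).card =
      (Z.image ψ.1 ∪ W.image ψ.1).card := by
    rw [symmDiff_eq_sup_sdiff_inf]
    exact Finset.card_sdiff_add_card_eq_card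
      (Finset.inter_subset_left.trans Finset.subset_union_left)
  unfold missed
  rw [Finset.image_union]
  omega

/-! ### Decoding radius -/

/-- Estimates for `a` within `p * n` of `m ≈ n log 2`, where `exp (-a / n) ≈ 1 / 2`, and for a
number `k` of edits, which stays below `m` by enough to leave a margin of order `p`. -/
theorem exp_bounds {n m : ℕ} {p a k : ℝ} (hm : m = indexLength n) (hp0 : 0 < p) (hp : p < 1 / 2000)
    (hn : 16 ≤ n * p) (ha : m - p * n ≤ a) (ham : a ≤ m) (hk : k ≤ (1 - 200 * p) * m) :
    Real.exp (-(a / n)) ≤ 1 / 2 + p ∧ 1 / 2 - p ≤ Real.exp (-(a / n)) ∧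
      Real.exp (k / n) ≤ 2 ∧ 1 / 2 + 65 * p ≤ Real.exp (-(k / n)) := by
  have hn0 : (0 : ℝ) < n := by
    by_contra h
    have : (n : ℝ) = 0 := le_antisymm (not_lt.1 h) (Nat.cast_nonneg _)
    rw [this] at hn; linarith
  have hL := Real.log_two_gt_d9
  have hL' := Real.log_two_lt_d9
  have hm1 : Real.log 2 * n ≤ m := by rw [hm]; exact Nat.le_ceil _
  have hm2 : (m : ℝ) < Real.log 2 * n + 1 := by
    rw [hm]; exact Nat.ceil_lt_add_one (by positivity)
  have hexp : Real.exp (-Real.log 2) = 1 / 2 := by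
    rw [Real.exp_neg, Real.exp_log two_pos, one_div]
  refine ⟨?_, ?_, ?_, ?_⟩
  · have h1 : -(a / n) ≤ -Real.log 2 + p := by
      rw [← neg_div, div_le_iff₀ hn0]; nlinarith
    refine (Real.exp_le_exp.2 h1).trans ?_
    rw [Real.exp_add, hexp]
    have h2 : Real.exp p ≤ 1 + 2 * p := by
      have := Real.abs_exp_sub_one_sub_id_le (x := p) (by rw [abs_of_pos hp0]; linarith)
      have := (abs_le.1 this).2
      nlinarith
    linarith
  · have h1 : -Real.log 2 + -p ≤ -(a / n) := by
      rw [← neg_div, le_div_iff₀ hn0]; nlinarith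
    refine le_trans ?_ (Real.exp_le_exp.2 h1)
    rw [Real.exp_add, hexp]
    have := Real.one_sub_le_exp_neg p
    linarith
  · have h1 : k / n ≤ Real.log 2 := by
      rw [div_le_iff₀ hn0]; nlinarith
    exact (Real.exp_le_exp.2 h1).trans (Real.exp_log two_pos).le
  · have h1 : -Real.log 2 + 130 * p ≤ -(k / n) := by
      rw [← neg_div, le_div_iff₀ hn0]; nlinarith
    refine le_trans ?_ (Real.exp_le_exp.2 h1)
    rw [Real.exp_add, hexp]
    have := Real.add_one_le_exp (130 * p)
    linarith

/-- If the numbers of missed values of the sets of sent and of received symbols, and of their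
union, are close to their expectations, then the sets of their images differ in fewer than half
of the positions. -/
theorem card_symmDiff_image_le {ρ n m : ℕ} {p : ℝ} (hm : m = indexLength n) (hp0 : 0 < p)
    (hp : p < 1 / 2000) (hn : 16 ≤ n * p) (ψ : BalancedMap ρ n) {Z W : Finset (Fin (ρ * n))}
    {k : ℕ} (hZ : m - p * n ≤ Z.card) (hZm : Z.card ≤ m) (hk : k ≤ (1 - 200 * p) * m)
    (hWZ : (W \ Z).card ≤ k) (hZW : (Z \ W).card ≤ k)
    (hψ : ∀ T ∈ ({Z, W, Z ∪ W} : Finset (Finset (Fin (ρ * n)))),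
      |(missed ψ T : ℝ) - n * Real.exp (-(T.card / n))| ≤ 2 * p * n) :
    |((Z.image ψ.1).card : ℝ) - n / 2| ≤ 3 * p * n ∧
      ((symmDiff (Z.image ψ.1) (W.image ψ.1)).card : ℝ) ≤ n / 2 - 56 * p * n := by
  have hn0 : (0 : ℝ) < n := by
    by_contra h
    have : (n : ℝ) = 0 := le_antisymm (not_lt.1 h) (Nat.cast_nonneg _)
    rw [this] at hn; linarith
  obtain ⟨e1, e2, e3, e4⟩ := exp_bounds (a := Z.card) (k := k) hm hp0 hp hn hZ
    (by exact_mod_cast hZm) hk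
  have hMZ := abs_le.1 (hψ Z (by simp))
  have hMW := abs_le.1 (hψ W (by simp))
  have hMU := abs_le.1 (hψ (Z ∪ W) (by simp))
  have f1 : (n : ℝ) * Real.exp (-(Z.card / n)) ≤ n * (1 / 2 + p) :=
    mul_le_mul_of_nonneg_left e1 hn0.le
  have f2 : (n : ℝ) * (1 / 2 - p) ≤ n * Real.exp (-(Z.card / n)) :=
    mul_le_mul_of_nonneg_left e2 hn0.le
  constructor
  · have h1 := Finset.card_add_card_compl (Z.image ψ.1)
    rw [Fintype.card_fin] at h1
    have h2 : ((Z.image ψ.1).card : ℝ) + missed ψ Z = n := by exact_mod_cast h1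
    rw [abs_le]
    constructor <;> nlinarith
  · have h1 : ((symmDiff (Z.image ψ.1) (W.image ψ.1)).card : ℝ) + 2 * missed ψ (Z ∪ W) =
        missed ψ Z + missed ψ W := by exact_mod_cast card_symmDiff_image ψ Z W
    have hu1 : (Z ∪ W).card ≤ Z.card + k := by
      have : (Z ∪ W).card = Z.card + (W \ Z).card := by
        rw [← Finset.union_sdiff_self_eq_union, Finset.card_union_of_disjoint Finset.disjoint_sdiff]
      omega
    have hu2 : (Z ∪ W).card ≤ W.card + k := by
      have : (W ∪ Z).card = W.card + (Z \ W).card := by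
        rw [← Finset.union_sdiff_self_eq_union, Finset.card_union_of_disjoint Finset.disjoint_sdiff]
      rw [Finset.union_comm]
      omega
    have hu1' : ((Z ∪ W).card : ℝ) ≤ Z.card + k := by exact_mod_cast hu1
    have hu2' : ((Z ∪ W).card : ℝ) ≤ W.card + k := by exact_mod_cast hu2
    set EU := Real.exp (-((Z ∪ W).card / n : ℝ)) with hEU
    set EZ := Real.exp (-(Z.card / n : ℝ)) with hEZ
    have g1 : Real.exp (-(W.card / n : ℝ)) ≤ EU * Real.exp (k / n) := by
      rw [hEU, ← Real.exp_add, Real.exp_le_exp, ← neg_div, ← neg_div, ← add_div]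
      gcongr
      linarith
    have g2 : EZ * Real.exp (-(k / n)) ≤ EU := by
      rw [hEZ, hEU, ← Real.exp_add, Real.exp_le_exp, ← neg_div, ← neg_div, ← neg_div, ← add_div]
      gcongr
      linarith
    have hprod : Real.exp (k / n) * Real.exp (-(k / n)) = 1 := by
      rw [← Real.exp_add, add_neg_cancel, Real.exp_zero]
    -- by `card_symmDiff_image`, the left side is the expected fraction of differing positions; as
    -- `exp (-|W| / n) ≤ EU * exp (k / n)`, it is at most `EU * (exp (k / n) - 2) + EZ`, which
    -- decreases in `EU` and is largest at `EU = EZ * exp (-k / n)`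
    have g3 : EZ + Real.exp (-(W.card / n : ℝ)) - 2 * EU ≤ 2 * EZ * (1 - Real.exp (-(k / n))) := by
      nlinarith [mul_le_mul_of_nonneg_left g2 (sub_nonneg.2 e3)]
    have hEZ0 : 0 < EZ := Real.exp_pos _
    have g4 : 2 * EZ * (1 - Real.exp (-(k / n))) ≤ 2 * (1 / 2 + p) * (1 / 2 - 65 * p) := by
      calc 2 * EZ * (1 - Real.exp (-(k / n))) ≤ 2 * EZ * (1 / 2 - 65 * p) :=
            mul_le_mul_of_nonneg_left (by linarith) (by linarith)
        _ ≤ _ := mul_le_mul_of_nonneg_right (by linarith) (by linarith)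
    have g5 : EZ + Real.exp (-(W.card / n : ℝ)) - 2 * EU ≤ 1 / 2 - 64 * p := by nlinarith
    have g6 := mul_le_mul_of_nonneg_left g5 hn0.le
    linarith

end PRCode
end

noncomputable section
namespace PRCode
open Coded
open scoped ENNReal

/-! ### Expectations -/

/-- The expectation of a nonnegative function, which may be infinite. -/
def expect {α : Type*} (p : PMF α) (g : α → ℝ≥0∞) : ℝ≥0∞ := ∑' a, p a * g a

open Classical in
/-- The indicator of a proposition. -/
def ind (P : Prop) : ℝ≥0∞ := if P then 1 else 0

theorem ind_of_true {P : Prop} (h : P) : ind P = 1 := if_pos h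

theorem ind_of_false {P : Prop} (h : ¬ P) : ind P = 0 := if_neg h

theorem ind_le_one (P : Prop) : ind P ≤ 1 := by
  by_cases h : P <;> simp [ind, h]

theorem ind_mono {P Q : Prop} (h : P → Q) : ind P ≤ ind Q := by
  by_cases hP : P
  · rw [ind_of_true hP, ind_of_true (h hP)]
  · rw [ind_of_false hP]; exact zero_le

theorem ind_or_le (P Q : Prop) : ind (P ∨ Q) ≤ ind P + ind Q := by
  by_cases hP : P <;> by_cases hQ : Q <;> simp [ind, hP, hQ]

section
variable {α β : Type*}

theorem bind_apply_eq_expect (p : PMF α) (f : α → PMF β) (b : β) :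
    p.bind f b = expect p fun a => f a b := PMF.bind_apply _ _ _

theorem expect_mono {p : PMF α} {g h : α → ℝ≥0∞} (H : ∀ a ∈ p.support, g a ≤ h a) :
    expect p g ≤ expect p h := by
  refine ENNReal.tsum_le_tsum fun a => ?_
  by_cases ha : a ∈ p.support
  · exact mul_le_mul_right (H a ha) _
  · rw [(PMF.apply_eq_zero_iff p a).2 ha, zero_mul, zero_mul]

theorem expect_const (p : PMF α) (c : ℝ≥0∞) : expect p (fun _ => c) = c := by
  rw [expect, ENNReal.tsum_mul_right, p.tsum_coe, one_mul]

theorem expect_le_of_forall {p : PMF α} {g : α → ℝ≥0∞} {c : ℝ≥0∞}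
    (H : ∀ a ∈ p.support, g a ≤ c) : expect p g ≤ c :=
  (expect_mono H).trans (expect_const p c).le

theorem expect_add (p : PMF α) (g h : α → ℝ≥0∞) :
    expect p (fun a => g a + h a) = expect p g + expect p h := by
  simp only [expect, mul_add]
  exact ENNReal.tsum_add

theorem expect_comm (p : PMF α) (q : PMF β) (g : α → β → ℝ≥0∞) :
    expect p (fun a => expect q fun b => g a b) = expect q fun b => expect p fun a => g a b := by
  simp only [expect, ← ENNReal.tsum_mul_left]
  rw [ENNReal.tsum_comm]
  refine tsum_congr fun b => tsum_congr fun a => ?_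
  ring

theorem expect_bind (p : PMF α) (f : α → PMF β) (g : β → ℝ≥0∞) :
    expect (p.bind f) g = expect p fun a => expect (f a) g := by
  simp only [expect, PMF.bind_apply, ← ENNReal.tsum_mul_left, ← ENNReal.tsum_mul_right]
  rw [ENNReal.tsum_comm]
  refine tsum_congr fun b => tsum_congr fun a => ?_
  ring

theorem expect_pure (a : α) (g : α → ℝ≥0∞) : expect (PMF.pure a) g = g a := by
  rw [expect, tsum_eq_single a]
  · simp
  · intro b hb; simp [PMF.pure_apply, hb]

theorem expect_map (p : PMF α) (f : α → β) (g : β → ℝ≥0∞) :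
    expect (p.map f) g = expect p fun a => g (f a) := by
  rw [PMF.map, expect_bind]
  simp only [Function.comp_apply, expect_pure]

open Classical in
theorem expect_uniform_le [Fintype α] [Nonempty α] (P : α → Prop) {c : ℝ}
    (h : ((Finset.univ.filter P).card : ℝ) ≤ Fintype.card α * c) :
    expect (PMF.uniformOfFintype α) (fun a => ind (P a)) ≤ ENNReal.ofReal c := by
  have hcard : (0 : ℝ) < Fintype.card α := by exact_mod_cast Fintype.card_pos
  simp only [expect, PMF.uniformOfFintype_apply, tsum_fintype, ind]
  rw [← Finset.mul_sum, Finset.sum_ite, Finset.sum_const_zero, add_zero, Finset.sum_const,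
    nsmul_one, mul_comm, ← div_eq_mul_inv]
  refine ENNReal.div_le_of_le_mul ?_
  rw [← ENNReal.ofReal_natCast, ← ENNReal.ofReal_natCast, ← ENNReal.ofReal_mul' (Nat.cast_nonneg _)]
  refine ENNReal.ofReal_le_ofReal ?_
  rwa [mul_comm c]

end

/-! ### The noise that the construction and a channel apply to a codeword -/

section
variable {ρ n m : ℕ}

/-- After the perturbation, the set of symbols is contained in, or contains, the set of ones. -/
theorem unique_perturbed (y₀ : Fin n → Fin 2) (y₁ : Fin m → Fin n) (π : Equiv.Perm (Fin n)) :
    unique (perturbed y₀ y₁ π) ⊆ ones y₀ ∨ ones y₀ ⊆ unique (perturbed y₀ y₁ π) := by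
  have hkeep : ∀ x ∈ ones y₀, swapBy (unique y₁ \ ones y₀) (ones y₀ \ unique y₁) π x = x :=
    fun x hx => swapSymbol_of_notMem fun b hb =>
      (Finset.mem_sdiff.1 (mem_orderedBy.1 (List.of_mem_zip hb).1)).2 hx
  rcases le_total (unique y₁ \ ones y₀).card (ones y₀ \ unique y₁).card with h | h
  · left
    intro x hx
    obtain ⟨j, -, rfl⟩ := Finset.mem_image.1 hx
    by_cases hj : y₁ j ∈ ones y₀
    · rw [perturbed, hkeep _ hj]; exact hj
    · have hmem : y₁ j ∈ unique y₁ \ ones y₀ :=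
        Finset.mem_sdiff.2 ⟨Finset.mem_image_of_mem _ (Finset.mem_univ _), hj⟩
      have := mem_orderedBy.1 (List.of_mem_zip (pair_mem_zip h π hmem)).2
      exact (Finset.mem_sdiff.1 this).1
  · right
    intro x hx
    by_cases hx1 : x ∈ unique y₁
    · obtain ⟨j, -, rfl⟩ := Finset.mem_image.1 hx1
      exact Finset.mem_image.2 ⟨j, Finset.mem_univ _, hkeep _ hx⟩
    · have hz := mem_zip_swap (pair_mem_zip h π (Finset.mem_sdiff.2 ⟨hx, hx1⟩))
      have ha := mem_orderedBy.1 (List.of_mem_zip hz).1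
      obtain ⟨j, -, hj⟩ := Finset.mem_image.1 (Finset.mem_sdiff.1 ha).1
      refine Finset.mem_image.2 ⟨j, Finset.mem_univ _, ?_⟩
      rw [perturbed, hj]
      exact swapSymbol_of_mem (nodup_orderedBy _ _) hz

theorem card_symmDiff_of_subset {α : Type*} [DecidableEq α] {s t : Finset α} (h : s ⊆ t) :
    ((symmDiff s t).card : ℝ) = t.card - s.card := by
  rw [symmDiff_of_le h]
  exact Finset.cast_card_sdiff h

theorem unique_comp (g : Equiv.Perm (Fin n)) (y : Fin m → Fin n) :
    unique (g ∘ y) = (unique y).image g := by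
  rw [unique, unique, Finset.image_image]

/-- The perturbation minimises the distance to the given word among all relabellings. -/
theorem card_symmDiff_unique_perturbed (y₀ : Fin n → Fin 2) (y₁ : Fin m → Fin n)
    (π : Equiv.Perm (Fin n)) :
    ((symmDiff (ones y₀) (unique (perturbed y₀ y₁ π))).card : ℝ) =
      |((ones y₀).card : ℝ) - (unique y₁).card| := by
  have hcard : (unique (perturbed y₀ y₁ π)).card = (unique y₁).card := by
    obtain ⟨g, hg⟩ := exists_perturbed_eq y₀ y₁ π
    rw [hg, unique_comp, Finset.card_image_of_injective _ g.injective]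
  rw [← hcard]
  rcases unique_perturbed y₀ y₁ π with h | h
  · have := (Nat.cast_le (α := ℝ)).2 (Finset.card_le_card h)
    rw [symmDiff_comm, card_symmDiff_of_subset h, abs_of_nonneg (by linarith)]
  · have := (Nat.cast_le (α := ℝ)).2 (Finset.card_le_card h)
    rw [card_symmDiff_of_subset h, abs_of_nonpos (by linarith)]
    ring

/-- A word and a balanced map relabelled in the same way have the same lifts. -/
theorem liftWord_postcomp (hρ : 0 < ρ) (g : Equiv.Perm (Fin n)) (ψ : BalancedMap ρ n)
    (y : Fin m → Fin n) : liftWord hρ (ψ.postcomp g) (g ∘ y) = liftWord hρ ψ y := by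
  ext z
  simp only [liftWord, PMF.uniformOfFinset_apply, BalancedMap.postcomp, Function.comp_apply,
    EmbeddingLike.apply_eq_iff_eq]

theorem unique_of_mem_support_liftWord (hρ : 0 < ρ) (ψ : BalancedMap ρ n) {y : Fin m → Fin n}
    {z : Fin m → Fin (ρ * n)} (hz : z ∈ (liftWord hρ ψ y).support) :
    unique y = (unique z).image ψ.1 := by
  rw [liftWord, PMF.mem_support_uniformOfFinset_iff, Fintype.mem_piFinset] at hz
  have : y = ψ.1 ∘ z := funext fun j => ((Finset.mem_filter.1 (hz j)).2).symm
  rw [this, unique, unique, Finset.image_image]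

theorem toFinset_ofFn {N : ℕ} (z : Fin m → Fin N) : (List.ofFn z).toFinset = unique z := by
  ext x
  simp [unique, List.mem_ofFn]

/-- The law of the word that the decoder recovers when the word `y₀` has been encoded and sent
through the channel `E`. -/
def received (hρ : 0 < ρ) (E : Channel (Fin (ρ * n))) (y₀ : Fin n → Fin 2) :
    PMF (Fin n → Fin 2) :=
  (PMF.uniformOfFintype (BalancedMap ρ n)).bind fun ψ =>
    (perturbDifference n (indexLength n) y₀).bind fun y =>
      (liftWord hρ ψ y).bind fun z => (E (List.ofFn z)).map (indicatorWord ψ)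

/-- The event that, under a balanced map, the image of the set `Z` of sent symbols has atypical
size, or differs from the image of the set `W` of received symbols in more than `n / 2 - 56 * p * n`
values. -/
def Separates (p : ℝ) (ψ : BalancedMap ρ n) (Z W : Finset (Fin (ρ * n))) : Prop :=
  ¬ (|((Z.image ψ.1).card : ℝ) - n / 2| ≤ 3 * p * n ∧
      ((symmDiff (Z.image ψ.1) (W.image ψ.1)).card : ℝ) ≤ n / 2 - 56 * p * n)

/-- Independently of the relabelling `g` of the perturbation, a recovered word that is far from
the encoded one reveals a bad balanced map. -/
theorem separates_of_far {p : ℝ} (hp0 : 0 < p) {y₀ : Fin n → Fin 2}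
    (hy₀ : |((ones y₀).card : ℝ) - n / 2| ≤ p * n) {y₁ : Fin m → Fin n}
    {π : Equiv.Perm (Fin n)} {g : Equiv.Perm (Fin n)} (hg : perturbed y₀ y₁ π = g ∘ y₁)
    {ψ : BalancedMap ρ n} {z : Fin m → Fin (ρ * n)} (hz : unique y₁ = (unique z).image ψ.1)
    {w : List (Fin (ρ * n))}
    (h : (1 / 2 - p) * n < hammingDist y₀ (indicatorWord (ψ.postcomp g) w)) :
    Separates p ψ (unique z) w.toFinset := by
  rintro ⟨h1, h2⟩
  have hpn : 0 ≤ p * n := by positivity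
  have him : ∀ s : Finset (Fin (ρ * n)), s.image (ψ.postcomp g).1 = (s.image ψ.1).image g := by
    intro s; rw [Finset.image_image]; rfl
  have h3 := card_symmDiff_unique_perturbed y₀ y₁ π
  have h4 := card_symmDiff_triangle (ones y₀) (unique (perturbed y₀ y₁ π))
    (w.toFinset.image (ψ.postcomp g).1)
  rw [← ones_indicatorWord, ← hammingDist_eq_card, ones_indicatorWord, him, hg, unique_comp, hz,
    ← Finset.image_symmDiff _ _ g.injective, Finset.card_image_of_injective _ g.injective] at h4
  rw [hg, unique_comp, hz] at h3
  have h5 := (Nat.cast_le (α := ℝ)).2 h4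
  push_cast at h5
  rw [h3] at h5
  have h6 := abs_sub_le ((ones y₀).card : ℝ) (n / 2) ((unique z).image ψ.1).card
  rw [abs_sub_comm (n / 2 : ℝ)] at h6
  linarith

/-- For fixed sent and received words, the balanced map is unlikely to separate their sets of
symbols: it would have to miss an atypical number of values of one of three fixed sets. -/
theorem expect_separates_le {p : ℝ} (hp0 : 0 < p) (hp : p < 1 / 2000) (hn : 16 ≤ n * p)
    (hρ : 100 ≤ ρ * p) {z : Fin m → Fin (ρ * n)} {w : List (Fin (ρ * n))} {k : ℕ}
    (hm : m = indexLength n)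
    (hz : m - p * n ≤ (unique z).card) (hk : k ≤ (1 - 200 * p) * m)
    (he : Edits k (List.ofFn z) w) :
    expect (PMF.uniformOfFintype (BalancedMap ρ n))
      (fun ψ => ind (Separates p ψ (unique z) w.toFinset)) ≤
        6 * ENNReal.ofReal (Real.exp (-(p ^ 2 / 16 * n))) := by
  have hd := he.card_sdiff_le
  rw [toFinset_ofFn] at hd
  have hZm := card_unique_le z
  have hmn : m ≤ n := hm ▸ indexLength_le n
  have hkm : k ≤ m := by
    have : (k : ℝ) ≤ m := hk.trans (by nlinarith [(Nat.cast_nonneg m : (0 : ℝ) ≤ m)])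
    exact_mod_cast this
  set Z := unique z
  set W := w.toFinset
  have hU : (Z ∪ W).card ≤ 2 * n := by
    have : (Z ∪ W).card = Z.card + (W \ Z).card := by
      rw [← Finset.union_sdiff_self_eq_union, Finset.card_union_of_disjoint Finset.disjoint_sdiff]
    omega
  have htail : ∀ T : Finset (Fin (ρ * n)), T ⊆ Z ∪ W →
      expect (PMF.uniformOfFintype (BalancedMap ρ n)) (fun ψ =>
        ind (2 * p * n < |(missed ψ T : ℝ) - n * Real.exp (-(T.card / n))|)) ≤
        2 * ENNReal.ofReal (Real.exp (-(p ^ 2 / 16 * n))) := by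
    intro T hT
    have h1 := card_abs_missed_sub_gt_le hp0 (by linarith) hn hρ
      ((Finset.card_le_card hT).trans hU)
    have h2 := expect_uniform_le (fun ψ : BalancedMap ρ n =>
      2 * p * n < |(missed ψ T : ℝ) - n * Real.exp (-(T.card / n))|)
      (c := 2 * Real.exp (-(p ^ 2 / 16 * n))) (by linarith)
    rwa [ENNReal.ofReal_mul two_pos.le, ENNReal.ofReal_ofNat] at h2
  have hle : ∀ ψ : BalancedMap ρ n, ind (Separates p ψ Z W) ≤
      ind (2 * p * n < |(missed ψ Z : ℝ) - n * Real.exp (-(Z.card / n))|) +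
      (ind (2 * p * n < |(missed ψ W : ℝ) - n * Real.exp (-(W.card / n))|) +
      ind (2 * p * n < |(missed ψ (Z ∪ W) : ℝ) - n * Real.exp (-((Z ∪ W).card / n))|)) := by
    intro ψ
    refine (ind_mono fun hs => ?_).trans ((ind_or_le _ _).trans
      (add_le_add_right (ind_or_le _ _) _))
    by_contra! hcon
    refine hs (card_symmDiff_image_le hm hp0 hp hn ψ hz hZm hk hd.1 hd.2 fun T hT => ?_)
    simp only [Finset.mem_insert, Finset.mem_singleton] at hT
    rcases hT with rfl | rfl | rfl
    · exact hcon.1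
    · exact hcon.2.1
    · exact hcon.2.2
  refine (expect_mono fun ψ _ => hle ψ).trans ?_
  rw [expect_add, expect_add]
  refine (add_le_add (htail Z Finset.subset_union_left)
    (add_le_add (htail W Finset.subset_union_right) (htail _ subset_rfl))).trans (le_of_eq ?_)
  ring

/-- With overwhelming probability, the recovered word is close to the encoded one. -/
theorem expect_received_far_le {p : ℝ} (hp0 : 0 < p) (hp : p < 1 / 2000) (hn : 16 ≤ n * p)
    (hρ0 : 0 < ρ) (hρ : 100 ≤ ρ * p) {E : Channel (Fin (ρ * n))}
    (hE : EditBounded (1 - 200 * p) E) {y₀ : Fin n → Fin 2}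
    (hy₀ : |((ones y₀).card : ℝ) - n / 2| ≤ p * n) :
    expect (received hρ0 E y₀) (fun y' => ind ((1 / 2 - p) * n < hammingDist y₀ y')) ≤
      7 * ENNReal.ofReal (Real.exp (-(p ^ 2 / 16 * n))) := by
  have hn0 : 0 < n := by
    by_contra h
    have : n = 0 := by omega
    subst this; simp at hn; linarith
  have hne : Nonempty (Fin (indexLength n) → Fin (ρ * n)) := ⟨fun _ => ⟨0, by positivity⟩⟩
  let bad (ψ : BalancedMap ρ n) (z : Fin (indexLength n) → Fin (ρ * n)) : ℝ≥0∞ :=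
    expect (E (List.ofFn z)) fun w => ind (Separates p ψ (unique z) w.toFinset)
  -- relabelling by the perturbation can be moved into `ψ`, whose distribution does not change;
  -- the bad event and the law of `z` then no longer depend on the encoded word
  have hrelabel : ∀ (y₁ : Fin (indexLength n) → Fin n) (π : Equiv.Perm (Fin n)),
      expect (PMF.uniformOfFintype (BalancedMap ρ n)) (fun ψ =>
        expect (liftWord hρ0 ψ (perturbed y₀ y₁ π)) fun z => expect (E (List.ofFn z)) fun w =>
          ind ((1 / 2 - p) * n < hammingDist y₀ (indicatorWord ψ w))) ≤
      expect (PMF.uniformOfFintype (BalancedMap ρ n)) (fun ψ =>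
        expect (liftWord hρ0 ψ y₁) (bad ψ)) := by
    intro y₁ π
    obtain ⟨g, hg⟩ := exists_perturbed_eq y₀ y₁ π
    rw [← map_postcomp_uniform g, expect_map]
    rw [map_postcomp_uniform g]
    refine expect_mono fun ψ _ => ?_
    rw [hg, liftWord_postcomp]
    refine expect_mono fun z hz => expect_mono fun w _ => ind_mono fun h => ?_
    exact separates_of_far hp0 hy₀ hg (unique_of_mem_support_liftWord hρ0 ψ hz) h
  calc expect (received hρ0 E y₀) (fun y' => ind ((1 / 2 - p) * n < hammingDist y₀ y'))
      = expect (PMF.uniformOfFintype (Fin (indexLength n) → Fin n)) (fun y₁ =>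
          expect (PMF.uniformOfFintype (Equiv.Perm (Fin n))) fun π =>
          expect (PMF.uniformOfFintype (BalancedMap ρ n)) fun ψ =>
          expect (liftWord hρ0 ψ (perturbed y₀ y₁ π)) fun z => expect (E (List.ofFn z)) fun w =>
            ind ((1 / 2 - p) * n < hammingDist y₀ (indicatorWord ψ w))) := by
        simp only [received, perturbDifference_eq, expect_bind, expect_map]
        rw [expect_comm]
        congr 1; funext y₁
        rw [expect_comm]
    _ ≤ expect (PMF.uniformOfFintype (Fin (indexLength n) → Fin n)) (fun y₁ =>
          expect (PMF.uniformOfFintype (BalancedMap ρ n)) fun ψ =>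
          expect (liftWord hρ0 ψ y₁) (bad ψ)) :=
        expect_mono fun y₁ _ => expect_le_of_forall fun π _ => hrelabel y₁ π
    _ = expect (PMF.uniformOfFintype (Fin (indexLength n) → Fin (ρ * n))) (fun z =>
          expect (E (List.ofFn z)) fun w => expect (PMF.uniformOfFintype (BalancedMap ρ n))
            fun ψ => ind (Separates p ψ (unique z) w.toFinset)) := by
        rw [expect_comm]
        simp only [← expect_bind, bind_liftWord_uniform hρ0]
        rw [expect_comm]
        congr 1; funext z
        rw [expect_comm]
    _ ≤ expect (PMF.uniformOfFintype (Fin (indexLength n) → Fin (ρ * n))) (fun z =>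
          ind (p * n ≤ indexLength n - (unique z).card) +
            6 * ENNReal.ofReal (Real.exp (-(p ^ 2 / 16 * n)))) := by
        refine expect_mono fun z _ => expect_le_of_forall fun w hw => ?_
        by_cases hz : p * n ≤ indexLength n - (unique z).card
        · rw [ind_of_true hz]
          exact (expect_le_of_forall fun _ _ => ind_le_one _).trans le_self_add
        · rw [ind_of_false hz, zero_add]
          obtain ⟨k, hk, he⟩ := hE _ w hw
          rw [List.length_ofFn] at hk
          exact expect_separates_le hp0 hp hn hρ rfl (by linarith) hk he
    _ ≤ 7 * ENNReal.ofReal (Real.exp (-(p ^ 2 / 16 * n))) := by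
        rw [expect_add, expect_const]
        have h1 := expect_uniform_le _ (card_repeats_le (indexLength_le n) hp0 hn0 hρ)
        have h2 : Real.exp (-(p / 2 * n)) ≤ Real.exp (-(p ^ 2 / 16 * n)) := by
          refine Real.exp_le_exp.2 (neg_le_neg ?_)
          refine mul_le_mul_of_nonneg_right ?_ (Nat.cast_nonneg n)
          nlinarith
        refine (add_le_add_left (h1.trans (ENNReal.ofReal_le_ofReal h2)) _).trans (le_of_eq ?_)
        ring

end
end PRCode
end

noncomputable section
namespace PRCode
open Coded
open scoped ENNReal

/-! ### Negligible functions -/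

theorem Negligible.add {f g : ℕ → ℝ} (hf : Negligible f) (hg : Negligible g) :
    Negligible fun l => f l + g l := by
  refine ⟨fun l => add_nonneg (hf.1 l) (hg.1 l), fun C hC => ?_⟩
  obtain ⟨a, ha⟩ := hf.2 (C + 1) (by linarith)
  obtain ⟨b, hb⟩ := hg.2 (C + 1) (by linarith)
  refine ⟨max 2 (max a b), fun l hl => ?_⟩
  simp only [max_lt_iff] at hl
  have hl2 : (2 : ℝ) ≤ l := by exact_mod_cast hl.1.le
  have h1 := ha l hl.2.1
  have h2 := hb l hl.2.2
  have h3 : (l : ℝ) ^ (-(C + 1)) * l = (l : ℝ) ^ (-C) := by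
    rw [← Real.rpow_add_one (by linarith)]; congr 1; ring
  have h4 : (0 : ℝ) ≤ (l : ℝ) ^ (-(C + 1)) := by positivity
  nlinarith

theorem negligible_exp_neg {c : ℝ} (K : ℝ) (hK : 0 ≤ K) (hc : 0 < c) :
    Negligible fun l => K * Real.exp (-(c * l)) := by
  refine ⟨fun l => by positivity, fun C _ => ?_⟩
  have h := ((tendsto_rpow_mul_exp_neg_mul_atTop_nhds_zero C c hc).const_mul K).comp
    tendsto_natCast_atTop_atTop
  rw [mul_zero] at h
  obtain ⟨a, ha⟩ := Filter.eventually_atTop.1 (h.eventually_le_const one_pos)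
  refine ⟨a, fun l hl => ?_⟩
  have h1 := ha l hl.le
  have hl0 : (0 : ℝ) < l := by exact_mod_cast (Nat.zero_le a).trans_lt hl
  rw [Real.rpow_neg hl0.le, ← one_div, le_div_iff₀ (by positivity)]
  simp only [Function.comp_apply, neg_mul] at h1
  linarith

/-! ### Channels given by random maps of words -/

open Classical in
/-- The channel that applies a random map to the words of length `n` and returns all other strings
unchanged, as substitution-boundedness constrains a channel at every length. -/
def wordChannel {q n : ℕ} (G : (Fin n → Fin q) → PMF (Fin n → Fin q)) : Channel (Fin q) := fun l =>
  if h : ∃ x : Fin n → Fin q, l = List.ofFn x then (G h.choose).map List.ofFn else PMF.pure l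

theorem wordChannel_ofFn {q n : ℕ} (G : (Fin n → Fin q) → PMF (Fin n → Fin q))
    (x : Fin n → Fin q) : wordChannel G (List.ofFn x) = (G x).map List.ofFn := by
  have h : ∃ x' : Fin n → Fin q, List.ofFn x = List.ofFn x' := ⟨x, rfl⟩
  rw [wordChannel, dif_pos h, ← List.ofFn_injective h.choose_spec]

theorem substitutionBounded_wordChannel {q n : ℕ} {p : ℝ} (hp : 0 ≤ p)
    {G : (Fin n → Fin q) → PMF (Fin n → Fin q)}
    (hG : ∀ x, ∀ y ∈ (G x).support, (hammingDist x y : ℝ) ≤ p * n) :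
    SubstitutionBounded p (wordChannel G) := by
  intro k y z hz
  by_cases hk : k = n
  · subst hk
    rw [wordChannel_ofFn, PMF.support_map] at hz
    obtain ⟨w, hw, rfl⟩ := hz
    exact ⟨w, rfl, hG y w hw⟩
  · have hx : ¬ ∃ x : Fin n → Fin q, List.ofFn y = List.ofFn x := by
      rintro ⟨x, hx⟩
      have := congrArg List.length hx
      simp only [List.length_ofFn] at this
      exact hk this
    rw [wordChannel, dif_neg hx, PMF.support_pure, Set.mem_singleton_iff] at hz
    refine ⟨y, hz, ?_⟩
    rw [hammingDist_self]
    simp only [Nat.cast_zero]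
    positivity

theorem apply_some_add_apply_none_le {α : Type*} (p : PMF (Option α)) (a : α) :
    p (some a) + p none ≤ 1 := by
  classical
  rw [← p.tsum_coe]
  have := ENNReal.sum_le_tsum (f := p) {some a, none}
  rwa [Finset.sum_pair (by simp)] at this

/-! ### Robustness of the indexing construction -/

namespace Scheme

variable {S : Scheme fun _ => 2}

/-- The joint law of a key and of an encoding of the message `msg` under it. -/
def sent (S : Scheme fun _ => 2) (l : ℕ) (msg : Fin (S.msgLength l) → Fin 2) :
    PMF (S.Key l × (Fin (S.blockLength l) → Fin 2)) :=
  (S.key l).bind fun sk => (S.enc l sk msg).map fun x => (sk, x)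

theorem transmit_wordChannel (l : ℕ) (msg : Fin (S.msgLength l) → Fin 2)
    (G : (Fin (S.blockLength l) → Fin 2) → PMF (Fin (S.blockLength l) → Fin 2)) :
    S.transmit l (wordChannel G) msg (some msg) =
      expect (S.sent l msg) fun x => expect (G x.2) fun y =>
        S.dec l x.1 (List.ofFn y) (some msg) := by
  simp only [transmit, sent, wordChannel_ofFn, bind_apply_eq_expect, expect_bind, expect_map]

theorem transmit_indexing {ρ : ℕ} (hρ : 0 < ρ) (l : ℕ) (msg : Fin (S.msgLength l) → Fin 2)
    (E : Channel (Fin (ρ * S.blockLength l))) :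
    (indexing S ρ hρ).transmit l E msg (some msg) =
      expect (S.sent l msg) fun x => expect (received hρ E x.2) fun y =>
        S.dec l x.1 (List.ofFn y) (some msg) := by
  have h : (indexing S ρ hρ).transmit l E msg = (S.sent l msg).bind fun x =>
      (received hρ E x.2).bind fun y => S.dec l x.1 (List.ofFn y) := by
    simp only [transmit, sent, indexing, received, PMF.bind_bind, PMF.bind_map, Function.comp_def]
    congr 1; funext sk
    rw [PMF.bind_comm]
  have h' : ((S.sent l msg).bind fun x =>
      (received hρ E x.2).bind fun y => S.dec l x.1 (List.ofFn y)) (some msg) =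
      expect (S.sent l msg) fun x => expect (received hρ E x.2) fun y =>
        S.dec l x.1 (List.ofFn y) (some msg) := by
    simp only [bind_apply_eq_expect]
  exact (DFunLike.congr_fun h (some msg)).trans h'

/-- An encoding is unlikely to be so close to a fixed word `c` that a channel may replace it by
`c`: the decoder rejects `c` by soundness, but has to accept the output of the channel. -/
theorem expect_close_le {p ν₁ ν₂ : ℝ} (hp : p ≤ 1 / 2) {l : ℕ} {msg : Fin (S.msgLength l) → Fin 2}
    (h₁ : ∀ E, SubstitutionBounded (1 / 2 - p) E →
      1 - ν₁ ≤ (S.transmit l E msg (some msg)).toReal)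
    (h₂ : ∀ y : List (Fin 2), 1 - ν₂ ≤ (((S.key l).bind fun sk => S.dec l sk y) none).toReal)
    (c : Fin (S.blockLength l) → Fin 2) :
    expect (S.sent l msg) (fun x =>
      ind ((hammingDist x.2 c : ℝ) ≤ (1 / 2 - p) * S.blockLength l)) ≤
        ENNReal.ofReal (ν₁ + ν₂) := by
  classical
  set D := S.sent l msg
  let A : (Fin (S.blockLength l) → Fin 2) → Prop := fun x =>
    (hammingDist x c : ℝ) ≤ (1 / 2 - p) * S.blockLength l
  let G : (Fin (S.blockLength l) → Fin 2) → PMF (Fin (S.blockLength l) → Fin 2) := fun x =>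
    PMF.pure (if A x then c else x)
  have hG := h₁ (wordChannel G) (substitutionBounded_wordChannel (by linarith) fun x y hy => by
    rw [PMF.support_pure, Set.mem_singleton_iff] at hy
    rw [hy]
    split
    · assumption
    · rw [hammingDist_self]
      have : 0 ≤ 1 / 2 - p := by linarith
      simp only [Nat.cast_zero]
      positivity)
  have hsound := h₂ (List.ofFn c)
  set a := S.transmit l (wordChannel G) msg (some msg) with ha
  set b := ((S.key l).bind fun sk => S.dec l sk (List.ofFn c)) none with hb
  set P := expect D (fun x => ind (A x.2)) with hP
  have hbD : b = expect D fun x => S.dec l x.1 (List.ofFn c) none := by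
    simp only [hb, D, sent, bind_apply_eq_expect, expect_bind, expect_map, expect_const]
  -- when `x` is close to `c`, both `a` and `b` count decodings of the same word `c`, with different
  -- results
  have hsum : a + P + b ≤ 2 := by
    rw [ha, transmit_wordChannel, hbD, hP, ← expect_add, ← expect_add]
    refine le_of_le_of_eq (expect_le_of_forall fun x _ => ?_) one_add_one_eq_two
    simp only [G, expect_pure]
    by_cases hx : A x.2
    · rw [if_pos hx, ind_of_true hx, add_right_comm]
      exact add_le_add_left (apply_some_add_apply_none_le _ _) 1
    · rw [if_neg hx, ind_of_false hx, add_zero]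
      exact add_le_add (PMF.coe_le_one _ _) (PMF.coe_le_one _ _)
  have ha' : a ≠ ∞ := PMF.apply_ne_top _ _
  have hb' : b ≠ ∞ := PMF.apply_ne_top _ _
  have hP' : P ≠ ∞ := ne_top_of_le_ne_top ENNReal.ofNat_ne_top
    ((le_add_self.trans le_self_add).trans hsum)
  rw [← ENNReal.ofReal_toReal hP']
  refine ENNReal.ofReal_le_ofReal ?_
  have hreal := ENNReal.toReal_mono ENNReal.ofNat_ne_top hsum
  rw [ENNReal.toReal_add (by finiteness) hb', ENNReal.toReal_add ha' hP',
    ENNReal.toReal_ofNat] at hreal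
  linarith

/-- A word with too few or too many ones is close to one of the two constant words. -/
theorem close_to_const_of_unbalanced {n : ℕ} {p : ℝ} {x : Fin n → Fin 2}
    (h : ¬ |((ones x).card : ℝ) - n / 2| ≤ p * n) :
    (hammingDist x (fun _ => 0) : ℝ) ≤ (1 / 2 - p) * n ∨
      (hammingDist x (fun _ => 1) : ℝ) ≤ (1 / 2 - p) * n := by
  have h0 : hammingDist x (fun _ => 0) = (ones x).card := by
    rw [hammingDist_eq_card]
    have : ones (fun _ : Fin n => (0 : Fin 2)) = ∅ := by ext i; simp [ones]
    rw [this, ← Finset.bot_eq_empty, symmDiff_bot]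
  have h1 : (hammingDist x (fun _ => 1) : ℝ) = n - (ones x).card := by
    rw [hammingDist_eq_card]
    have : ones (fun _ : Fin n => (1 : Fin 2)) = Finset.univ := by ext i; simp [ones]
    rw [this, card_symmDiff_of_subset (Finset.subset_univ _), Finset.card_univ, Fintype.card_fin]
  rw [h0, h1]
  rcases lt_abs.1 (not_le.1 h) with h | h
  · right; linarith
  · left; linarith

/-- The noise that the construction and the channel inflict on the binary codeword exceeds its
radius with small probability, and otherwise agrees with a substitution-bounded channel, which the
decoder corrects. -/
theorem transmit_indexing_ge {p ν₁ ν₂ : ℝ} (hp0 : 0 < p) (hp : p < 1 / 2000) {ρ : ℕ} (hρ0 : 0 < ρ)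
    (hρ : 100 ≤ ρ * p) {l : ℕ} (hn : 16 ≤ S.blockLength l * p)
    {msg : Fin (S.msgLength l) → Fin 2}
    (hν₁ : 0 ≤ ν₁) (hν₂ : 0 ≤ ν₂)
    (h₁ : ∀ E, SubstitutionBounded (1 / 2 - p) E →
      1 - ν₁ ≤ (S.transmit l E msg (some msg)).toReal)
    (h₂ : ∀ y : List (Fin 2), 1 - ν₂ ≤ (((S.key l).bind fun sk => S.dec l sk y) none).toReal)
    {E : Channel (Fin (ρ * S.blockLength l))} (hE : EditBounded (1 - 200 * p) E) :
    1 - (3 * ν₁ + 2 * ν₂ + 7 * Real.exp (-(p ^ 2 / 16 * S.blockLength l))) ≤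
      ((indexing S ρ hρ0).transmit l E msg (some msg)).toReal := by
  classical
  let far (x y : Fin (S.blockLength l) → Fin 2) : Prop :=
    (1 / 2 - p) * S.blockLength l < hammingDist x y
  -- the noise of the construction, cut off where it exceeds the radius of the binary code
  let G : (Fin (S.blockLength l) → Fin 2) → PMF (Fin (S.blockLength l) → Fin 2) := fun x =>
    (received hρ0 E x).map fun y => if far x y then x else y
  have hG := h₁ (wordChannel G) (substitutionBounded_wordChannel (by linarith) fun x y hy => by
    rw [PMF.support_map] at hy
    obtain ⟨y, -, rfl⟩ := hy
    beta_reduce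
    split
    · rw [hammingDist_self]
      have : 0 ≤ 1 / 2 - p := by linarith
      simp only [Nat.cast_zero]
      positivity
    · rename_i h
      exact not_lt.1 h)
  have hcut : S.transmit l (wordChannel G) msg (some msg) ≤
      (indexing S ρ hρ0).transmit l E msg (some msg) + expect (S.sent l msg) fun x =>
        expect (received hρ0 E x.2) fun y => ind (far x.2 y) := by
    rw [transmit_wordChannel, transmit_indexing, ← expect_add]
    refine expect_mono fun x _ => ?_
    rw [← expect_add, expect_map]
    refine expect_mono fun y _ => ?_
    by_cases h : far x.2 y
    · rw [ind_of_true h]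
      exact (PMF.coe_le_one _ _).trans le_add_self
    · rw [if_neg h]; exact le_self_add
  have hfar : (expect (S.sent l msg) fun x =>
      expect (received hρ0 E x.2) fun y => ind (far x.2 y)) ≤
      ENNReal.ofReal (2 * (ν₁ + ν₂) + 7 * Real.exp (-(p ^ 2 / 16 * S.blockLength l))) := by
    calc (expect (S.sent l msg) fun x => expect (received hρ0 E x.2) fun y => ind (far x.2 y))
        ≤ expect (S.sent l msg) fun x =>
          (ind ((hammingDist x.2 (fun _ => 0) : ℝ) ≤ (1 / 2 - p) * S.blockLength l) +
            ind ((hammingDist x.2 (fun _ => 1) : ℝ) ≤ (1 / 2 - p) * S.blockLength l)) +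
            7 * ENNReal.ofReal (Real.exp (-(p ^ 2 / 16 * S.blockLength l))) := by
          refine expect_mono fun x _ => ?_
          by_cases h : |((ones x.2).card : ℝ) - S.blockLength l / 2| ≤ p * S.blockLength l
          · exact (expect_received_far_le hp0 hp hn hρ0 hρ hE h).trans le_add_self
          · refine (expect_le_of_forall fun y _ => ind_le_one _).trans (le_trans ?_ le_self_add)
            rw [← ind_of_true (close_to_const_of_unbalanced h)]
            exact ind_or_le _ _
      _ ≤ (ENNReal.ofReal (ν₁ + ν₂) + ENNReal.ofReal (ν₁ + ν₂)) +
            7 * ENNReal.ofReal (Real.exp (-(p ^ 2 / 16 * S.blockLength l))) := by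
          rw [expect_add, expect_add, expect_const]
          gcongr
          · exact expect_close_le (by linarith) h₁ h₂ _
          · exact expect_close_le (by linarith) h₁ h₂ _
      _ = _ := by
          rw [← ENNReal.ofReal_add (by positivity) (by positivity), ← two_mul,
            ← ENNReal.ofReal_ofNat 7, ← ENNReal.ofReal_mul (by norm_num),
            ← ENNReal.ofReal_add (by positivity) (by positivity)]
  have hreal := ENNReal.toReal_mono
    (by have := PMF.apply_ne_top ((indexing S ρ hρ0).transmit l E msg) (some msg); finiteness)
    (hcut.trans (add_le_add_right hfar _))
  rw [ENNReal.toReal_add (PMF.apply_ne_top _ _) ENNReal.ofReal_ne_top,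
    ENNReal.toReal_ofReal (by positivity)] at hreal
  linarith

theorem Robust.indexing {p : ℝ} (hp0 : 0 < p) (hp : p < 1 / 2000)
    (hR : S.Robust fun _ => {E | SubstitutionBounded (1 / 2 - p) E}) (hS : S.Sound)
    (hn : ∀ l, l ≤ S.blockLength l) {ρ : ℕ} (hρ0 : 0 < ρ) (hρ : 100 ≤ ρ * p) :
    (indexing S ρ hρ0).Robust fun _ => {E | EditBounded (1 - 200 * p) E} := by
  obtain ⟨ν₁, hν₁, h₁⟩ := hR
  obtain ⟨ν₂, hν₂, h₂⟩ := hS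
  -- the constant makes the error at least `1` for the short block lengths, where `n * p < 16`
  set K := 7 + Real.exp (p ^ 2 / 16 * (16 / p)) with hK
  have hK7 : 7 ≤ K := by linarith [Real.exp_pos (p ^ 2 / 16 * (16 / p))]
  refine ⟨fun l => ((ν₁ l + (ν₁ l + ν₁ l)) + (ν₂ l + ν₂ l)) + K * Real.exp (-(p ^ 2 / 16 * l)),
    ((hν₁.add (hν₁.add hν₁)).add (hν₂.add hν₂)).add
      (negligible_exp_neg K (by linarith) (by positivity)), fun l E hE msg => ?_⟩
  have e1 := hν₁.1 l
  have e2 := hν₂.1 l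
  have hl : (l : ℝ) ≤ S.blockLength l := by exact_mod_cast hn l
  by_cases hnp : 16 ≤ S.blockLength l * p
  · have h := transmit_indexing_ge hp0 hp hρ0 hρ hnp e1 e2 (fun E hE => h₁ l E hE msg) (h₂ l) hE
    have h3 : 7 * Real.exp (-(p ^ 2 / 16 * S.blockLength l)) ≤
        K * Real.exp (-(p ^ 2 / 16 * l)) := by
      gcongr
    beta_reduce
    linarith
  · have h3 : 1 ≤ K * Real.exp (-(p ^ 2 / 16 * l)) := by
      have h4 : (l : ℝ) ≤ 16 / p := by
        rw [le_div_iff₀ hp0]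
        nlinarith
      calc (1 : ℝ) = Real.exp (p ^ 2 / 16 * l) * Real.exp (-(p ^ 2 / 16 * l)) := by
            rw [← Real.exp_add, add_neg_cancel, Real.exp_zero]
        _ ≤ Real.exp (p ^ 2 / 16 * (16 / p)) * Real.exp (-(p ^ 2 / 16 * l)) := by gcongr
        _ ≤ _ := mul_le_mul_of_nonneg_right (by linarith) (Real.exp_pos _).le
    have h5 : 0 ≤ ((PRCode.indexing S ρ hρ0).transmit l E msg (some msg)).toReal :=
      ENNReal.toReal_nonneg
    beta_reduce
    linarith

end Scheme
end PRCode
end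

theorem mainTheorem3 :
    ∃ C₀ Crob : ℝ, 1 ≤ C₀ ∧ 1 ≤ Crob ∧
      ∀ p₀ : ℝ, 0 < p₀ → p₀ < (10 * Crob)⁻¹ →
      ∀ S : PRCode.Scheme (fun _ => 2),
        S.IsPRC (fun _ => {E | PRCode.SubstitutionBounded (1 / 2 - p₀) E}) →
        (∀ l, l ≤ S.blockLength l) →
        ∀ (ρ : ℕ) (hρ : 0 < ρ), C₀ / p₀ ≤ (ρ : ℝ) →
          (PRCode.indexing S ρ hρ).IsPRC
            (fun _ => {E | PRCode.EditBounded (1 - Crob * p₀) E}) ∧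
          (∀ l, (PRCode.indexing S ρ hρ).alphabetSize l = ⌈(ρ : ℝ) * (S.blockLength l : ℝ)⌉₊) ∧
          (∀ l, (PRCode.indexing S ρ hρ).blockLength l ≤ S.blockLength l) := by
  refine ⟨100, 200, by norm_num, by norm_num, fun p₀ hp0 hp S hS hn ρ hρ hρp => ⟨?_, ?_, ?_⟩⟩
  · rw [div_le_iff₀ hp0] at hρp
    exact {
      efficient := hS.efficient.indexing_efficient ρ hρ
      robust := hS.robust.indexing hp0 (by norm_num at hp ⊢; exact hp) hS.sound hn hρ hρp
      sound := hS.sound.indexing hρ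
      undetectable := hS.undetectable.indexing hS.efficient hρ }
  · intro l
    rw [← Nat.cast_mul, Nat.ceil_natCast]
    rfl
  · exact fun l => PRCode.indexLength_le _
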